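/- Let $d\ge 1$ and let $\omega=(P_n,Q_n,R_n)_{n\in\mathbb Z}$ be a sequence of triples of nonnegative $d\times d$ matrices with $P_n+Q_n+R_n$ stochastic, distributed according to a probability measure $P$ (with expectation $E$) on the space $\Omega$ of such sequences. Write $\|A\|=\max_i\sum_j|A(i,j)|$. Assume Condition C: (C1) the shift $\theta$ on $\Omega$ preserves $P$ and is ergodic; (C2) $E\log(1-\|R_n+P_n\|)^{-1}<\infty$ and $E\log(1-\|R_n+Q_n\|)^{-1}<\infty$; (C3) for all $j$ and $n$, $\sum_iQ_n(i,j)>0$ and $\sum_iP_n(i,j)>0$, $P$-a.s.; (C4) with positive $P$-probability the layer $\{0\}\times\{1,\dots,d\}$ lies in one communication class of the following walk. Given $\omega$, let $X_t=(\xi(t),Y_t)$, $t\ge 0$, be the Markov chain on $\mathbb Z\times\{1,\dots,d\}$ that jumps from $(n,i)$ to $(n+1,j)$, $(n,j)$, $(n-1,j)$ with probability $P_n(i,j)$, $R_n(i,j)$, $Q_n(i,j)$ respectively. Let $(\zeta_n)_{n\in\mathbb Z}$ be the ($P$-a.s. unique) sequence of stochastic matrices with $\zeta_n=(I-Q_n\zeta_{n-1}-R_n)^{-1}P_n$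 for all $n$, put $A_n=(I-Q_n\zeta_{n-1}-R_n)^{-1}Q_n$ and $u_n=(I-Q_n\zeta_{n-1}-R_n)^{-1}\mathbf 1$, and let $\mathbf y_n=\lim_{a\to-\infty}\mathbf p_a\zeta_a\zeta_{a+1}\cdots\zeta_n$, where $\mathbf p_a$ are arbitrary probability row vectors (the limit exists $P$-a.s. and does not depend on them). Let the walk start from layer $0$ with $\mathrm{Prob}_\omega(X_0=(0,i))=\mu_\omega(i)$, where $\mu_\omega=\mathbf y_{-1}(\omega)$ for $P$-a.e. $\omega$; let $\mathbb P=\int P_\omega^\mu\,P(d\omega)$ be the annealed law, with expectation $\mathbb E$, and $T_1=\inf\{t:\xi(t)=1\}$. Assume that $\xi(t)\to+\infty$ $\mathbb P$-a.s. and that $v_P:=1/\mathbb E T_1>0$, i.e. $\mathbb E T_1<\infty$. Then the series $u_0+A_0u_{-1}+A_0A_{-1}u_{-2}+\cdots$ converges $P$-a.s., $E\big[\mathbf y_{-1}(u_0+A_0u_{-1}+A_0A_{-1}u_{-2}+\cdots)\big]$ is finite and positive, and $\mathbb P$-a.s. $$\lim_{n\to\infty}\frac{\xi(n)}{n}=\frac{1}{E\big[\mathbf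 y_{-1}(u_0+A_0u_{-1}+\cdots+A_0A_{-1}\cdots A_{-k}u_{-k-1}+\cdots)\big]}.$$ -/

import Mathlib

open MeasureTheory ProbabilityTheory Filter Topology
open scoped ENNReal Matrix

noncomputable section

namespace StripWalk

/-! ### The environment -/

/-- A triple `(P, Q, R)` of nonnegative `d × d` matrices such that `P + Q + R` is stochastic. -/
structure Triple (d : ℕ) where
  P : Matrix (Fin d) (Fin d) ℝ
  Q : Matrix (Fin d) (Fin d) ℝ
  R : Matrix (Fin d) (Fin d) ℝ
  P_nonneg : ∀ i j, 0 ≤ P i j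
  Q_nonneg : ∀ i j, 0 ≤ Q i j
  R_nonneg : ∀ i j, 0 ≤ R i j
  row_sum : ∀ i, ∑ j, (P + Q + R) i j = 1

/-- The σ-algebra on triples generated by all the matrix entries. -/
instance (d : ℕ) : MeasurableSpace (Triple d) :=
  MeasurableSpace.comap (fun t (i j : Fin d) => (t.P i j, t.Q i j, t.R i j)) MeasurableSpace.pi

/-- The space `Ω` of environments, with the product σ-algebra. -/
abbrev Env (d : ℕ) : Type := ℤ → Triple d

/-- The shift `(θ ω) n = ω (n + 1)`. -/
def shift {d : ℕ} (ω : Env d) : Env d := fun n => ω (n + 1)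

/-! ### The walk -/

/-- The strip `ℤ × {1, …, d}`. -/
abbrev Strip (d : ℕ) : Type := ℤ × Fin d

/-- The one-step transition probabilities of the walk in the environment `ω`. -/
def transProb {d : ℕ} (ω : Env d) (z w : Strip d) : ℝ :=
  if w.1 = z.1 + 1 then (ω z.1).P z.2 w.2
  else if w.1 = z.1 then (ω z.1).R z.2 w.2
  else if w.1 = z.1 - 1 then (ω z.1).Q z.2 w.2
  else 0

/-- The law of the next position of the walk in the environment `ω`, from the site `z`. -/
def stepMeasure {d : ℕ} (ω : Env d) (z : Strip d) : Measure (Strip d) :=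
  Measure.sum fun w => ENNReal.ofReal (transProb ω z w) • Measure.dirac w

lemma transProb_nonneg {d : ℕ} (ω : Env d) (z w : Strip d) : 0 ≤ transProb ω z w := by
  unfold transProb
  split_ifs
  · exact (ω z.1).P_nonneg _ _
  · exact (ω z.1).R_nonneg _ _
  · exact (ω z.1).Q_nonneg _ _
  · exact le_rfl

lemma stepMeasure_singleton {d : ℕ} (ω : Env d) (z w : Strip d) :
    stepMeasure ω z {w} = ENNReal.ofReal (transProb ω z w) := by
  unfold stepMeasure
  rw [Measure.sum_apply _ (measurableSet_singleton w), tsum_eq_single w]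
  · simp
  · intro v hv
    simp [hv]

instance {d : ℕ} (ω : Env d) (z : Strip d) : IsProbabilityMeasure (stepMeasure ω z) := by
  constructor
  have h1 : stepMeasure ω z Set.univ = ∑' w : Strip d, ENNReal.ofReal (transProb ω z w) := by
    unfold stepMeasure
    rw [Measure.sum_apply _ MeasurableSet.univ]
    simp
  have h2 : ∀ w ∉ ({z.1 + 1, z.1, z.1 - 1} : Finset ℤ) ×ˢ (Finset.univ : Finset (Fin d)),
      ENNReal.ofReal (transProb ω z w) = 0 := by
    intro w hw
    simp only [Finset.mem_product, Finset.mem_insert, Finset.mem_singleton, Finset.mem_univ,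
      and_true, not_or] at hw
    simp [transProb, hw.1, hw.2.1, hw.2.2]
  rw [h1, tsum_eq_sum h2, ← ENNReal.ofReal_sum_of_nonneg (fun w _ => transProb_nonneg ω z w),
    Finset.sum_product, Finset.sum_insert (by simp; omega), Finset.sum_insert (by simp; omega),
    Finset.sum_singleton, ← Finset.sum_add_distrib, ← Finset.sum_add_distrib]
  rw [← ENNReal.ofReal_one, ← (ω z.1).row_sum z.2]
  congr 1
  refine Finset.sum_congr rfl fun j _ => ?_
  have e1 : ¬ (z.1 = z.1 + 1) := by omega
  have e2 : ¬ (z.1 - 1 = z.1 + 1) := by omega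
  have e3 : ¬ (z.1 - 1 = z.1) := by omega
  simp only [transProb, if_true, if_neg e1, if_neg e2, if_neg e3, Matrix.add_apply]
  ring

/-- The transition kernel of the walk in the environment `ω`. -/
def stepKernel {d : ℕ} (ω : Env d) : Kernel (Strip d) (Strip d) where
  toFun := stepMeasure ω
  measurable' := measurable_of_countable _

instance {d : ℕ} (ω : Env d) : IsMarkovKernel (stepKernel ω) :=
  ⟨fun z => inferInstanceAs (IsProbabilityMeasure (stepMeasure ω z))⟩

/-- The transition kernel at time `n`, as a function of the path up to time `n`. -/
def pathKernel {d : ℕ} (ω : Env d) (n : ℕ) :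
    Kernel ((i : Finset.Iic n) → Strip d) (Strip d) :=
  (stepKernel ω).comap (fun x => x ⟨n, Finset.mem_Iic.2 le_rfl⟩) (by fun_prop)

instance {d : ℕ} (ω : Env d) (n : ℕ) : IsMarkovKernel (pathKernel ω n) := by
  unfold pathKernel; infer_instance

/-- The families `μ = (μ_ω)` of probability vectors on `{1, …, d}`, measurable in `ω`. -/
structure InitialLaw (d : ℕ) where
  vec : Env d → Fin d → ℝ
  measurable_vec : Measurable vec
  mem_simplex : ∀ ω, vec ω ∈ stdSimplex ℝ (Fin d)

/-- The initial distribution of the walk: the site `(0, i)` has mass `μ_ω(i)`. -/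
def initMeasure {d : ℕ} (μ : InitialLaw d) (ω : Env d) : Measure (Strip d) :=
  ∑ i, ENNReal.ofReal (μ.vec ω i) • Measure.dirac ((0, i) : Strip d)

instance {d : ℕ} (μ : InitialLaw d) (ω : Env d) : IsProbabilityMeasure (initMeasure μ ω) := by
  constructor
  simp only [initMeasure, Measure.coe_finsetSum, Finset.sum_apply, Measure.smul_apply,
    measure_univ, smul_eq_mul, mul_one]
  rw [← ENNReal.ofReal_sum_of_nonneg (fun i _ => (μ.mem_simplex ω).1 i), (μ.mem_simplex ω).2,
    ENNReal.ofReal_one]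

/-- The quenched law `P_ω^μ`: the law on path space of the time-homogeneous Markov chain with
the transition probabilities `transProb ω` and the initial distribution `initMeasure μ ω`. -/
def quenchedLaw {d : ℕ} (μ : InitialLaw d) (ω : Env d) : Measure (ℕ → Strip d) :=
  Kernel.trajMeasure (X := fun _ => Strip d) (initMeasure μ ω) (pathKernel ω)

instance {d : ℕ} (μ : InitialLaw d) (ω : Env d) : IsProbabilityMeasure (quenchedLaw μ ω) := by
  unfold quenchedLaw; infer_instance

lemma quenchedLaw_map_zero {d : ℕ} (μ : InitialLaw d) (ω : Env d) (a : ℕ → Strip d) :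
    (quenchedLaw μ ω).map (Preorder.frestrictLe (π := fun _ => Strip d) 0)
      {Preorder.frestrictLe 0 a} = initMeasure μ ω {a 0} := by
  unfold quenchedLaw Kernel.trajMeasure
  rw [Measure.map_comp _ _ (by fun_prop), Kernel.traj_map_frestrictLe, Kernel.partialTraj_self,
    Measure.id_comp, Measure.map_apply (by fun_prop) (measurableSet_singleton _)]
  congr 1
  ext x
  simp only [Set.mem_preimage, Set.mem_singleton_iff]
  constructor
  · intro h
    have := congrFun h ⟨0, by simp⟩
    simpa using this
  · rintro rfl
    funext i
    obtain ⟨i, hi⟩ := i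
    have : i = 0 := by simpa using hi
    subst this
    rfl

/-- The finite-dimensional distributions of the quenched law:
`P_ω^μ(X_0 = a_0, …, X_n = a_n) = P_ω^μ(X_0 = a_0) ∏ transProb ω a_k a_{k+1}`. -/
lemma quenchedLaw_map_singleton {d : ℕ} (μ : InitialLaw d) (ω : Env d) (a : ℕ → Strip d) (n : ℕ) :
    (quenchedLaw μ ω).map (Preorder.frestrictLe (π := fun _ => Strip d) n)
      {Preorder.frestrictLe n a} = initMeasure μ ω {a 0} *
        ∏ k ∈ Finset.range n, ENNReal.ofReal (transProb ω (a k) (a (k + 1))) := by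
  induction n with
  | zero => simpa using quenchedLaw_map_zero μ ω a
  | succ n ih =>
    have h := Kernel.map_frestrictLe_trajMeasure_compProd_eq_map_trajMeasure
      (X := fun _ => Strip d) (μ₀ := initMeasure μ ω) (κ := pathKernel ω) (a := n)
    have h' := congrArg (fun m => m ({Preorder.frestrictLe n a} ×ˢ {a (n + 1)})) h
    rw [Measure.compProd_apply_prod (measurableSet_singleton _) (measurableSet_singleton _),
      Measure.restrict_singleton, lintegral_smul_measure, lintegral_dirac,
      Measure.map_apply (by fun_prop)
        ((measurableSet_singleton _).prod (measurableSet_singleton _))] at h'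
    change (quenchedLaw μ ω).map _ _ • stepMeasure ω (a n) {a (n + 1)} = quenchedLaw μ ω _ at h'
    rw [ih, stepMeasure_singleton, smul_eq_mul] at h'
    rw [Finset.prod_range_succ, ← mul_assoc, h',
      Measure.map_apply (by fun_prop) (measurableSet_singleton _)]
    congr 1
    ext x
    simp only [Set.mem_preimage, Set.mem_singleton_iff, Set.mem_prod]
    constructor
    · intro hx
      constructor
      · funext i
        exact congrFun hx ⟨i.1, Finset.mem_Iic.2 ((Finset.mem_Iic.1 i.2).trans n.le_succ)⟩
      · exact congrFun hx ⟨n + 1, Finset.mem_Iic.2 le_rfl⟩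
    · rintro ⟨h1, h2⟩
      funext i
      obtain ⟨i, hi⟩ := i
      rcases Nat.lt_or_ge n i with hlt | hge
      · obtain rfl : i = n + 1 := le_antisymm (Finset.mem_Iic.1 hi) hlt
        exact h2
      · exact congrFun h1 ⟨i, Finset.mem_Iic.2 hge⟩

lemma measurable_entries {d : ℕ} (n : ℤ) (i j : Fin d) :
    Measurable (fun ω : Env d => ((ω n).P i j, (ω n).Q i j, (ω n).R i j)) := by
  have h : Measurable (fun t : Triple d => fun i j : Fin d => (t.P i j, t.Q i j, t.R i j)) :=
    comap_measurable _
  exact (measurable_pi_apply j).comp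
    ((measurable_pi_apply i).comp (h.comp (measurable_pi_apply n)))

lemma measurable_transProb {d : ℕ} (z w : Strip d) :
    Measurable (fun ω : Env d => transProb ω z w) := by
  have h := measurable_entries z.1 z.2 w.2
  unfold transProb
  split_ifs
  · exact h.fst
  · exact h.snd.snd
  · exact h.snd.fst
  · exact measurable_const

lemma measurable_quenchedLaw {d : ℕ} (μ : InitialLaw d) : Measurable (quenchedLaw μ) := by
  refine Measurable.measure_of_isPiSystem_of_isProbabilityMeasure
    (generateFrom_measurableCylinders (α := fun _ : ℕ => Strip d)).symm
    isPiSystem_measurableCylinders fun t ht => ?_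
  obtain ⟨N, S, mS, rfl⟩ : ∃ N S, MeasurableSet S ∧
      t = cylinder (α := fun _ : ℕ => Strip d) (Finset.Iic N) S := by
    simpa [measurableCylinders_nat] using ht
  have key : ∀ ω, quenchedLaw μ ω (cylinder (Finset.Iic N) S) =
      ∑' b : (Finset.Iic N) → Strip d, S.indicator (fun b => (quenchedLaw μ ω).map
        (Preorder.frestrictLe (π := fun _ => Strip d) N) {b}) b := by
    intro ω
    rw [Measure.tsum_indicator_apply_singleton _ _ mS, Measure.map_apply (by fun_prop) mS]
    rfl
  simp_rw [key]
  refine Measurable.tsum fun b => ?_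
  by_cases hb : b ∈ S
  · simp only [Set.indicator_of_mem hb]
    have hba : b = Preorder.frestrictLe (π := fun _ => Strip d) N
        (fun k => if h : k ∈ Finset.Iic N then b ⟨k, h⟩ else b ⟨0, by simp⟩) := by
      funext i
      simp only [Preorder.frestrictLe, Finset.restrict, i.2, dite_true]
    rw [hba]
    simp_rw [quenchedLaw_map_singleton]
    refine Measurable.mul ?_ (Finset.measurable_prod _ fun k _ =>
      (measurable_transProb _ _).ennreal_ofReal)
    simp only [initMeasure, Measure.coe_finsetSum, Finset.sum_apply, Measure.smul_apply,
      smul_eq_mul]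
    exact Finset.measurable_sum _ fun i _ => (((measurable_pi_apply i).comp
      μ.measurable_vec).ennreal_ofReal).mul_const _
  · simp only [Set.indicator_of_notMem hb]
    exact measurable_const

/-- The quenched laws as a probability kernel from environments to paths. -/
def quenchedKernel {d : ℕ} (μ : InitialLaw d) : Kernel (Env d) (ℕ → Strip d) where
  toFun := quenchedLaw μ
  measurable' := measurable_quenchedLaw μ

instance {d : ℕ} (μ : InitialLaw d) : IsMarkovKernel (quenchedKernel μ) :=
  ⟨fun ω => inferInstanceAs (IsProbabilityMeasure (quenchedLaw μ ω))⟩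

/-- The annealed law `ℙ^μ(F × G) = ∫_F P_ω^μ(G) P(dω)` on environments and paths. -/
def annealedLaw {d : ℕ} (P : Measure (Env d)) (μ : InitialLaw d) :
    Measure (Env d × (ℕ → Strip d)) :=
  P ⊗ₘ quenchedKernel μ

/-- The hitting time `T_n = inf {t : ξ(t) = n}` of the layer `n`, with `inf ∅ = ∞`. -/
def hitTime {d : ℕ} (n : ℤ) (x : ℕ → Strip d) : ℕ∞ :=
  ⨅ (t : ℕ) (_ : (x t).1 = n), (t : ℕ∞)

/-- The speed `v_P = 1 / 𝔼 T_1`; it is `0` exactly when `𝔼 T_1 = ∞`. -/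
def speed {d : ℕ} (P : Measure (Env d)) (μ : InitialLaw d) : ℝ≥0∞ :=
  (∫⁻ p, (hitTime 1 p.2 : ℝ≥0∞) ∂(annealedLaw P μ))⁻¹

/-! ### The standing condition on the environment -/

/-- The norm `‖A‖ = max_i ∑_j |A i j|`. -/
def rowNorm {d : ℕ} (A : Matrix (Fin d) (Fin d) ℝ) : ℝ := ⨆ i, ∑ j, |A i j|

/-- The layer `0` is in one communication class: from each of its sites the walk in the
environment `ω` can reach every other one with positive probability. -/
def LayerZeroCommunicates {d : ℕ} (ω : Env d) : Prop :=
  ∀ i j : Fin d, Relation.ReflTransGen (fun z w : Strip d => 0 < transProb ω z w) (0, i) (0, j)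

/-- Condition C. The finiteness of `E log (1 - ‖A‖)⁻¹` (where `‖A‖ ≤ 1`) means that `‖A‖ < 1`
almost surely and that the logarithm is integrable. -/
structure ConditionC {d : ℕ} (P : Measure (Env d)) : Prop where
  ergodic : Ergodic shift P
  lt_one_RP : ∀ n, ∀ᵐ ω ∂P, rowNorm ((ω n).R + (ω n).P) < 1
  log_RP : ∀ n, Integrable (fun ω : Env d => Real.log (1 - rowNorm ((ω n).R + (ω n).P))⁻¹) P
  lt_one_RQ : ∀ n, ∀ᵐ ω ∂P, rowNorm ((ω n).R + (ω n).Q) < 1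
  log_RQ : ∀ n, Integrable (fun ω : Env d => Real.log (1 - rowNorm ((ω n).R + (ω n).Q))⁻¹) P
  col_Q : ∀ n j, ∀ᵐ ω ∂P, 0 < ∑ i, (ω n).Q i j
  col_P : ∀ n j, ∀ᵐ ω ∂P, 0 < ∑ i, (ω n).P i j
  communication : 0 < P {ω | LayerZeroCommunicates ω}

/-! ### The matrices `ζ_n`, `A_n` and the vectors `y_n`, `u_n` -/

/-- `ζ` is a sequence of stochastic matrices with
`ζ_n = (I - Q_n ζ_{n-1} - R_n)⁻¹ P_n` for all `n`. -/
def IsZeta {d : ℕ} (ω : Env d) (ζ : ℤ → Matrix (Fin d) (Fin d) ℝ) : Prop :=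
  ∀ n, ζ n ∈ Matrix.rowStochastic ℝ (Fin d) ∧
    IsUnit (1 - (ω n).Q * ζ (n - 1) - (ω n).R) ∧
    ζ n = (1 - (ω n).Q * ζ (n - 1) - (ω n).R)⁻¹ * (ω n).P

/-- The sequence `ζ` of stochastic matrices that solves the system `IsZeta`; under Condition C
such a sequence exists and is unique for almost every `ω`. -/
def zeta {d : ℕ} (ω : Env d) : ℤ → Matrix (Fin d) (Fin d) ℝ := Classical.epsilon (IsZeta ω)

/-- `(I - Q_n ζ_{n-1} - R_n)⁻¹`. -/
def resolvent {d : ℕ} (ω : Env d) (n : ℤ) : Matrix (Fin d) (Fin d) ℝ :=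
  (1 - (ω n).Q * zeta ω (n - 1) - (ω n).R)⁻¹

/-- `A_n = (I - Q_n ζ_{n-1} - R_n)⁻¹ Q_n`. -/
def matA {d : ℕ} (ω : Env d) (n : ℤ) : Matrix (Fin d) (Fin d) ℝ := resolvent ω n * (ω n).Q

/-- `u_n = (I - Q_n ζ_{n-1} - R_n)⁻¹ 𝟏`. -/
def vecU {d : ℕ} (ω : Env d) (n : ℤ) : Fin d → ℝ := resolvent ω n *ᵥ 1

/-- The product `ζ_{n-k} ζ_{n-k+1} ⋯ ζ_n`. -/
def zetaProd {d : ℕ} (ω : Env d) (n : ℤ) : ℕ → Matrix (Fin d) (Fin d) ℝ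
  | 0 => zeta ω n
  | k + 1 => zeta ω (n - (k + 1 : ℕ)) * zetaProd ω n k

/-- `v` is the limit, as `a → -∞`, of `p_a ζ_a ζ_{a+1} ⋯ ζ_n` (here `a = n - k`), for every
sequence of probability vectors `p_a`. -/
def IsY {d : ℕ} (ω : Env d) (n : ℤ) (v : Fin d → ℝ) : Prop :=
  ∀ p : ℕ → Fin d → ℝ, (∀ k, p k ∈ stdSimplex ℝ (Fin d)) →
    Tendsto (fun k => p k ᵥ* zetaProd ω n k) atTop (𝓝 v)

/-- The vector `y_n = lim_{a → -∞} p_a ζ_a ζ_{a+1} ⋯ ζ_n`; under Condition C the limit exists and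
does not depend on the `p_a`, for almost every `ω`. -/
def vecY {d : ℕ} (ω : Env d) (n : ℤ) : Fin d → ℝ := Classical.epsilon (IsY ω n)

/-- The product `A_0 A_{-1} ⋯ A_{-(k-1)}` of `k` matrices. -/
def prodA {d : ℕ} (ω : Env d) : ℕ → Matrix (Fin d) (Fin d) ℝ
  | 0 => 1
  | k + 1 => prodA ω k * matA ω (-(k : ℤ))

/-- The `k`-th term `A_0 A_{-1} ⋯ A_{-(k-1)} u_{-k}` of the series
`u_0 + A_0 u_{-1} + A_0 A_{-1} u_{-2} + ⋯`. -/
def seriesTerm {d : ℕ} (ω : Env d) (k : ℕ) : Fin d → ℝ := prodA ω k *ᵥ vecU ω (-(k : ℤ))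

/-- `y_{-1} (u_0 + A_0 u_{-1} + A_0 A_{-1} u_{-2} + ⋯)`. -/
def seriesValue {d : ℕ} (ω : Env d) : ℝ := vecY ω (-1) ⬝ᵥ ∑' k, seriesTerm ω k

end StripWalk

end

open StripWalk

/-! The hitting times of the layers are Birkhoff sums. Let `advance` restart the walk when it hits
layer 1 and shift environment and path by one layer, so that this layer becomes layer 0. The walk is
nearest-neighbour in the layer coordinate and transient to the right, so it meets the layers 1, 2, …
in order, and T_n is the sum of T_1 along the first n iterates of `advance`
(`GoodPath.birkhoffSum_tau`). Once the annealed law is invariant and ergodic under `advance`,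
Birkhoff's theorem gives T_n/n → 𝔼T_1, and inverting the hitting times gives ξ(n)/n → 1/𝔼T_1
(`GoodPath.tendsto_div`).

Invariance. By the strong Markov property the place where layer 1 is hit has law μ_ω H, with H the
matrix of hitting probabilities from layer 0 to layer 1. The law is invariant because μ_{θω} = μ_ω
H, which is the shift relation of the vectors y once H = ζ_0 is known. The hitting probabilities
solve the system for ζ by one-step analysis; every stochastic solution dominates them entrywise, and
equal row sums then force equality (`Regular.eq_hm_of_isZeta`).

Mixing in the strip. Communication in layer 0 together with (C3) and transience gives, with positive
probability, a product ζ_0 ⋯ ζ_{L-1} with positive entries. Such a block contracts the distance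
between rows, and ergodicity of the shift turns this into almost sure convergence to y
(`ae_limSpread_eq_zero`).

Ergodicity of `advance`. For an invariant event A, the quenched probabilities f_ω(i) of A satisfy
f_ω = ζ_0 f_{θω}. Their maximum and minimum over i are almost surely constant by ergodicity of the
shift, and a positive block makes them equal, so f = c. An invariant event is decided after
arbitrarily late hitting times, hence is independent of every cylinder
(`Regular.restrict_invariant`); thus c = c² (`ergodic_advance`).

The series. The mean crossing times e_n from layer n to n+1 satisfy e_n = u_n + A_n e_{n-1}.
Iteration bounds the partial sums of the series by e_0; conversely, time-truncated crossing times
are bounded by the series by induction on the truncation. So the series is e_0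
(`Regular.tsum_seriesTerm`), and E[y_{-1} e_0] = 𝔼T_1. -/

/-! ### Birkhoff's pointwise ergodic theorem -/

namespace BirkhoffErgodic

variable {α : Type*} {T : α → α} {g : α → ℝ}

/-- The running maximum of the Birkhoff sums of orders `0, …, n`. -/
noncomputable def runMax (T : α → α) (g : α → ℝ) : ℕ → α → ℝ
  | 0 => fun _ => 0
  | n + 1 => fun x => max 0 (g x + runMax T g n (T x))

lemma runMax_nonneg (n : ℕ) (x : α) : 0 ≤ runMax T g n x := by
  cases n with
  | zero => exact le_rfl
  | succ n => exact le_max_left _ _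

lemma runMax_le_succ (n : ℕ) (x : α) : runMax T g n x ≤ runMax T g (n + 1) x := by
  induction n generalizing x with
  | zero => exact runMax_nonneg 1 x
  | succ n ih => exact max_le_max le_rfl (add_le_add le_rfl (ih (T x)))

lemma runMax_mono (x : α) : Monotone fun n => runMax T g n x :=
  monotone_nat_of_le_succ fun n => runMax_le_succ n x

lemma birkhoffSum_le_runMax (n : ℕ) (x : α) : birkhoffSum T g n x ≤ runMax T g n x := by
  induction n generalizing x with
  | zero => simp [runMax]
  | succ n ih =>
    rw [birkhoffSum_succ']
    exact (add_le_add le_rfl (ih (T x))).trans (le_max_right _ _)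

/-- The set of points at which the Birkhoff sums are unbounded above. -/
def unbddSet (T : α → α) (g : α → ℝ) : Set α := {x | ∀ C : ℕ, ∃ n, (C : ℝ) < runMax T g n x}

/-- The recursion for `runMax` changes the running maximum by the fixed amount g x when x is
replaced by T x, so unboundedness at x and at T x is the same. The invariance is exact, not just
almost everywhere. -/
lemma preimage_unbddSet : T ⁻¹' unbddSet T g = unbddSet T g := by
  ext x
  constructor
  · intro h C
    obtain ⟨K, hK⟩ := exists_nat_gt ((C : ℝ) - g x)
    obtain ⟨n, hn⟩ := h K
    exact ⟨n + 1, lt_of_lt_of_le (by linarith) (le_max_right 0 (g x + runMax T g n (T x)))⟩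
  · intro h C
    obtain ⟨K, hK⟩ := exists_nat_gt (max 0 (g x + C))
    obtain ⟨n, hn⟩ := h K
    refine ⟨n, ?_⟩
    have h1 := hn.trans_le (runMax_le_succ n x)
    have h2 : max 0 (g x + C) < max 0 (g x + runMax T g n (T x)) := hK.trans h1
    rcases lt_max_iff.1 h2 with h3 | h3
    · exact absurd h3 (not_lt.2 (le_max_left _ _))
    · linarith [(le_max_right 0 (g x + (C : ℝ))).trans_lt h3]

variable [MeasurableSpace α] {m : Measure α}

lemma measurable_runMax (hT : Measurable T) (hg : Measurable g) (n : ℕ) :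
    Measurable (runMax T g n) := by
  induction n with
  | zero => exact measurable_const
  | succ n ih => exact measurable_const.max (hg.add (ih.comp hT))

lemma integrable_runMax (hT : MeasurePreserving T m m) (hg : Integrable g m) (n : ℕ) :
    Integrable (runMax T g n) m := by
  induction n with
  | zero => exact integrable_zero _ _ _
  | succ n ih =>
    exact (integrable_zero _ _ _).sup (hg.add (hT.integrable_comp_of_integrable ih))

lemma measurableSet_unbddSet (hT : Measurable T) (hg : Measurable g) :
    MeasurableSet (unbddSet T g) := by
  have : unbddSet T g = ⋂ C : ℕ, ⋃ n, {x | (C : ℝ) < runMax T g n x} := by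
    ext x; simp [unbddSet]
  rw [this]
  exact MeasurableSet.iInter fun C => MeasurableSet.iUnion fun n =>
    measurableSet_lt measurable_const (measurable_runMax hT hg n)

/-- A form of the maximal ergodic theorem. On the invariant set the integral of `runMax (n+1) -
runMax n ∘ T` is that of `runMax (n+1) - runMax n`, hence nonnegative, and the integrand converges
to g there. -/
lemma setIntegral_unbddSet_nonneg (hT : MeasurePreserving T m m) (hgm : Measurable g)
    (hg : Integrable g m) : 0 ≤ ∫ x in unbddSet T g, g x ∂m := by
  set E := unbddSet T g
  have hE : MeasurableSet E := measurableSet_unbddSet hT.measurable hgm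
  have hTE : MeasurePreserving T (m.restrict E) (m.restrict E) := by
    have := hT.restrict_preimage hE
    rwa [preimage_unbddSet] at this
  have hI : ∀ n, Integrable (runMax T g n) (m.restrict E) :=
    fun n => (integrable_runMax hT hg n).restrict
  have hnn : ∀ n, 0 ≤ ∫ x in E, (runMax T g (n + 1) x - runMax T g n (T x)) ∂m := by
    intro n
    have hsub := integral_sub (hI (n + 1)) (hTE.integrable_comp_of_integrable (hI n))
    simp only [Function.comp_apply] at hsub
    rw [hsub]
    have : ∫ x in E, runMax T g n (T x) ∂m = ∫ x in E, runMax T g n x ∂m := by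
      have h := integral_map (μ := m.restrict E) (φ := T) hT.measurable.aemeasurable
        (f := runMax T g n)
        (measurable_runMax hT.measurable hgm n).aestronglyMeasurable
      rw [hTE.map_eq] at h
      exact h.symm
    rw [this, sub_nonneg]
    exact integral_mono (hI _) (hI _) fun x => runMax_le_succ n x
  refine ge_of_tendsto' (tendsto_integral_of_dominated_convergence
    (F := fun n x => runMax T g (n + 1) x - runMax T g n (T x)) (fun x => |g x|) ?_ ?_ ?_ ?_) hnn
  · intro n
    exact ((measurable_runMax hT.measurable hgm _).sub
      ((measurable_runMax hT.measurable hgm n).comp hT.measurable)).aestronglyMeasurable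
  · exact hg.restrict.abs
  · intro n
    refine Eventually.of_forall fun x => ?_
    have h0 := runMax_nonneg (T := T) (g := g) n (T x)
    simp only [runMax, Real.norm_eq_abs]
    -- Either the difference is g x itself, or the maximum is 0 and the difference lies between g x
    -- and 0; so |g| dominates.
    rcases max_cases 0 (g x + runMax T g n (T x)) with ⟨h, h'⟩ | ⟨h, h'⟩
    · rw [h, abs_le]
      constructor <;> cases abs_cases (g x) <;> linarith
    · rw [h]; simp
  · refine (ae_restrict_iff' hE).2 (Eventually.of_forall fun x hx => ?_)
    have hx' : T x ∈ E := by
      have : x ∈ T ⁻¹' E := by rw [preimage_unbddSet]; exact hx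
      exact this
    -- Once the running maximum at T x exceeds -g x, the maximum with 0 is inactive and the
    -- difference equals g x exactly.
    obtain ⟨C, hC⟩ := exists_nat_gt (-g x)
    obtain ⟨N, hN⟩ := hx' C
    refine tendsto_const_nhds.congr' ?_
    filter_upwards [eventually_ge_atTop N] with n hn
    have h1 := runMax_mono (T := T) (g := g) (T x) hn
    simp only at h1
    simp only [runMax]
    rw [max_eq_right (by linarith)]
    ring

/-- The set of unboundedness is invariant, so null or conull; were it conull, the integral of g
would be nonnegative. -/
lemma ae_birkhoffSum_bddAbove [IsProbabilityMeasure m] (hT : Ergodic T m) (hgm : Measurable g)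
    (hg : Integrable g m) (hneg : ∫ x, g x ∂m < 0) :
    ∀ᵐ x ∂m, ∃ C : ℝ, ∀ n, birkhoffSum T g n x ≤ C := by
  have hE : MeasurableSet (unbddSet T g) := measurableSet_unbddSet hT.measurable hgm
  have h0 := setIntegral_unbddSet_nonneg hT.toMeasurePreserving hgm hg
  rcases hT.toPreErgodic.ae_mem_or_ae_notMem hE preimage_unbddSet with h | h
  · rw [Measure.restrict_eq_self_of_ae_mem h] at h0
    exact absurd h0 (not_le.2 hneg)
  · filter_upwards [h] with x hx
    simp only [unbddSet, Set.mem_ofPred_eq, not_forall, not_exists, not_lt] at hx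
    obtain ⟨C, hC⟩ := hx
    exact ⟨C, fun n => (birkhoffSum_le_runMax n x).trans (hC n)⟩

/-- For b strictly between the integral and c, the sums of g - b are bounded by some C, so the
averages of g are at most b + C/n. -/
lemma ae_eventually_birkhoffSum_le [IsProbabilityMeasure m] (hT : Ergodic T m)
    (hgm : Measurable g) (hg : Integrable g m) {c : ℝ} (hc : ∫ x, g x ∂m < c) :
    ∀ᵐ x ∂m, ∀ᶠ n : ℕ in atTop, birkhoffSum T g n x / n < c := by
  obtain ⟨b, hb, hbc⟩ := exists_between hc
  have h := ae_birkhoffSum_bddAbove hT (hgm.sub_const b) (hg.sub (integrable_const b))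
    (by rw [integral_sub hg (integrable_const b)]; simpa using hb)
  filter_upwards [h] with x ⟨C, hC⟩
  have hlim : Tendsto (fun n : ℕ => C / (n : ℝ)) atTop (𝓝 0) :=
    tendsto_const_div_atTop_nhds_zero_nat C
  filter_upwards [hlim.eventually (gt_mem_nhds (sub_pos.2 hbc)), eventually_gt_atTop 0]
    with n hn hn0
  have hn0' : (0 : ℝ) < n := by exact_mod_cast hn0
  have h1 := hC n
  have h2 : birkhoffSum T (fun x => g x - b) n x = birkhoffSum T g n x - n * b := by
    simp [birkhoffSum, Finset.sum_sub_distrib]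
  rw [h2] at h1
  rw [div_lt_iff₀ hn0'] at hn ⊢
  linarith

/-- **Birkhoff's pointwise ergodic theorem** for an ergodic transformation. -/
theorem ae_tendsto_birkhoffSum_div [IsProbabilityMeasure m] (hT : Ergodic T m)
    (hgm : Measurable g) (hg : Integrable g m) :
    ∀ᵐ x ∂m, Tendsto (fun n : ℕ => birkhoffSum T g n x / n) atTop (𝓝 (∫ x, g x ∂m)) := by
  have hup : ∀ᵐ x ∂m, ∀ k : ℕ, ∀ᶠ n : ℕ in atTop,
      birkhoffSum T g n x / n < ∫ x, g x ∂m + 1 / ((k : ℝ) + 1) :=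
    ae_all_iff.2 fun k => ae_eventually_birkhoffSum_le hT hgm hg
      (lt_add_of_pos_right _ Nat.one_div_pos_of_nat)
  have hlo : ∀ᵐ x ∂m, ∀ k : ℕ, ∀ᶠ n : ℕ in atTop,
      birkhoffSum T (fun x => -g x) n x / n < -∫ x, g x ∂m + 1 / ((k : ℝ) + 1) :=
    ae_all_iff.2 fun k => ae_eventually_birkhoffSum_le hT hgm.neg hg.neg (by
      simp only [Pi.neg_apply, integral_neg]
      exact lt_add_of_pos_right _ Nat.one_div_pos_of_nat)
  filter_upwards [hup, hlo] with x h1 h2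
  rw [tendsto_order]
  constructor
  · intro a ha
    obtain ⟨k, hk⟩ := exists_nat_one_div_lt (sub_pos.2 ha)
    filter_upwards [h2 k] with n hn
    have h3 : birkhoffSum T (fun x => -g x) n x = -birkhoffSum T g n x := by
      simp [birkhoffSum]
    rw [h3, neg_div] at hn
    linarith
  · intro a ha
    obtain ⟨k, hk⟩ := exists_nat_one_div_lt (sub_pos.2 ha)
    filter_upwards [h1 k] with n hn
    linarith

end BirkhoffErgodic

/-! ### The Markov chain in a fixed environment -/

namespace StripWalk

variable {d : ℕ}

/-- The paths of the walk. -/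
abbrev Path (d : ℕ) : Type := ℕ → Strip d

/-- The paths that agree with `a` up to time `n`. -/
def cyl (a : Path d) (n : ℕ) : Set (Path d) := {x | ∀ k ≤ n, x k = a k}

lemma mem_cyl {a x : Path d} {n : ℕ} : x ∈ cyl a n ↔ ∀ k ≤ n, x k = a k := Iff.rfl

lemma cyl_eq_preimage (a : Path d) (n : ℕ) :
    cyl a n = Preorder.frestrictLe (π := fun _ => Strip d) n ⁻¹' {Preorder.frestrictLe n a} := by
  ext x
  simp only [mem_cyl, Set.mem_preimage, Set.mem_singleton_iff]
  constructor
  · intro h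
    funext i
    exact h i.1 (Finset.mem_Iic.1 i.2)
  · intro h k hk
    exact congrFun h ⟨k, Finset.mem_Iic.2 hk⟩

lemma measurableSet_cyl (a : Path d) (n : ℕ) : MeasurableSet (cyl a n) := by
  rw [cyl_eq_preimage]
  exact (by fun_prop : Measurable (Preorder.frestrictLe (π := fun _ => Strip d) n))
    (measurableSet_singleton _)

/-- A path with prescribed values up to time `n`. -/
noncomputable def extendPath (n : ℕ) (b : (Finset.Iic n) → Strip d) : Path d :=
  fun k => if h : k ∈ Finset.Iic n then b ⟨k, h⟩ else b ⟨0, by simp⟩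

lemma frestrictLe_extendPath (n : ℕ) (b : (Finset.Iic n) → Strip d) :
    Preorder.frestrictLe (π := fun _ => Strip d) n (extendPath n b) = b := by
  funext i
  simp only [Preorder.frestrictLe, Finset.restrict, extendPath, i.2, dite_true]

lemma map_frestrictLe_eq_of_cyl {ρ σ : Measure (Path d)} (n : ℕ)
    (h : ∀ a, ρ (cyl a n) = σ (cyl a n)) :
    ρ.map (Preorder.frestrictLe (π := fun _ => Strip d) n) =
      σ.map (Preorder.frestrictLe (π := fun _ => Strip d) n) := by
  refine Measure.ext_of_singleton fun b => ?_
  rw [Measure.map_apply (by fun_prop) (measurableSet_singleton _),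
    Measure.map_apply (by fun_prop) (measurableSet_singleton _),
    ← frestrictLe_extendPath n b, ← cyl_eq_preimage, h]

/-- A finite measure on paths is determined by the cylinders `cyl a n`. -/
lemma ext_of_cyl {ρ σ : Measure (Path d)} [IsFiniteMeasure ρ]
    (h : ∀ a n, ρ (cyl a n) = σ (cyl a n)) : ρ = σ := by
  refine ext_of_generate_finite (measurableCylinders fun _ : ℕ => Strip d)
    generateFrom_measurableCylinders.symm isPiSystem_measurableCylinders (fun t ht => ?_) ?_
  · obtain ⟨N, S, mS, rfl⟩ : ∃ N S, MeasurableSet S ∧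
        t = cylinder (α := fun _ : ℕ => Strip d) (Finset.Iic N) S := by
      simpa [measurableCylinders_nat] using ht
    have := congrArg (fun m => m S) (map_frestrictLe_eq_of_cyl N fun a => h a N)
    simp only at this
    rwa [Measure.map_apply (by fun_prop) mS, Measure.map_apply (by fun_prop) mS] at this
  · have := congrArg (fun m => m Set.univ) (map_frestrictLe_eq_of_cyl 0 fun a => h a 0)
    simp only at this
    rwa [Measure.map_apply (by fun_prop) MeasurableSet.univ,
      Measure.map_apply (by fun_prop) MeasurableSet.univ] at this

lemma trajMeasure_cyl (ν : Measure (Strip d)) [IsProbabilityMeasure ν] (ω : Env d) (a : Path d)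
    (n : ℕ) :
    Kernel.trajMeasure (X := fun _ => Strip d) ν (pathKernel ω) (cyl a n) =
      ν {a 0} * ∏ k ∈ Finset.range n, ENNReal.ofReal (transProb ω (a k) (a (k + 1))) := by
  induction n with
  | zero =>
    rw [cyl_eq_preimage, ← Measure.map_apply (by fun_prop) (measurableSet_singleton _)]
    unfold Kernel.trajMeasure
    rw [Measure.map_comp _ _ (by fun_prop), Kernel.traj_map_frestrictLe, Kernel.partialTraj_self,
      Measure.id_comp, Measure.map_apply (by fun_prop) (measurableSet_singleton _)]
    simp only [Finset.range_zero, Finset.prod_empty, mul_one]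
    congr 1
    ext x
    simp only [Set.mem_preimage, Set.mem_singleton_iff]
    constructor
    · intro h
      simpa using congrFun h ⟨0, by simp⟩
    · rintro rfl
      funext ⟨i, hi⟩
      obtain rfl : i = 0 := by simpa using hi
      rfl
  | succ n ih =>
    have h := Kernel.map_frestrictLe_trajMeasure_compProd_eq_map_trajMeasure
      (X := fun _ => Strip d) (μ₀ := ν) (κ := pathKernel ω) (a := n)
    have h' := congrArg (fun m => m ({Preorder.frestrictLe n a} ×ˢ {a (n + 1)})) h
    rw [Measure.compProd_apply_prod (measurableSet_singleton _) (measurableSet_singleton _),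
      Measure.restrict_singleton, lintegral_smul_measure, lintegral_dirac,
      Measure.map_apply (by fun_prop) (measurableSet_singleton _), ← cyl_eq_preimage,
      Measure.map_apply (by fun_prop)
        ((measurableSet_singleton _).prod (measurableSet_singleton _))] at h'
    change _ • stepMeasure ω (a n) {a (n + 1)} = _ at h'
    rw [ih, stepMeasure_singleton, smul_eq_mul] at h'
    rw [Finset.prod_range_succ, ← mul_assoc, h']
    congr 1
    ext x
    simp only [Set.mem_preimage, Set.mem_singleton_iff, Set.mem_prod, mem_cyl]
    constructor
    · intro hx
      exact ⟨funext fun i => hx i.1 ((Finset.mem_Iic.1 i.2).trans n.le_succ), hx _ le_rfl⟩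
    · rintro ⟨h1, h2⟩ k hk
      rcases Nat.lt_or_ge n k with hlt | hge
      · obtain rfl : k = n + 1 := le_antisymm hk hlt
        exact h2
      · exact congrFun h1 ⟨k, Finset.mem_Iic.2 hge⟩

/-- The law of the walk in the environment `ω` that starts from `z`. -/
noncomputable def chain (ω : Env d) (z : Strip d) : Measure (Path d) :=
  Kernel.trajMeasure (X := fun _ => Strip d) (Measure.dirac z) (pathKernel ω)

instance (ω : Env d) (z : Strip d) : IsProbabilityMeasure (chain ω z) := by
  unfold chain; infer_instance

lemma chain_cyl (ω : Env d) (z : Strip d) (a : Path d) (n : ℕ) :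
    chain ω z (cyl a n) = (if a 0 = z then 1 else 0) *
      ∏ k ∈ Finset.range n, ENNReal.ofReal (transProb ω (a k) (a (k + 1))) := by
  rw [chain, trajMeasure_cyl, Measure.dirac_apply' _ (measurableSet_singleton _)]
  congr 1
  by_cases h : a 0 = z
  · simp [h]
  · simp [h, Ne.symm h]

/-- This reduces quenched statements to walks from a single site, to which the Markov property
applies. -/
lemma quenchedLaw_eq_sum (μ : InitialLaw d) (ω : Env d) :
    quenchedLaw μ ω = ∑ i, ENNReal.ofReal (μ.vec ω i) • chain ω (0, i) := by
  refine ext_of_cyl fun a n => ?_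
  rw [quenchedLaw, trajMeasure_cyl]
  simp only [initMeasure, Measure.coe_finsetSum, Finset.sum_apply, Measure.smul_apply,
    smul_eq_mul, chain_cyl, Finset.sum_mul]
  refine Finset.sum_congr rfl fun i _ => ?_
  rw [Measure.dirac_apply' _ (measurableSet_singleton _), mul_assoc]
  congr 2
  by_cases h : a 0 = (0, i)
  · simp [h]
  · simp [h, Ne.symm h]

/-- A family of probability measures on paths is measurable if the masses of cylinders are. -/
lemma measurable_of_cyl {α : Type*} [MeasurableSpace α] {ρ : α → Measure (Path d)}
    [∀ x, IsProbabilityMeasure (ρ x)] (h : ∀ a n, Measurable fun x => ρ x (cyl a n)) :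
    Measurable ρ := by
  refine Measurable.measure_of_isPiSystem_of_isProbabilityMeasure
    (generateFrom_measurableCylinders (α := fun _ : ℕ => Strip d)).symm
    isPiSystem_measurableCylinders fun t ht => ?_
  obtain ⟨N, S, mS, rfl⟩ : ∃ N S, MeasurableSet S ∧
      t = cylinder (α := fun _ : ℕ => Strip d) (Finset.Iic N) S := by
    simpa [measurableCylinders_nat] using ht
  have key : ∀ x, ρ x (cylinder (Finset.Iic N) S) =
      ∑' b : (Finset.Iic N) → Strip d, S.indicator (fun b => ρ x (cyl (extendPath N b) N)) b := by
    intro x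
    have h1 : ∀ b : (Finset.Iic N) → Strip d, ρ x (cyl (extendPath N b) N) =
        (ρ x).map (Preorder.frestrictLe (π := fun _ => Strip d) N) {b} := fun b => by
      rw [Measure.map_apply (by fun_prop) (measurableSet_singleton _), cyl_eq_preimage,
        frestrictLe_extendPath]
    simp_rw [h1]
    rw [Measure.tsum_indicator_apply_singleton _ _ mS, Measure.map_apply (by fun_prop) mS]
    rfl
  simp_rw [key]
  refine Measurable.tsum fun b => ?_
  by_cases hb : b ∈ S
  · simpa only [Set.indicator_of_mem hb] using h _ _
  · simp only [Set.indicator_of_notMem hb]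
    exact measurable_const

lemma measurable_chain (z : Strip d) : Measurable fun ω : Env d => chain ω z :=
  measurable_of_cyl fun a n => by
    simp_rw [chain_cyl]
    exact (Finset.measurable_prod _ fun k _ => (measurable_transProb _ _).ennreal_ofReal).const_mul _

/-- The laws of the walks from `z` as a kernel from environments to paths. -/
noncomputable def chainKernel (z : Strip d) : Kernel (Env d) (Path d) where
  toFun ω := chain ω z
  measurable' := measurable_chain z

instance (z : Strip d) : IsMarkovKernel (chainKernel z) :=
  ⟨fun ω => inferInstanceAs (IsProbabilityMeasure (chain ω z))⟩

/-! ### The Markov property -/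

/-- The path after time `t`. -/
def drop (t : ℕ) (x : Path d) : Path d := fun s => x (t + s)

lemma measurable_drop (t : ℕ) : Measurable (drop (d := d) t) :=
  measurable_pi_iff.2 fun _ => measurable_pi_apply _

/-- As functions of `D` both sides are finite measures, so comparison on cylinders suffices; there
the product formula for path probabilities splits at time `t`. -/
lemma chain_cyl_inter_drop (ω : Env d) (z : Strip d) (a : Path d) (t : ℕ) {D : Set (Path d)}
    (hD : MeasurableSet D) :
    chain ω z (cyl a t ∩ drop t ⁻¹' D) = chain ω z (cyl a t) * chain ω (a t) D := by
  have key : ((chain ω z).restrict (cyl a t)).map (drop t) =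
      chain ω z (cyl a t) • chain ω (a t) := by
    have : IsFiniteMeasure (((chain ω z).restrict (cyl a t)).map (drop t)) :=
      Measure.isFiniteMeasure_map _ _
    refine ext_of_cyl fun b m => ?_
    rw [Measure.map_apply (measurable_drop t) (measurableSet_cyl b m),
      Measure.restrict_apply (measurable_drop t (measurableSet_cyl b m)), Measure.smul_apply,
      smul_eq_mul]
    by_cases hb : b 0 = a t
    · have h1 : drop t ⁻¹' cyl b m ∩ cyl a t =
          cyl (fun k => if k ≤ t then a k else b (k - t)) (t + m) := by
        ext x
        simp only [Set.mem_inter_iff, Set.mem_preimage, mem_cyl, drop]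
        constructor
        · rintro ⟨h1, h2⟩ k hk
          split_ifs with h
          · exact h2 k h
          · rw [← h1 (k - t) (by omega)]
            congr 1
            omega
        · intro h
          refine ⟨fun k hk => ?_, fun k hk => ?_⟩
          · rw [h (t + k) (by omega)]
            split_ifs with h0
            · obtain rfl : k = 0 := by omega
              simpa using hb.symm
            · congr 1
              omega
          · rw [h k (by omega), if_pos hk]
      rw [h1, chain_cyl, chain_cyl, chain_cyl, Finset.prod_range_add, if_pos (Nat.zero_le t),
        if_pos hb, one_mul, ← mul_assoc]
      congr 1
      · congr 1
        refine Finset.prod_congr rfl fun k hk => ?_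
        have := Finset.mem_range.1 hk
        rw [if_pos (by omega), if_pos (by omega)]
      · refine Finset.prod_congr rfl fun k hk => ?_
        rw [if_neg (by omega : ¬ t + k + 1 ≤ t), show t + k + 1 - t = k + 1 by omega]
        split_ifs with h0
        · obtain rfl : k = 0 := by omega
          rw [Nat.add_zero, hb]
        · rw [show t + k - t = k by omega]
    · have h1 : drop t ⁻¹' cyl b m ∩ cyl a t = ∅ := by
        ext x
        simp only [Set.mem_inter_iff, Set.mem_preimage, Set.mem_empty_iff_false, iff_false]
        rintro ⟨h1, h2⟩
        exact hb ((h1 0 (Nat.zero_le _)).symm.trans (h2 t le_rfl))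
      rw [h1, chain_cyl ω (a t), if_neg hb]
      simp
  have := congrArg (fun m => m D) key
  simp only [Measure.smul_apply, smul_eq_mul] at this
  rw [← this, Measure.map_apply (measurable_drop t) hD,
    Measure.restrict_apply (measurable_drop t hD), Set.inter_comm]

/-- `C` depends on the path up to time `t` only. -/
def Adapted (t : ℕ) (C : Set (Path d)) : Prop :=
  ∀ ⦃x y : Path d⦄, (∀ k ≤ t, x k = y k) → x ∈ C → y ∈ C

lemma adapted_cyl (a : Path d) (t : ℕ) : Adapted t (cyl a t) :=
  fun _ _ h hx k hk => (h k hk).symm.trans (hx k hk)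

lemma Adapted.eq_preimage {t : ℕ} {C : Set (Path d)} (hC : Adapted t C) :
    C = Preorder.frestrictLe (π := fun _ => Strip d) t ⁻¹' {b | extendPath t b ∈ C} := by
  ext x
  have h : ∀ k ≤ t, x k = extendPath t (Preorder.frestrictLe (π := fun _ => Strip d) t x) k := by
    intro k hk
    simp [extendPath, hk, Preorder.frestrictLe]
  exact ⟨fun hx => hC h hx, fun hx => hC (fun k hk => (h k hk).symm) hx⟩

lemma Adapted.measurableSet {t : ℕ} {C : Set (Path d)} (hC : Adapted t C) : MeasurableSet C := by
  rw [hC.eq_preimage]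
  exact (by fun_prop : Measurable (Preorder.frestrictLe (π := fun _ => Strip d) t))
    (Set.to_countable _).measurableSet

/-- The state space is countable, so an event decided by time `t` is a countable disjoint union of
cylinders of length `t`. This extends cylinder identities to all adapted events. -/
lemma Adapted.measure_inter_eq_tsum {t : ℕ} {C : Set (Path d)} (hC : Adapted t C)
    (ρ : Measure (Path d)) {E : Set (Path d)} (hE : MeasurableSet E) :
    ρ (C ∩ E) = ∑' b : {b : (Finset.Iic t) → Strip d // extendPath t b ∈ C},
      ρ (cyl (extendPath t b.1) t ∩ E) := by
  have h : C ∩ E = ⋃ b : {b : (Finset.Iic t) → Strip d // extendPath t b ∈ C},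
      (cyl (extendPath t b.1) t ∩ E) := by
    rw [← Set.iUnion_inter]
    congr 1
    conv_lhs => rw [hC.eq_preimage]
    ext x
    simp [cyl_eq_preimage, frestrictLe_extendPath]
  rw [h, measure_iUnion]
  · rintro ⟨b, hb⟩ ⟨b', hb'⟩ hne
    refine Set.disjoint_left.2 fun x hx hx' => hne ?_
    have h1 := hx.1
    have h2 := hx'.1
    rw [cyl_eq_preimage, frestrictLe_extendPath] at h1 h2
    exact Subtype.ext (h1.symm.trans h2)
  · exact fun b => (measurableSet_cyl _ _).inter hE

/-- The Markov property at a fixed time. -/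
lemma chain_inter_drop (ω : Env d) (z w : Strip d) {t : ℕ} {C D : Set (Path d)}
    (hC : Adapted t C) (hw : ∀ x ∈ C, x t = w) (hD : MeasurableSet D) :
    chain ω z (C ∩ drop t ⁻¹' D) = chain ω z C * chain ω w D := by
  have h2 := hC.measure_inter_eq_tsum (chain ω z) MeasurableSet.univ
  simp only [Set.inter_univ] at h2
  rw [hC.measure_inter_eq_tsum _ (measurable_drop t hD), h2, ← ENNReal.tsum_mul_right]
  refine tsum_congr fun b => ?_
  rw [chain_cyl_inter_drop _ _ _ _ hD, hw _ b.2]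

lemma ae_chain_zero (ω : Env d) (z : Strip d) : ∀ᵐ x ∂chain ω z, x 0 = z := by
  have h : Adapted 0 {x : Path d | x 0 ≠ z} := fun x y h hx => by
    have := h 0 le_rfl
    simpa [← this] using hx
  have h2 := h.measure_inter_eq_tsum (chain ω z) MeasurableSet.univ
  rw [Set.inter_univ] at h2
  rw [ae_iff]
  refine h2.trans (ENNReal.tsum_eq_zero.2 fun b => ?_)
  rw [Set.inter_univ, chain_cyl, if_neg b.2, zero_mul]

/-- The one-step decomposition of the walk. -/
lemma chain_map_drop_one (ω : Env d) (n : ℤ) (i : Fin d) :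
    (chain ω (n, i)).map (drop 1) =
      ∑ j, (ENNReal.ofReal ((ω n).P i j) • chain ω (n + 1, j) +
        ENNReal.ofReal ((ω n).R i j) • chain ω (n, j) +
        ENNReal.ofReal ((ω n).Q i j) • chain ω (n - 1, j)) := by
  have : IsFiniteMeasure ((chain ω (n, i)).map (drop 1)) := Measure.isFiniteMeasure_map _ _
  refine ext_of_cyl fun b m => ?_
  rw [Measure.map_apply (measurable_drop 1) (measurableSet_cyl b m)]
  set a : Path d := fun k => if k = 0 then (n, i) else b (k - 1) with ha
  have h1 : chain ω (n, i) (drop 1 ⁻¹' cyl b m) = chain ω (n, i) (cyl a (m + 1)) := by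
    refine measure_congr ?_
    filter_upwards [ae_chain_zero ω (n, i)] with x hx
    refine propext ⟨fun h k hk => ?_, fun h k hk => ?_⟩
    · rcases Nat.eq_zero_or_pos k with rfl | hk0
      · simpa [ha] using hx
      · have h3 : x (1 + (k - 1)) = b (k - 1) := h (k - 1) (by omega)
        rw [show 1 + (k - 1) = k by omega] at h3
        simp [ha, hk0.ne', h3]
    · have := h (1 + k) (by omega)
      simpa [ha, drop] using this
  have h2 : chain ω (n, i) (cyl a (m + 1)) = ENNReal.ofReal (transProb ω (n, i) (b 0)) *
      ∏ k ∈ Finset.range m, ENNReal.ofReal (transProb ω (b k) (b (k + 1))) := by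
    rw [chain_cyl, Finset.prod_range_succ', if_pos (by simp [ha]), one_mul, mul_comm]
    simp [ha]
  rw [h1, h2]
  simp only [Measure.coe_finsetSum, Finset.sum_apply, Measure.add_apply, Measure.smul_apply,
    smul_eq_mul, chain_cyl, ← mul_assoc, ← add_mul, ← Finset.sum_mul]
  congr 1
  rw [Finset.sum_eq_single (b 0).2]
  · have e : ∀ k : ℤ, (b 0 = (k, (b 0).2)) ↔ (b 0).1 = k :=
      fun k => ⟨fun h => congrArg Prod.fst h, fun h => Prod.ext h rfl⟩
    simp only [e, transProb]
    split_ifs <;> first | omega | simp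
  · intro j _ hj
    have e : ∀ k : ℤ, b 0 ≠ (k, j) := fun k h => hj (congrArg Prod.snd h).symm
    simp [e]
  · simp

lemma chain_drop_one (ω : Env d) (n : ℤ) (i : Fin d) {D : Set (Path d)} (hD : MeasurableSet D) :
    chain ω (n, i) (drop 1 ⁻¹' D) =
      ∑ j, (ENNReal.ofReal ((ω n).P i j) * chain ω (n + 1, j) D +
        ENNReal.ofReal ((ω n).R i j) * chain ω (n, j) D +
        ENNReal.ofReal ((ω n).Q i j) * chain ω (n - 1, j) D) := by
  rw [← Measure.map_apply (measurable_drop 1) hD, chain_map_drop_one]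
  simp

lemma lintegral_chain_drop_one (ω : Env d) (n : ℤ) (i : Fin d) {f : Path d → ℝ≥0∞}
    (hf : Measurable f) :
    ∫⁻ x, f (drop 1 x) ∂chain ω (n, i) =
      ∑ j, (ENNReal.ofReal ((ω n).P i j) * ∫⁻ x, f x ∂chain ω (n + 1, j) +
        ENNReal.ofReal ((ω n).R i j) * ∫⁻ x, f x ∂chain ω (n, j) +
        ENNReal.ofReal ((ω n).Q i j) * ∫⁻ x, f x ∂chain ω (n - 1, j)) := by
  rw [← lintegral_map hf (measurable_drop 1), chain_map_drop_one]
  simp [lintegral_finsetSum_measure, lintegral_add_measure, lintegral_smul_measure]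

/-! ### Translations -/

/-- The translation of a path by one layer to the left. -/
def tr (x : Path d) : Path d := fun t => ((x t).1 - 1, (x t).2)

lemma measurable_tr : Measurable (tr (d := d)) :=
  measurable_pi_iff.2 fun t => (measurable_of_countable fun w : Strip d => (w.1 - 1, w.2)).comp
    (measurable_pi_apply t)

lemma measurable_shift : Measurable (shift (d := d)) :=
  measurable_pi_iff.2 fun _ => measurable_pi_apply _

lemma transProb_shift (ω : Env d) (z w : Strip d) :
    transProb (shift ω) z w = transProb ω (z.1 + 1, z.2) (w.1 + 1, w.2) := by
  have e1 : (w.1 + 1 = z.1 + 1 + 1) ↔ (w.1 = z.1 + 1) := by omega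
  have e2 : (w.1 + 1 = z.1 + 1) ↔ (w.1 = z.1) := by omega
  have e3 : (w.1 + 1 = z.1 + 1 - 1) ↔ (w.1 = z.1 - 1) := by omega
  simp only [transProb, e1, e2, e3]
  rfl

lemma chain_shift (ω : Env d) (n : ℤ) (i : Fin d) :
    chain (shift ω) (n, i) = (chain ω (n + 1, i)).map tr := by
  refine ext_of_cyl fun a m => ?_
  rw [Measure.map_apply measurable_tr (measurableSet_cyl _ _)]
  have h : tr ⁻¹' cyl a m = cyl (fun k => ((a k).1 + 1, (a k).2)) m := by
    ext x
    simp only [Set.mem_preimage, mem_cyl, tr, Prod.ext_iff]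
    refine forall₂_congr fun k _ => and_congr_left' ?_
    omega
  rw [h, chain_cyl, chain_cyl]
  simp only [transProb_shift]
  congr 1
  have e : (((a 0).1 + 1, (a 0).2) = (n + 1, i)) ↔ a 0 = (n, i) := by
    simp [Prod.ext_iff]
  simp only [e]

end StripWalk

/-! ### Hitting times of layers and the strong Markov property -/

namespace StripWalk

variable {d : ℕ}

/-- The path visits the layer `N`. -/
def Hits (N : ℤ) (x : Path d) : Prop := ∃ t, (x t).1 = N

/-- The hitting time of the layer `N` as a natural number, which is `0` on the paths that do not
visit it. -/
noncomputable def tau (N : ℤ) (x : Path d) : ℕ := sInf {t | (x t).1 = N}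

/-- The path after the hitting time of the layer `N`. -/
noncomputable def post (N : ℤ) (x : Path d) : Path d := drop (tau N x) x

/-- The paths that first hit the layer of `w` at the site `w`. -/
def HitAt (w : Strip d) : Set (Path d) := {x | Hits w.1 x ∧ x (tau w.1 x) = w}

/-- The paths that first hit the layer of `w` at the site `w` and at time `t`. -/
def FirstAt (w : Strip d) (t : ℕ) : Set (Path d) := {x | x t = w ∧ ∀ s < t, (x s).1 ≠ w.1}

lemma Hits.tau_spec {N : ℤ} {x : Path d} (h : Hits N x) : (x (tau N x)).1 = N :=
  Nat.sInf_mem (s := {t | (x t).1 = N}) h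

lemma tau_le {N : ℤ} {x : Path d} {t : ℕ} (h : (x t).1 = N) : tau N x ≤ t :=
  Nat.sInf_le (s := {t | (x t).1 = N}) h

lemma ne_of_lt_tau {N : ℤ} {x : Path d} {t : ℕ} (h : t < tau N x) : (x t).1 ≠ N :=
  fun h' => absurd (tau_le h') (not_le.2 h)

lemma tau_eq {N : ℤ} {x : Path d} {t : ℕ} (h : (x t).1 = N) (h' : ∀ s < t, (x s).1 ≠ N) :
    tau N x = t := by
  refine le_antisymm (tau_le h) (not_lt.1 fun hlt => h' _ hlt ?_)
  exact Hits.tau_spec ⟨t, h⟩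

lemma tau_eq_of_firstAt {w : Strip d} {t : ℕ} {x : Path d} (h : x ∈ FirstAt w t) :
    tau w.1 x = t := tau_eq (by rw [h.1]) h.2

lemma adapted_firstAt (w : Strip d) (t : ℕ) : Adapted t (FirstAt w t) := by
  intro x y h hx
  refine ⟨(h t le_rfl).symm.trans hx.1, fun s hs => ?_⟩
  rw [← h s hs.le]
  exact hx.2 s hs

lemma hitAt_eq_iUnion (w : Strip d) : HitAt w = ⋃ t, FirstAt w t := by
  ext x
  simp only [Set.mem_iUnion]
  constructor
  · intro h
    exact ⟨tau w.1 x, h.2, fun s hs => ne_of_lt_tau hs⟩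
  · rintro ⟨t, ht⟩
    refine ⟨⟨t, by rw [ht.1]⟩, ?_⟩
    rw [tau_eq_of_firstAt ht]
    exact ht.1

lemma measurableSet_hitAt (w : Strip d) : MeasurableSet (HitAt w) := by
  rw [hitAt_eq_iUnion]
  exact MeasurableSet.iUnion fun t => (adapted_firstAt w t).measurableSet

lemma disjoint_firstAt (w : Strip d) : Pairwise (Function.onFun Disjoint (FirstAt w)) := by
  intro s t hst
  exact Set.disjoint_left.2 fun x hx hx' =>
    hst ((tau_eq_of_firstAt hx).symm.trans (tau_eq_of_firstAt hx'))

lemma disjoint_hitAt (N : ℤ) :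
    Pairwise (Function.onFun Disjoint fun l : Fin d => HitAt (N, l)) := by
  intro l l' hne
  exact Set.disjoint_left.2 fun x hx hx' => hne (congrArg Prod.snd (hx.2.symm.trans hx'.2))

lemma iUnion_hitAt (N : ℤ) : ⋃ l : Fin d, HitAt (N, l) = {x : Path d | Hits N x} := by
  ext x
  simp only [Set.mem_iUnion]
  exact ⟨fun ⟨l, hl⟩ => hl.1, fun h => ⟨(x (tau N x)).2, h, Prod.ext h.tau_spec rfl⟩⟩

lemma measurableSet_hits (N : ℤ) : MeasurableSet {x : Path d | Hits N x} := by
  rw [← iUnion_hitAt]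
  exact MeasurableSet.iUnion fun l => measurableSet_hitAt _

lemma measurable_tau (N : ℤ) : Measurable (tau (d := d) N) := by
  refine measurable_to_countable' fun t => ?_
  have h : tau (d := d) N ⁻¹' {t} =
      (⋃ l, FirstAt (N, l) t) ∪ ({x | Hits N x}ᶜ ∩ {x | t = 0}) := by
    ext x
    simp only [Set.mem_preimage, Set.mem_singleton_iff, Set.mem_union, Set.mem_iUnion,
      Set.mem_inter_iff, Set.mem_compl_iff, Set.mem_ofPred_eq]
    -- The value 0 is taken both by paths that start in the layer and by paths that miss it; the
    -- second member of the union covers the latter.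
    constructor
    · rintro rfl
      by_cases hx : Hits N x
      · exact Or.inl ⟨(x (tau N x)).2, Prod.ext hx.tau_spec rfl, fun s hs => ne_of_lt_tau hs⟩
      · refine Or.inr ⟨hx, ?_⟩
        have : {t | (x t).1 = N} = ∅ := by
          ext t
          simpa using fun h => hx ⟨t, h⟩
        rw [tau, this, Nat.sInf_empty]
    · rintro (⟨l, hl⟩ | ⟨hx, rfl⟩)
      · exact tau_eq_of_firstAt hl
      · have : {t | (x t).1 = N} = ∅ := by
          ext t
          simpa using fun h => hx ⟨t, h⟩
        rw [tau, this, Nat.sInf_empty]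
  rw [h]
  refine (MeasurableSet.iUnion fun l => (adapted_firstAt _ t).measurableSet).union
    ((measurableSet_hits N).compl.inter (MeasurableSet.const _))

lemma measurable_post (N : ℤ) : Measurable (post (d := d) N) := by
  refine measurable_pi_iff.2 fun s => ?_
  have h : Measurable fun p : Path d × ℕ => p.1 p.2 :=
    measurable_from_prod_countable_left fun n => measurable_pi_apply n
  exact h.comp (measurable_id.prodMk ((measurable_tau N).add_const s))

/-- The strong Markov property at the hitting time of a layer. -/
lemma chain_inter_post (ω : Env d) (z w : Strip d) {C D : Set (Path d)}
    (hC : ∀ t, Adapted t (C ∩ FirstAt w t)) (hD : MeasurableSet D) :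
    chain ω z (C ∩ HitAt w ∩ post w.1 ⁻¹' D) = chain ω z (C ∩ HitAt w) * chain ω w D := by
  have hdisj : Pairwise (Function.onFun Disjoint fun t => C ∩ FirstAt w t) := fun s t hst =>
    (disjoint_firstAt w hst).mono Set.inter_subset_right Set.inter_subset_right
  have h1 : C ∩ HitAt w ∩ post w.1 ⁻¹' D = ⋃ t, (C ∩ FirstAt w t ∩ drop t ⁻¹' D) := by
    rw [hitAt_eq_iUnion, Set.inter_iUnion, Set.iUnion_inter]
    refine Set.iUnion_congr fun t => ?_
    ext x
    refine and_congr_right fun hx => ?_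
    simp only [Set.mem_preimage, post, tau_eq_of_firstAt hx.2]
  have h2 : C ∩ HitAt w = ⋃ t, (C ∩ FirstAt w t) := by
    rw [hitAt_eq_iUnion, Set.inter_iUnion]
  rw [h1, h2, measure_iUnion hdisj fun t => (hC t).measurableSet, measure_iUnion,
    ← ENNReal.tsum_mul_right]
  · exact tsum_congr fun t => chain_inter_drop ω z w (hC t) (fun x hx => hx.2.1) hD
  · intro s t hst
    exact (hdisj hst).mono Set.inter_subset_left Set.inter_subset_left
  · exact fun t => (hC t).measurableSet.inter (measurable_drop t hD)

lemma chain_hitAt_inter_post (ω : Env d) (z w : Strip d) {D : Set (Path d)}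
    (hD : MeasurableSet D) :
    chain ω z (HitAt w ∩ post w.1 ⁻¹' D) = chain ω z (HitAt w) * chain ω w D := by
  have := chain_inter_post ω z w (C := Set.univ) (D := D)
    (fun t => by simpa using adapted_firstAt w t) hD
  simpa using this

lemma map_post_restrict_hitAt (ω : Env d) (z w : Strip d) :
    ((chain ω z).restrict (HitAt w)).map (post w.1) = chain ω z (HitAt w) • chain ω w := by
  ext D hD
  rw [Measure.map_apply (measurable_post _) hD, Measure.restrict_apply (measurable_post _ hD),
    Set.inter_comm, chain_hitAt_inter_post ω z w hD]
  rfl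

/-- The strong Markov property for walks that hit the layer `N` almost surely. -/
lemma map_post (ω : Env d) (z : Strip d) (N : ℤ) (h : ∀ᵐ x ∂chain ω z, Hits N x) :
    (chain ω z).map (post N) = ∑ l, chain ω z (HitAt (N, l)) • chain ω (N, l) := by
  have h1 : chain ω z = ∑ l, (chain ω z).restrict (HitAt (N, l)) := by
    have h2 := Measure.restrict_iUnion (μ := chain ω z) (disjoint_hitAt (d := d) N)
      fun l => measurableSet_hitAt _
    rw [iUnion_hitAt, Measure.restrict_eq_self_of_ae_mem (s := {x | Hits N x}) h, Measure.sum_fintype] at h2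
    exact h2
  ext D hD
  have h2 := congrArg (fun m => m (post N ⁻¹' D)) h1
  simp only [Measure.coe_finsetSum, Finset.sum_apply] at h2 ⊢
  rw [Measure.map_apply (measurable_post N) hD, h2]
  refine Finset.sum_congr rfl fun l _ => ?_
  rw [← map_post_restrict_hitAt ω z (N, l), Measure.map_apply (measurable_post _) hD]

lemma lintegral_post (ω : Env d) (z : Strip d) (N : ℤ) (h : ∀ᵐ x ∂chain ω z, Hits N x)
    {f : Path d → ℝ≥0∞} (hf : Measurable f) :
    ∫⁻ x, f (post N x) ∂chain ω z =
      ∑ l, chain ω z (HitAt (N, l)) * ∫⁻ x, f x ∂chain ω (N, l) := by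
  rw [← lintegral_map hf (measurable_post N), map_post ω z N h]
  simp [lintegral_finsetSum_measure, lintegral_smul_measure]

lemma sum_chain_hitAt (ω : Env d) (z : Strip d) (N : ℤ) (h : ∀ᵐ x ∂chain ω z, Hits N x) :
    ∑ l, chain ω z (HitAt (N, l)) = 1 := by
  have := measure_iUnion (μ := chain ω z) (disjoint_hitAt (d := d) N)
    fun l => measurableSet_hitAt _
  rw [iUnion_hitAt, tsum_fintype] at this
  rw [← this]
  exact (measure_congr (eventuallyEq_univ.2 h)).trans measure_univ

/-! ### Nearest-neighbour paths -/

/-- The path moves between adjacent layers only. -/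
def NearestNeighbor (x : Path d) : Prop := ∀ t, |(x (t + 1)).1 - (x t).1| ≤ 1

lemma ae_chain_nearestNeighbor (ω : Env d) (z : Strip d) :
    ∀ᵐ x ∂chain ω z, NearestNeighbor x := by
  refine ae_all_iff.2 fun t => ?_
  have h : Adapted (t + 1) {x : Path d | ¬ |(x (t + 1)).1 - (x t).1| ≤ 1} := fun x y h hx => by
    simpa [← h (t + 1) le_rfl, ← h t t.le_succ] using hx
  have h2 := h.measure_inter_eq_tsum (chain ω z) MeasurableSet.univ
  rw [Set.inter_univ] at h2
  rw [ae_iff]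
  refine h2.trans (ENNReal.tsum_eq_zero.2 fun b => ?_)
  have hb : ¬ |(extendPath (t + 1) b.1 (t + 1)).1 - (extendPath (t + 1) b.1 t).1| ≤ 1 := b.2
  rw [Set.inter_univ, chain_cyl, Finset.prod_eq_zero (i := t) (by simp), mul_zero]
  rw [abs_le] at hb
  have e1 : ¬ (extendPath (t + 1) b.1 (t + 1)).1 = (extendPath (t + 1) b.1 t).1 + 1 := by omega
  have e2 : ¬ (extendPath (t + 1) b.1 (t + 1)).1 = (extendPath (t + 1) b.1 t).1 := by omega
  have e3 : ¬ (extendPath (t + 1) b.1 (t + 1)).1 = (extendPath (t + 1) b.1 t).1 - 1 := by omega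
  simp [transProb, e1, e2, e3]

lemma NearestNeighbor.exists_eq {x : Path d} (h : NearestNeighbor x) {M : ℤ} {t : ℕ}
    (h0 : (x 0).1 ≤ M) (ht : M ≤ (x t).1) : ∃ s ≤ t, (x s).1 = M := by
  induction t with
  | zero => exact ⟨0, le_rfl, le_antisymm h0 ht⟩
  | succ t ih =>
    rcases le_or_gt M (x t).1 with h1 | h1
    · obtain ⟨s, hs, hM⟩ := ih h1
      exact ⟨s, hs.trans t.le_succ, hM⟩
    · have := abs_le.1 (h t)
      exact ⟨t + 1, le_rfl, by omega⟩

/-- A discrete intermediate value argument: no layer between the start and `N` can be jumped over.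
-/
lemma NearestNeighbor.hits_of_hits {x : Path d} (h : NearestNeighbor x) {M N : ℤ}
    (h0 : (x 0).1 ≤ M) (hMN : M ≤ N) (hN : Hits N x) : Hits M x ∧ tau M x ≤ tau N x := by
  obtain ⟨s, hs, hM⟩ := h.exists_eq (t := tau N x) h0 (by rwa [hN.tau_spec])
  exact ⟨⟨s, hM⟩, (tau_le hM).trans hs⟩

lemma tau_eq_add {x : Path d} {M N : ℤ} (hN : Hits N x) (hle : tau M x ≤ tau N x) :
    Hits N (post M x) ∧ tau N x = tau M x + tau N (post M x) := by
  have h1 : (post M x (tau N x - tau M x)).1 = N := by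
    simp only [post, drop]
    rw [Nat.add_sub_cancel' hle, hN.tau_spec]
  refine ⟨⟨_, h1⟩, ?_⟩
  have h2 : tau N (post M x) = tau N x - tau M x := by
    refine tau_eq h1 fun s hs => ?_
    simp only [post, drop]
    exact ne_of_lt_tau (by omega)
  omega

lemma post_post {x : Path d} {M N : ℤ} (hN : Hits N x) (hle : tau M x ≤ tau N x) :
    post N (post M x) = post N x := by
  have h := (tau_eq_add hN hle).2
  funext s
  simp only [post, drop] at h ⊢
  congr 1
  omega

lemma NearestNeighbor.mem_hitAt_iff {x : Path d} (h : NearestNeighbor x) {M : ℤ} {w : Strip d}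
    (h0 : (x 0).1 ≤ M) (hMN : M ≤ w.1) :
    x ∈ HitAt w ↔ ∃ l, x ∈ HitAt (M, l) ∩ post M ⁻¹' HitAt w := by
  have key : ∀ hN : Hits w.1 x, (x (tau w.1 x) = w ↔
      (post M x) (tau w.1 (post M x)) = w) := fun hN => by
    obtain ⟨hM, hle⟩ := h.hits_of_hits h0 hMN hN
    rw [(tau_eq_add hN hle).2]
    rfl
  constructor
  · intro hx
    obtain ⟨hM, hle⟩ := h.hits_of_hits h0 hMN hx.1
    exact ⟨(x (tau M x)).2, ⟨hM, Prod.ext hM.tau_spec rfl⟩, (tau_eq_add hx.1 hle).1,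
      (key hx.1).1 hx.2⟩
  · rintro ⟨l, hl, hp⟩
    have hN : Hits w.1 x := by
      obtain ⟨t, ht⟩ := hp.1
      exact ⟨_, ht⟩
    exact ⟨hN, (key hN).2 hp.2⟩

/-- Hitting probabilities decompose at an intermediate layer. -/
lemma chain_hitAt_comp (ω : Env d) {z w : Strip d} {M : ℤ} (h1 : z.1 ≤ M) (h2 : M ≤ w.1) :
    chain ω z (HitAt w) = ∑ l, chain ω z (HitAt (M, l)) * chain ω (M, l) (HitAt w) := by
  have h3 : chain ω z (HitAt w) = chain ω z (⋃ l, (HitAt (M, l) ∩ post M ⁻¹' HitAt w)) := by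
    refine measure_congr ?_
    filter_upwards [ae_chain_zero ω z, ae_chain_nearestNeighbor ω z] with x hx0 hx
    exact propext ((hx.mem_hitAt_iff (by rwa [hx0]) h2).trans Set.mem_iUnion.symm)
  rw [h3, measure_iUnion, tsum_fintype]
  · exact Finset.sum_congr rfl fun l _ =>
      chain_hitAt_inter_post ω z (M, l) (measurableSet_hitAt w)
  · intro l l' hne
    exact (disjoint_hitAt M hne).mono Set.inter_subset_left Set.inter_subset_left
  · exact fun l => (measurableSet_hitAt _).inter (measurable_post M (measurableSet_hitAt w))

/-- Starting in its own layer, the walk hits that layer at its starting point. -/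
lemma chain_hitAt_self (ω : Env d) (N : ℤ) (i j : Fin d) :
    chain ω (N, i) (HitAt (N, j)) = if i = j then 1 else 0 := by
  have h : ∀ᵐ x ∂chain ω (N, i), x ∈ HitAt (N, j) ↔ i = j := by
    filter_upwards [ae_chain_zero ω (N, i)] with x hx
    have h1 : tau N x = 0 := tau_eq (by rw [hx]) (by simp)
    constructor
    · intro h
      have h2 := h.2
      rw [show (((N, j) : Strip d)).1 = N from rfl, h1, hx] at h2
      exact congrArg Prod.snd h2
    · rintro rfl
      refine ⟨⟨0, by rw [hx]⟩, ?_⟩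
      rw [show (((N, i) : Strip d)).1 = N from rfl, h1, hx]
  split_ifs with hij
  · exact (measure_congr (eventuallyEq_univ.2 (h.mono fun x hx => hx.2 hij))).trans measure_univ
  · exact measure_eq_zero_iff_ae_notMem.2 (h.mono fun x hx hx' => hij (hx.1 hx'))

end StripWalk

/-! ### Substochastic matrices -/

namespace StripWalk

variable {d : ℕ}

/-- Minimum principle: at a coordinate m where x is minimal, a negative x m would give (K x) m ≥ (∑
K m j) x m > x m. -/
lemma nonneg_of_one_sub_mulVec_nonneg {K : Matrix (Fin d) (Fin d) ℝ} (hK : ∀ i j, 0 ≤ K i j)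
    (hsum : ∀ i, ∑ j, K i j < 1) {x : Fin d → ℝ} (hx : ∀ i, 0 ≤ ((1 - K) *ᵥ x) i) (i : Fin d) :
    0 ≤ x i := by
  have : Nonempty (Fin d) := ⟨i⟩
  obtain ⟨m, hm⟩ := Finite.exists_min x
  refine le_trans ?_ (hm i)
  by_contra! hneg
  have h1 := hx m
  rw [Matrix.sub_mulVec, Matrix.one_mulVec, Pi.sub_apply, Matrix.mulVec, dotProduct] at h1
  have h2 : (∑ j, K m j) * x m ≤ ∑ j, K m j * x j := by
    rw [Finset.sum_mul]
    exact Finset.sum_le_sum fun j _ => mul_le_mul_of_nonneg_left (hm j) (hK m j)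
  nlinarith [hsum m]

lemma isUnit_one_sub {K : Matrix (Fin d) (Fin d) ℝ} (hK : ∀ i j, 0 ≤ K i j)
    (hsum : ∀ i, ∑ j, K i j < 1) : IsUnit (1 - K) := by
  rw [← Matrix.mulVec_injective_iff_isUnit]
  intro x y hxy
  have h : ∀ x y, (1 - K) *ᵥ x = (1 - K) *ᵥ y → ∀ i, x i ≤ y i := fun x y hxy i => by
    have := nonneg_of_one_sub_mulVec_nonneg hK hsum (x := y - x)
      (fun i => by rw [Matrix.mulVec_sub, hxy]; simp) i
    simpa using this
  exact funext fun i => le_antisymm (h x y hxy i) (h y x hxy.symm i)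

lemma inv_one_sub_nonneg {K : Matrix (Fin d) (Fin d) ℝ} (hK : ∀ i j, 0 ≤ K i j)
    (hsum : ∀ i, ∑ j, K i j < 1) (i j : Fin d) : 0 ≤ (1 - K)⁻¹ i j := by
  have hdet := (Matrix.isUnit_iff_isUnit_det _).1 (isUnit_one_sub hK hsum)
  refine nonneg_of_one_sub_mulVec_nonneg hK hsum (x := fun i => (1 - K)⁻¹ i j) (fun i => ?_) i
  have : ((1 - K) *ᵥ fun i => (1 - K)⁻¹ i j) i = ((1 - K) * (1 - K)⁻¹) i j := rfl
  rw [this, Matrix.mul_nonsing_inv _ hdet, Matrix.one_apply]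
  split_ifs <;> norm_num

/-! ### Transience -/

/-- The path tends to the right end of the strip. -/
def Transient (x : Path d) : Prop := Tendsto (fun t => (x t).1) atTop atTop

lemma measurableSet_transient : MeasurableSet {x : Path d | Transient x} := by
  have h : {x : Path d | Transient x} = ⋂ b : ℤ, ⋃ T : ℕ, ⋂ t : ℕ, ⋂ _ : T ≤ t,
      {x | b ≤ (x t).1} := by
    ext x
    simp only [Transient, tendsto_atTop, eventually_atTop, Set.mem_iInter, Set.mem_iUnion,
      Set.mem_ofPred_eq]
  rw [h]
  refine MeasurableSet.iInter fun b => MeasurableSet.iUnion fun T => MeasurableSet.iInter fun t =>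
    MeasurableSet.iInter fun _ => ?_
  exact measurableSet_le measurable_const (measurable_fst.comp (measurable_pi_apply t))

lemma transient_drop_one_iff {x : Path d} : Transient (drop 1 x) ↔ Transient x := by
  simp only [Transient, drop, Nat.add_comm 1]
  exact tendsto_add_atTop_iff_nat (f := fun t => (x t).1) 1

lemma transient_tr_iff {x : Path d} : Transient (tr x) ↔ Transient x := by
  simp only [Transient, tr, tendsto_atTop]
  constructor
  · intro h b
    filter_upwards [h (b - 1)] with t ht
    omega
  · intro h b
    filter_upwards [h (b + 1)] with t ht
    omega

/-- By the Markov property, a step of positive probability cannot lead to a site from which an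
almost sure property of the remaining path fails. -/
lemma ae_chain_of_transProb_pos {ω : Env d} {z w : Strip d} (hp : 0 < transProb ω z w)
    {D : Set (Path d)} (hD : MeasurableSet D) (h : ∀ᵐ x ∂chain ω z, drop 1 x ∈ D) :
    ∀ᵐ x ∂chain ω w, x ∈ D := by
  set a : Path d := fun k => if k = 0 then z else w
  have h1 : chain ω z (cyl a 1 ∩ drop 1 ⁻¹' Dᶜ) = 0 := measure_mono_null Set.inter_subset_right h
  rw [chain_cyl_inter_drop ω z a 1 hD.compl, chain_cyl, mul_eq_zero] at h1
  rcases h1 with h1 | h1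
  · simp [a] at h1
    exact absurd h1 (not_le.2 hp)
  · exact h1

lemma ae_transient_of_transProb_pos {ω : Env d} {z w : Strip d} (hp : 0 < transProb ω z w)
    (h : ∀ᵐ x ∂chain ω z, Transient x) : ∀ᵐ x ∂chain ω w, Transient x :=
  ae_chain_of_transProb_pos hp measurableSet_transient
    (h.mono fun _ hx => transient_drop_one_iff.2 hx)

/-- The environments to which the quenched arguments apply. -/
structure Regular (ω : Env d) : Prop where
  lt_one : ∀ n i, ∑ j, ((ω n).Q i j + (ω n).R i j) < 1
  col_Q : ∀ n j, ∃ i, 0 < (ω n).Q i j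
  col_P : ∀ n j, ∃ i, 0 < (ω n).P i j
  transient : ∀ z, ∀ᵐ x ∂chain ω z, Transient x

lemma exists_pos_of_sum_pos {ι : Type*} [Fintype ι] {f : ι → ℝ} (h : 0 < ∑ i, f i) :
    ∃ i, 0 < f i := by
  by_contra! h'
  exact absurd (Finset.sum_nonpos fun i _ => h' i) (not_le.2 h)

lemma sum_lt_one_of_rowNorm_lt_one {t : Triple d} (h : rowNorm (t.R + t.Q) < 1) (i : Fin d) :
    ∑ j, (t.Q i j + t.R i j) < 1 := by
  refine lt_of_le_of_lt ?_ h
  have h1 : ∑ j, (t.Q i j + t.R i j) = ∑ j, |(t.R + t.Q) i j| := by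
    refine Finset.sum_congr rfl fun j _ => ?_
    rw [Matrix.add_apply, abs_of_nonneg (add_nonneg (t.R_nonneg i j) (t.Q_nonneg i j)), add_comm]
  rw [h1]
  exact le_ciSup (f := fun i => ∑ j, |(t.R + t.Q) i j|) (Set.finite_range _).bddAbove i

lemma transProb_add_one (ω : Env d) (n : ℤ) (i j : Fin d) :
    transProb ω (n, i) (n + 1, j) = (ω n).P i j := by simp [transProb]

lemma transProb_sub_one (ω : Env d) (n : ℤ) (i j : Fin d) :
    transProb ω (n, i) (n - 1, j) = (ω n).Q i j := by
  have e2 : ¬ (n - 1 = n + 1) := by omega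
  simp [transProb, e2]

/-- The environments for which the walks from all sites of the layer `0` are transient. -/
def transientEnv (d : ℕ) : Set (Env d) := {ω | ∀ i, ∀ᵐ x ∂chain ω (0, i), Transient x}

lemma measurableSet_transientEnv : MeasurableSet (transientEnv d) := by
  have h : transientEnv d = ⋂ i, {ω | chain ω (0, i) {x | Transient x}ᶜ = 0} := by
    ext ω
    simp only [Set.mem_iInter]
    rfl
  rw [h]
  exact MeasurableSet.iInter fun i => measurableSet_eq_fun
    ((Measure.measurable_coe measurableSet_transient.compl).comp (measurable_chain _))
    measurable_const

/-- The annealed hypothesis gives transience from the sites charged by μ. Where layer 0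
communicates, it spreads to the whole layer, hence `transientEnv` has positive probability. Since
every site of the next layer is reached in one step by (C3), this set is forward invariant, and
ergodicity makes it full. The column conditions then carry transience to all layers on both sides.
-/
lemma ae_regular {P : Measure (Env d)} [IsProbabilityMeasure P] (hC : ConditionC P)
    (μ : InitialLaw d)
    (htrans : ∀ᵐ p ∂(annealedLaw P μ), Tendsto (fun t => (p.2 t).1) atTop atTop) :
    ∀ᵐ ω ∂P, Regular ω := by
  have hP : ∀ᵐ ω ∂P, ∀ n j, ∃ i, 0 < (ω n).P i j :=
    ae_all_iff.2 fun n => ae_all_iff.2 fun j => (hC.col_P n j).mono fun ω h =>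
      exists_pos_of_sum_pos h
  have hQ : ∀ᵐ ω ∂P, ∀ n j, ∃ i, 0 < (ω n).Q i j :=
    ae_all_iff.2 fun n => ae_all_iff.2 fun j => (hC.col_Q n j).mono fun ω h =>
      exists_pos_of_sum_pos h
  have hRQ : ∀ᵐ ω ∂P, ∀ n, rowNorm ((ω n).R + (ω n).Q) < 1 := ae_all_iff.2 hC.lt_one_RQ
  have hcomm : ∀ᵐ ω ∂P, LayerZeroCommunicates ω → ω ∈ transientEnv d := by
    filter_upwards [Measure.ae_ae_of_ae_compProd htrans] with ω hω hc
    change ∀ᵐ x ∂quenchedLaw μ ω, Transient x at hω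
    obtain ⟨i, hi⟩ := exists_pos_of_sum_pos (f := μ.vec ω)
      (by rw [(μ.mem_simplex ω).2]; exact one_pos)
    have h0 : ∀ᵐ x ∂chain ω (0, i), Transient x := by
      have h1 : quenchedLaw μ ω {x | Transient x}ᶜ = 0 := hω
      rw [quenchedLaw_eq_sum] at h1
      simp only [Measure.coe_finsetSum, Finset.sum_apply, Measure.smul_apply, smul_eq_mul,
        Finset.sum_eq_zero_iff, Finset.mem_univ, true_implies, mul_eq_zero,
        ENNReal.ofReal_eq_zero] at h1
      exact (h1 i).resolve_left (not_le.2 hi)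
    intro j
    -- Induction along a positive-probability path from the charged site `(0, i)` to `(0, j)`.
    refine (hc i j).rec h0 fun _ hstep ih => ae_transient_of_transProb_pos hstep ih
  have hpos : P (transientEnv d) ≠ 0 := by
    refine (lt_of_lt_of_le hC.communication (measure_mono_ae ?_)).ne'
    exact hcomm.mono fun ω h => h
  have hfull : ∀ᵐ ω ∂P, ω ∈ transientEnv d := by
    have hsub : transientEnv d ≤ᵐ[P] shift ⁻¹' transientEnv d := by
      filter_upwards [hP] with ω hω h j
      obtain ⟨i, hi⟩ := hω 0 j
      have h1 := ae_transient_of_transProb_pos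
        (by rw [transProb_add_one]; exact hi : 0 < transProb ω (0, i) (0 + 1, j)) (h i)
      rw [chain_shift]
      refine (ae_map_iff measurable_tr.aemeasurable measurableSet_transient).2 ?_
      exact h1.mono fun x hx => transient_tr_iff.2 hx
    rcases hC.ergodic.ae_empty_or_univ_of_ae_le_preimage
      measurableSet_transientEnv.nullMeasurableSet hsub with h | h
    · exact absurd (ae_eq_empty.1 h) hpos
    · exact eventuallyEq_univ.1 h
  filter_upwards [hP, hQ, hRQ, hfull] with ω h1 h2 h3 h4
  refine ⟨fun n i => sum_lt_one_of_rowNorm_lt_one (h3 n) i, h2, h1, ?_⟩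
  have key : ∀ n : ℤ, ∀ i, ∀ᵐ x ∂chain ω (n, i), Transient x := by
    intro n
    induction n using Int.induction_on with
    | zero => exact h4
    | succ n ih =>
      intro j
      obtain ⟨i, hi⟩ := h1 n j
      exact ae_transient_of_transProb_pos (by rw [transProb_add_one]; exact hi) (ih i)
    | pred n ih =>
      intro j
      obtain ⟨i, hi⟩ := h2 (-n) j
      exact ae_transient_of_transProb_pos (by rw [transProb_sub_one]; exact hi) (ih i)
  exact fun z => key z.1 z.2

lemma regular_shift {ω : Env d} (h : Regular ω) : Regular (shift ω) where
  lt_one n := h.lt_one (n + 1)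
  col_Q n := h.col_Q (n + 1)
  col_P n := h.col_P (n + 1)
  transient z := by
    rw [show z = (z.1, z.2) from rfl, chain_shift]
    exact (ae_map_iff measurable_tr.aemeasurable measurableSet_transient).2
      ((h.transient _).mono fun x hx => transient_tr_iff.2 hx)

lemma Regular.ae_hits {ω : Env d} (h : Regular ω) {z : Strip d} {N : ℤ} (hz : z.1 ≤ N) :
    ∀ᵐ x ∂chain ω z, Hits N x := by
  filter_upwards [h.transient z, ae_chain_zero ω z, ae_chain_nearestNeighbor ω z] with x h1 h2 h3
  obtain ⟨t, ht⟩ := (h1.eventually (eventually_ge_atTop N)).exists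
  obtain ⟨s, -, hs⟩ := h3.exists_eq (by rwa [h2]) ht
  exact ⟨s, hs⟩

/-! ### Hitting probabilities -/

/-- The matrix of the probabilities that the walk from `(m, i)` first hits the layer `N` at
`(N, j)`. -/
noncomputable def hm (ω : Env d) (m N : ℤ) : Matrix (Fin d) (Fin d) ℝ :=
  fun i j => (chain ω (m, i) (HitAt (N, j))).toReal

lemma hm_nonneg (ω : Env d) (m N : ℤ) (i j : Fin d) : 0 ≤ hm ω m N i j := ENNReal.toReal_nonneg

lemma ofReal_hm (ω : Env d) (m N : ℤ) (i j : Fin d) :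
    ENNReal.ofReal (hm ω m N i j) = chain ω (m, i) (HitAt (N, j)) :=
  ENNReal.ofReal_toReal (measure_ne_top _ _)

lemma hm_self (ω : Env d) (N : ℤ) : hm ω N N = 1 := by
  ext i j
  rw [hm, chain_hitAt_self, Matrix.one_apply]
  split_ifs <;> simp

/-- The strong Markov property at the intermediate layer, which cannot be avoided; this makes
products of ζ's into hitting matrices. -/
lemma hm_comp (ω : Env d) {m M N : ℤ} (h1 : m ≤ M) (h2 : M ≤ N) :
    hm ω m N = hm ω m M * hm ω M N := by
  ext i j
  rw [Matrix.mul_apply, hm, chain_hitAt_comp ω h1 h2, ENNReal.toReal_sum]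
  · simp [hm, ENNReal.toReal_mul]
  · exact fun l _ => ENNReal.mul_ne_top (measure_ne_top _ _) (measure_ne_top _ _)

lemma tr_mem_hitAt_iff {x : Path d} {N : ℤ} {j : Fin d} :
    tr x ∈ HitAt (N, j) ↔ x ∈ HitAt (N + 1, j) := by
  have h : ∀ t, (tr x t).1 = N ↔ (x t).1 = N + 1 := fun t => by simp only [tr]; omega
  have h1 : tau N (tr x) = tau (N + 1) x := by simp only [tau, h]
  have h2 : Hits N (tr x) ↔ Hits (N + 1) x := by simp only [Hits, h]
  refine and_congr h2 ?_
  simp only [h1]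
  simp only [tr, Prod.ext_iff]
  refine and_congr_left' ?_
  omega

lemma hm_shift (ω : Env d) (m N : ℤ) : hm (shift ω) m N = hm ω (m + 1) (N + 1) := by
  ext i j
  rw [hm, chain_shift, Measure.map_apply measurable_tr (measurableSet_hitAt _)]
  have : tr ⁻¹' HitAt (N, j) = HitAt (d := d) (N + 1, j) := by
    ext x
    exact tr_mem_hitAt_iff
  rw [this, hm]

lemma measurable_hm (m N : ℤ) (i j : Fin d) : Measurable fun ω : Env d => hm ω m N i j :=
  ((Measure.measurable_coe (measurableSet_hitAt _)).comp (measurable_chain _)).ennreal_toReal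

lemma Regular.hm_rowSum {ω : Env d} (h : Regular ω) {m N : ℤ} (hmN : m ≤ N) (i : Fin d) :
    ∑ j, hm ω m N i j = 1 := by
  have h1 := sum_chain_hitAt ω (m, i) N (h.ae_hits hmN)
  simp only [hm]
  rw [← ENNReal.toReal_sum fun l _ => measure_ne_top _ _, h1, ENNReal.toReal_one]

lemma Regular.hm_mem {ω : Env d} (h : Regular ω) {m N : ℤ} (hmN : m ≤ N) :
    hm ω m N ∈ Matrix.rowStochastic ℝ (Fin d) := by
  rw [Matrix.mem_rowStochastic_iff_sum]
  exact ⟨hm_nonneg ω m N, h.hm_rowSum hmN⟩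

lemma hits_drop_one_iff {x : Path d} {N : ℤ} (h0 : (x 0).1 ≠ N) :
    Hits N (drop 1 x) ↔ Hits N x := by
  constructor
  · rintro ⟨t, ht⟩
    exact ⟨_, ht⟩
  · rintro ⟨t, ht⟩
    rcases Nat.eq_zero_or_pos t with rfl | h
    · exact absurd ht h0
    · refine ⟨t - 1, ?_⟩
      rw [drop, show 1 + (t - 1) = t by omega]
      exact ht

lemma tau_drop_one {x : Path d} {N : ℤ} (h0 : (x 0).1 ≠ N) (h : Hits N x) :
    tau N x = 1 + tau N (drop 1 x) := by
  refine tau_eq ((hits_drop_one_iff h0).2 h).tau_spec fun s hs => ?_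
  rcases Nat.eq_zero_or_pos s with rfl | hs0
  · exact h0
  · have := ne_of_lt_tau (show s - 1 < tau N (drop 1 x) by omega)
    rwa [drop, show 1 + (s - 1) = s by omega] at this

lemma drop_one_mem_hitAt_iff {x : Path d} {w : Strip d} (h0 : (x 0).1 ≠ w.1) :
    drop 1 x ∈ HitAt w ↔ x ∈ HitAt w := by
  constructor
  · rintro ⟨h1, h2⟩
    have h := (hits_drop_one_iff h0).1 h1
    exact ⟨h, by rw [tau_drop_one h0 h]; exact h2⟩
  · rintro ⟨h1, h2⟩
    exact ⟨(hits_drop_one_iff h0).2 h1, by rw [tau_drop_one h0 h1] at h2; exact h2⟩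

/-- Hitting probabilities are harmonic to the left of the layer that is hit. -/
lemma hm_harmonic (ω : Env d) {m N : ℤ} (hmN : m < N) :
    hm ω m N = (ω m).P * hm ω (m + 1) N + (ω m).R * hm ω m N + (ω m).Q * hm ω (m - 1) N := by
  ext i j
  have h1 : chain ω (m, i) (HitAt (N, j)) = chain ω (m, i) (drop 1 ⁻¹' HitAt (N, j)) := by
    refine measure_congr ?_
    filter_upwards [ae_chain_zero ω (m, i)] with x hx
    exact propext (drop_one_mem_hitAt_iff (by rw [hx]; exact hmN.ne)).symm
  have hf : ∀ (r : ℝ) z, ENNReal.ofReal r * chain ω z (HitAt (N, j)) ≠ ∞ := fun r z =>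
    ENNReal.mul_ne_top ENNReal.ofReal_ne_top (measure_ne_top _ _)
  conv_lhs => rw [hm, h1, chain_drop_one ω m i (measurableSet_hitAt _)]
  rw [ENNReal.toReal_sum fun l _ => by simp [hf]]
  simp only [Matrix.add_apply, Matrix.mul_apply, ← Finset.sum_add_distrib]
  refine Finset.sum_congr rfl fun l _ => ?_
  rw [ENNReal.toReal_add (by simp [hf]) (hf _ _), ENNReal.toReal_add (hf _ _) (hf _ _)]
  simp only [ENNReal.toReal_mul, ENNReal.toReal_ofReal ((ω m).P_nonneg i l),
    ENNReal.toReal_ofReal ((ω m).R_nonneg i l), ENNReal.toReal_ofReal ((ω m).Q_nonneg i l)]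
  rfl

end StripWalk

/-! ### Identification of `ζ_n` -/

namespace StripWalk

variable {d : ℕ} {ω : Env d}

lemma Regular.kernel_sum_lt_one (h : Regular ω) (n : ℤ) {Z : Matrix (Fin d) (Fin d) ℝ}
    (hZ : Z ∈ Matrix.rowStochastic ℝ (Fin d)) (i : Fin d) :
    ∑ j, ((ω n).Q * Z + (ω n).R) i j < 1 := by
  rw [Matrix.mem_rowStochastic_iff_sum] at hZ
  have h1 : ∑ j, ((ω n).Q * Z + (ω n).R) i j = ∑ j, ((ω n).Q i j + (ω n).R i j) := by
    simp only [Matrix.add_apply, Matrix.mul_apply, Finset.sum_add_distrib]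
    rw [Finset.sum_comm]
    simp only [← Finset.mul_sum, hZ.2, mul_one]
  rw [h1]
  exact h.lt_one n i

lemma kernel_nonneg (ω : Env d) (n : ℤ) {Z : Matrix (Fin d) (Fin d) ℝ}
    (hZ : Z ∈ Matrix.rowStochastic ℝ (Fin d)) (i j : Fin d) :
    0 ≤ ((ω n).Q * Z + (ω n).R) i j := by
  rw [Matrix.mem_rowStochastic_iff_sum] at hZ
  rw [Matrix.add_apply, Matrix.mul_apply]
  exact add_nonneg (Finset.sum_nonneg fun l _ => mul_nonneg ((ω n).Q_nonneg i l) (hZ.1 l j))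
    ((ω n).R_nonneg i j)

lemma hm_zeta_eq (ω : Env d) (n : ℤ) :
    hm ω n (n + 1) = (ω n).P + (ω n).R * hm ω n (n + 1) +
      (ω n).Q * (hm ω (n - 1) n * hm ω n (n + 1)) := by
  conv_lhs => rw [hm_harmonic ω (lt_add_one n), hm_self, mul_one,
    hm_comp ω (sub_one_lt n).le (lt_add_one n).le]

/-- One-step analysis, with the passage from layer n-1 to n+1 split at layer n, gives (1 - Q H - R)
H' = P. The inverse exists because Q H + R has row sums less than 1. -/
lemma Regular.isZeta_hm (h : Regular ω) : IsZeta ω fun n => hm ω n (n + 1) := by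
  intro n
  have hst := h.hm_mem (sub_one_lt n).le
  have hu : IsUnit (1 - (ω n).Q * hm ω (n - 1) n - (ω n).R) := by
    rw [sub_sub]
    exact isUnit_one_sub (kernel_nonneg ω n hst) (h.kernel_sum_lt_one n hst)
  simp only [sub_add_cancel]
  refine ⟨h.hm_mem (lt_add_one n).le, hu, ?_⟩
  have hdet := (Matrix.isUnit_iff_isUnit_det _).1 hu
  have h1 : (1 - (ω n).Q * hm ω (n - 1) n - (ω n).R) * hm ω n (n + 1) = (ω n).P := by
    rw [sub_mul, sub_mul, one_mul, mul_assoc, sub_sub, sub_eq_iff_eq_add]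
    conv_lhs => rw [hm_zeta_eq]
    abel
  rw [← h1, ← mul_assoc, Matrix.nonsing_inv_mul _ hdet, one_mul]

lemma IsZeta.eq_add {ζ : ℤ → Matrix (Fin d) (Fin d) ℝ} (hζ : IsZeta ω ζ) (n : ℤ) :
    ζ n = (ω n).P + (ω n).R * ζ n + (ω n).Q * (ζ (n - 1) * ζ n) := by
  obtain ⟨-, hu, heq⟩ := hζ n
  have hdet := (Matrix.isUnit_iff_isUnit_det _).1 hu
  have h1 : (1 - (ω n).Q * ζ (n - 1) - (ω n).R) * ζ n = (ω n).P := by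
    conv_lhs => rw [heq]
    rw [← mul_assoc, Matrix.mul_nonsing_inv _ hdet, one_mul]
  rw [← h1, ← mul_assoc]
  noncomm_ring

lemma adapted_inter_tau_le (N : ℤ) (k : ℕ) (l : Fin d) (t : ℕ) :
    Adapted t ({x : Path d | tau N x ≤ k} ∩ FirstAt (N, l) t) := by
  intro x y hxy hx
  have hy := adapted_firstAt (N, l) t hxy hx.2
  refine ⟨?_, hy⟩
  have h1 : tau N x = t := tau_eq_of_firstAt hx.2
  have h2 : tau N y = t := tau_eq_of_firstAt hy
  have h3 := hx.1
  simp only [Set.mem_ofPred_eq] at h3 ⊢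
  omega

lemma measurableSet_tau_le (N : ℤ) (k : ℕ) : MeasurableSet {x : Path d | tau N x ≤ k} :=
  measurableSet_le (measurable_tau N) measurable_const

/-- Reaching layer n+1 within time k forces both the passage to n and the one from n to n+1 to take
at most k steps. Only an upper bound is claimed: the two passages may add up to more than k. -/
lemma chain_two_layers_le (ω : Env d) (n : ℤ) (k : ℕ) (i j : Fin d) :
    chain ω (n - 1, i) ({x | tau (n + 1) x ≤ k} ∩ HitAt (n + 1, j)) ≤
      ∑ l, chain ω (n - 1, i) ({x | tau n x ≤ k} ∩ HitAt (n, l)) *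
        chain ω (n, l) ({x | tau (n + 1) x ≤ k} ∩ HitAt (n + 1, j)) := by
  have hD : MeasurableSet ({x : Path d | tau (n + 1) x ≤ k} ∩ HitAt (n + 1, j)) :=
    (measurableSet_tau_le _ _).inter (measurableSet_hitAt _)
  have hsub : chain ω (n - 1, i) ({x | tau (n + 1) x ≤ k} ∩ HitAt (n + 1, j)) ≤
      chain ω (n - 1, i) (⋃ l, ({x | tau n x ≤ k} ∩ HitAt (n, l) ∩
        post n ⁻¹' ({x | tau (n + 1) x ≤ k} ∩ HitAt (n + 1, j)))) := by
    refine measure_mono_ae ?_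
    filter_upwards [ae_chain_zero ω (n - 1, i), ae_chain_nearestNeighbor ω (n - 1, i)]
      with x h0 hnn hx
    have hx0 : (x 0).1 ≤ n := by rw [h0]; exact (sub_one_lt n).le
    obtain ⟨l, hl, hl'⟩ := (hnn.mem_hitAt_iff (w := (n + 1, j)) hx0 (lt_add_one n).le).1 hx.2
    have hle := (hnn.hits_of_hits hx0 (lt_add_one n).le hx.2.1).2
    have hadd := (tau_eq_add hx.2.1 hle).2
    have h3 : tau (n + 1) x ≤ k := hx.1
    refine Set.mem_iUnion.2 ⟨l, ⟨?_, hl⟩, ?_, hl'⟩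
    · exact hle.trans h3
    · change tau (n + 1) (post n x) ≤ k
      simp only at hadd
      omega
  refine hsub.trans ((measure_iUnion_le _).trans ?_)
  rw [tsum_fintype]
  exact Finset.sum_le_sum fun l _ =>
    (chain_inter_post ω (n - 1, i) (n, l) (adapted_inter_tau_le n k l) hD).le

/-- Hitting probabilities are the minimal nonnegative solution of the system: time-limited ones
start at 0 and are increased by one-step analysis, which preserves domination by ζ. Intersecting
with `HitAt` is essential, since `tau` is 0 on paths that miss the layer. -/
lemma IsZeta.chain_le {ζ : ℤ → Matrix (Fin d) (Fin d) ℝ} (hζ : IsZeta ω ζ) (k : ℕ) (n : ℤ)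
    (i j : Fin d) :
    chain ω (n, i) ({x | tau (n + 1) x ≤ k} ∩ HitAt (n + 1, j)) ≤ ENNReal.ofReal (ζ n i j) := by
  have hnn : ∀ n i j, 0 ≤ ζ n i j := fun n i j =>
    ((Matrix.mem_rowStochastic_iff_sum).1 (hζ n).1).1 i j
  induction k generalizing n i j with
  | zero =>
    refine le_of_eq_of_le ?_ zero_le
    refine measure_eq_zero_iff_ae_notMem.2 ?_
    filter_upwards [ae_chain_zero ω (n, i)] with x h0 hx
    have h1 : tau (n + 1) x = 0 := Nat.le_zero.1 hx.1
    have h2 := hx.2.1.tau_spec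
    simp only at h2
    rw [h1, h0] at h2
    simp at h2
  | succ k ih =>
    set D : Set (Path d) := {x | tau (n + 1) x ≤ k} ∩ HitAt (n + 1, j) with hDdef
    have hD : MeasurableSet D := (measurableSet_tau_le _ _).inter (measurableSet_hitAt _)
    have hsub : chain ω (n, i) ({x | tau (n + 1) x ≤ k + 1} ∩ HitAt (n + 1, j)) ≤
        chain ω (n, i) (drop 1 ⁻¹' D) := by
      refine measure_mono_ae ?_
      filter_upwards [ae_chain_zero ω (n, i)] with x h0 hx
      have hne : (x 0).1 ≠ n + 1 := by rw [h0]; simp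
      have h3 : tau (n + 1) x ≤ k + 1 := hx.1
      have h4 := tau_drop_one hne hx.2.1
      refine ⟨?_, (drop_one_mem_hitAt_iff (w := (n + 1, j)) hne).2 hx.2⟩
      change tau (n + 1) (drop 1 x) ≤ k
      omega
    refine hsub.trans ?_
    rw [chain_drop_one ω n i hD]
    have hP : ∀ l, chain ω (n + 1, l) D ≤ ENNReal.ofReal ((1 : Matrix (Fin d) (Fin d) ℝ) l j) := by
      intro l
      refine (measure_mono Set.inter_subset_right).trans ?_
      rw [chain_hitAt_self, Matrix.one_apply]
      split_ifs <;> simp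
    have hQ : ∀ l, chain ω (n - 1, l) D ≤ ENNReal.ofReal ((ζ (n - 1) * ζ n) l j) := by
      intro l
      refine (chain_two_layers_le ω n k l j).trans ?_
      rw [Matrix.mul_apply, ENNReal.ofReal_sum_of_nonneg
        fun l' _ => mul_nonneg (hnn _ _ _) (hnn _ _ _)]
      refine Finset.sum_le_sum fun l' _ => ?_
      rw [ENNReal.ofReal_mul (hnn _ _ _)]
      refine mul_le_mul' ?_ (ih n l' j)
      have := ih (n - 1) l l'
      rwa [sub_add_cancel] at this
    calc _ ≤ ∑ l, (ENNReal.ofReal ((ω n).P i l) *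
            ENNReal.ofReal ((1 : Matrix (Fin d) (Fin d) ℝ) l j) +
          ENNReal.ofReal ((ω n).R i l) * ENNReal.ofReal (ζ n l j) +
          ENNReal.ofReal ((ω n).Q i l) * ENNReal.ofReal ((ζ (n - 1) * ζ n) l j)) := by
          refine Finset.sum_le_sum fun l _ => ?_
          gcongr
          · exact hP l
          · exact ih n l j
          · exact hQ l
      _ = ENNReal.ofReal (ζ n i j) := by
          have hmul : ∀ l, 0 ≤ (ζ (n - 1) * ζ n) l j := fun l => by
            rw [Matrix.mul_apply]
            exact Finset.sum_nonneg fun l' _ => mul_nonneg (hnn _ _ _) (hnn _ _ _)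
          have hone : ∀ l, 0 ≤ (1 : Matrix (Fin d) (Fin d) ℝ) l j := fun l => by
            rw [Matrix.one_apply]; split_ifs <;> norm_num
          have p1 := fun l => mul_nonneg ((ω n).P_nonneg i l) (hone l)
          have p2 := fun l => mul_nonneg ((ω n).R_nonneg i l) (hnn n l j)
          have p3 := fun l => mul_nonneg ((ω n).Q_nonneg i l) (hmul l)
          conv_rhs => rw [hζ.eq_add n]
          rw [Matrix.add_apply, Matrix.add_apply, ← mul_one (ω n).P, Matrix.mul_apply,
            Matrix.mul_apply, Matrix.mul_apply, ← Finset.sum_add_distrib,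
            ← Finset.sum_add_distrib, ENNReal.ofReal_sum_of_nonneg
              fun l _ => add_nonneg (add_nonneg (p1 l) (p2 l)) (p3 l)]
          refine Finset.sum_congr rfl fun l _ => ?_
          rw [ENNReal.ofReal_add (add_nonneg (p1 l) (p2 l)) (p3 l),
            ENNReal.ofReal_add (p1 l) (p2 l), ENNReal.ofReal_mul ((ω n).P_nonneg i l),
            ENNReal.ofReal_mul ((ω n).R_nonneg i l), ENNReal.ofReal_mul ((ω n).Q_nonneg i l),
            mul_one]

lemma IsZeta.hm_le {ζ : ℤ → Matrix (Fin d) (Fin d) ℝ} (hζ : IsZeta ω ζ) (n : ℤ)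
    (i j : Fin d) : hm ω n (n + 1) i j ≤ ζ n i j := by
  have hnn : 0 ≤ ζ n i j := ((Matrix.mem_rowStochastic_iff_sum).1 (hζ n).1).1 i j
  rw [← ENNReal.ofReal_le_ofReal_iff hnn, ofReal_hm]
  have h1 : HitAt (n + 1, j) =
      ⋃ k : ℕ, ({x : Path d | tau (n + 1) x ≤ k} ∩ HitAt (n + 1, j)) := by
    rw [← Set.iUnion_inter]
    refine (Set.inter_eq_right.2 fun x _ => Set.mem_iUnion.2
      ⟨tau (n + 1) x, show tau (n + 1) x ≤ tau (n + 1) x from le_rfl⟩).symm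
  rw [h1, Monotone.measure_iUnion]
  · exact iSup_le fun k => hζ.chain_le k n i j
  · intro k k' hk x hx
    exact ⟨(show tau (n + 1) x ≤ k from hx.1).trans hk, hx.2⟩

/-- The system for `ζ` has exactly one stochastic solution, the hitting probabilities. -/
lemma Regular.eq_hm_of_isZeta (h : Regular ω) {ζ : ℤ → Matrix (Fin d) (Fin d) ℝ}
    (hζ : IsZeta ω ζ) (n : ℤ) : ζ n = hm ω n (n + 1) := by
  ext i j
  have h1 : ∑ j, hm ω n (n + 1) i j = ∑ j, ζ n i j := by
    rw [h.hm_rowSum (lt_add_one n).le, ((Matrix.mem_rowStochastic_iff_sum).1 (hζ n).1).2]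
  -- Entrywise inequality with equal row sums leaves no room for a strict inequality.
  exact ((Finset.sum_eq_sum_iff_of_le fun j _ => hζ.hm_le n i j).1 h1 j (Finset.mem_univ j)).symm

lemma Regular.zeta_eq (h : Regular ω) (n : ℤ) : zeta ω n = hm ω n (n + 1) :=
  h.eq_hm_of_isZeta (Classical.epsilon_spec ⟨_, h.isZeta_hm⟩) n

lemma Regular.zetaProd_eq (h : Regular ω) (n : ℤ) (k : ℕ) :
    zetaProd ω n k = hm ω (n - k) (n + 1) := by
  induction k with
  | zero => simp [zetaProd, h.zeta_eq]
  | succ k ih =>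
    rw [zetaProd, ih, h.zeta_eq, show n - (k : ℤ) = n - ((k + 1 : ℕ) : ℤ) + 1 by push_cast; ring]
    exact (hm_comp ω (by omega) (by push_cast; omega)).symm

end StripWalk

/-! ### Expected crossing times and the series -/

namespace StripWalk

variable {d : ℕ} {ω : Env d}

/-- The expected time that the walk from `(n, i)` needs to reach the layer `n + 1`. -/
noncomputable def crossTime (ω : Env d) (n : ℤ) (i : Fin d) : ℝ≥0∞ :=
  ∫⁻ x, (tau (n + 1) x : ℝ≥0∞) ∂chain ω (n, i)

/-- The crossing time, truncated at `k`. -/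
noncomputable def crossTimeTrunc (ω : Env d) (k : ℕ) (n : ℤ) (i : Fin d) : ℝ≥0∞ :=
  ∫⁻ x, ((min (tau (n + 1) x) k : ℕ) : ℝ≥0∞) ∂chain ω (n, i)

lemma measurable_tau_enn (N : ℤ) : Measurable fun x : Path d => (tau N x : ℝ≥0∞) :=
  (measurable_of_countable fun k : ℕ => (k : ℝ≥0∞)).comp (measurable_tau N)

lemma measurable_tau_min (N : ℤ) (k : ℕ) :
    Measurable fun x : Path d => ((min (tau N x) k : ℕ) : ℝ≥0∞) :=
  (measurable_of_countable fun t : ℕ => ((min t k : ℕ) : ℝ≥0∞)).comp (measurable_tau N)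

lemma ae_chain_tau_self (ω : Env d) (N : ℤ) (i : Fin d) : ∀ᵐ x ∂chain ω (N, i), tau N x = 0 := by
  filter_upwards [ae_chain_zero ω (N, i)] with x hx
  exact tau_eq (by rw [hx]) (by simp)

lemma Regular.ae_tau_drop_one (h : Regular ω) (n : ℤ) (i : Fin d) :
    ∀ᵐ x ∂chain ω (n, i), tau (n + 1) x = 1 + tau (n + 1) (drop 1 x) := by
  filter_upwards [ae_chain_zero ω (n, i), h.ae_hits (z := (n, i)) (lt_add_one n).le] with x h0 hx
  exact tau_drop_one (by rw [h0]; simp) hx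

lemma Regular.ae_tau_add (h : Regular ω) (n : ℤ) (i : Fin d) :
    ∀ᵐ x ∂chain ω (n - 1, i), tau (n + 1) x = tau n x + tau (n + 1) (post n x) := by
  filter_upwards [ae_chain_zero ω (n - 1, i), ae_chain_nearestNeighbor ω (n - 1, i),
    h.ae_hits (z := (n - 1, i)) (N := n + 1) (by simp only; omega)] with x h0 hnn hx
  exact (tau_eq_add hx (hnn.hits_of_hits (by rw [h0]; exact (sub_one_lt n).le)
    (lt_add_one n).le hx).2).2

/-- One-step analysis: a step to the right ends the crossing, and after a step to the left layer n
must be regained first. Working in `ℝ≥0∞` makes this valid before finiteness is known. -/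
lemma Regular.crossTime_eq (h : Regular ω) (n : ℤ) (i : Fin d) :
    crossTime ω n i = 1 + ∑ j, (ENNReal.ofReal ((ω n).R i j) * crossTime ω n j +
      ENNReal.ofReal ((ω n).Q i j) * (crossTime ω (n - 1) j +
        ∑ l, ENNReal.ofReal (hm ω (n - 1) n j l) * crossTime ω n l)) := by
  have h1 : crossTime ω n i = ∫⁻ x, (1 + (tau (n + 1) (drop 1 x) : ℝ≥0∞)) ∂chain ω (n, i) := by
    refine lintegral_congr_ae ?_
    filter_upwards [h.ae_tau_drop_one n i] with x hx
    rw [hx]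
    push_cast
    rfl
  rw [h1, lintegral_add_left measurable_const,
    lintegral_chain_drop_one ω n i (measurable_tau_enn (n + 1))]
  simp only [lintegral_const, measure_univ, mul_one]
  congr 1
  refine Finset.sum_congr rfl fun j _ => ?_
  have h2 : ∫⁻ x, (tau (n + 1) x : ℝ≥0∞) ∂chain ω (n + 1, j) = 0 := by
    rw [lintegral_congr_ae ((ae_chain_tau_self ω (n + 1) j).mono fun x hx =>
      show (tau (n + 1) x : ℝ≥0∞) = 0 by rw [hx]; simp)]
    simp
  have h3 : ∫⁻ x, (tau (n + 1) x : ℝ≥0∞) ∂chain ω (n - 1, j) = crossTime ω (n - 1) j +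
      ∑ l, ENNReal.ofReal (hm ω (n - 1) n j l) * crossTime ω n l := by
    rw [lintegral_congr_ae ((h.ae_tau_add n j).mono fun x hx =>
      show (tau (n + 1) x : ℝ≥0∞) = tau n x + tau (n + 1) (post n x) by rw [hx]; simp),
      lintegral_add_left (measurable_tau_enn n),
      lintegral_post ω (n - 1, j) n (h.ae_hits (sub_one_lt n).le) (measurable_tau_enn (n + 1))]
    simp only [ofReal_hm, crossTime, sub_add_cancel]
  rw [h2, h3, mul_zero, zero_add]
  rfl

/-- The inequality comes from min (a + b) k ≤ min a k + min b k, applied to the two passages after a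
step to the left. -/
lemma Regular.crossTimeTrunc_succ_le (h : Regular ω) (k : ℕ) (n : ℤ) (i : Fin d) :
    crossTimeTrunc ω (k + 1) n i ≤
      1 + ∑ j, (ENNReal.ofReal ((ω n).R i j) * crossTimeTrunc ω k n j +
        ENNReal.ofReal ((ω n).Q i j) * (crossTimeTrunc ω k (n - 1) j +
          ∑ l, ENNReal.ofReal (hm ω (n - 1) n j l) * crossTimeTrunc ω k n l)) := by
  have h1 : crossTimeTrunc ω (k + 1) n i =
      ∫⁻ x, (1 + ((min (tau (n + 1) (drop 1 x)) k : ℕ) : ℝ≥0∞)) ∂chain ω (n, i) := by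
    refine lintegral_congr_ae ?_
    filter_upwards [h.ae_tau_drop_one n i] with x hx
    rw [hx, show min (1 + tau (n + 1) (drop 1 x)) (k + 1) =
      1 + min (tau (n + 1) (drop 1 x)) k by omega]
    push_cast
    rfl
  rw [h1, lintegral_add_left measurable_const,
    lintegral_chain_drop_one ω n i (measurable_tau_min (n + 1) k)]
  simp only [lintegral_const, measure_univ, mul_one]
  refine add_le_add le_rfl (Finset.sum_le_sum fun j _ => ?_)
  have h2 : ∫⁻ x, ((min (tau (n + 1) x) k : ℕ) : ℝ≥0∞) ∂chain ω (n + 1, j) = 0 := by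
    rw [lintegral_congr_ae ((ae_chain_tau_self ω (n + 1) j).mono fun x hx =>
      show ((min (tau (n + 1) x) k : ℕ) : ℝ≥0∞) = 0 by rw [hx]; simp)]
    simp
  have h3 : ∫⁻ x, ((min (tau (n + 1) x) k : ℕ) : ℝ≥0∞) ∂chain ω (n - 1, j) ≤
      crossTimeTrunc ω k (n - 1) j +
      ∑ l, ENNReal.ofReal (hm ω (n - 1) n j l) * crossTimeTrunc ω k n l := by
    refine (lintegral_mono_ae ((h.ae_tau_add n j).mono fun x hx =>
      show ((min (tau (n + 1) x) k : ℕ) : ℝ≥0∞) ≤ ((min (tau n x) k : ℕ) : ℝ≥0∞) +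
        ((min (tau (n + 1) (post n x)) k : ℕ) : ℝ≥0∞) by
          rw [hx, ← Nat.cast_add]; exact Nat.cast_le.2 (by omega))).trans ?_
    rw [lintegral_add_left (measurable_tau_min n k),
      lintegral_post ω (n - 1, j) n (h.ae_hits (sub_one_lt n).le) (measurable_tau_min (n + 1) k)]
    simp only [ofReal_hm, crossTimeTrunc, sub_add_cancel]
    exact le_rfl
  rw [h2, mul_zero, zero_add]
  exact add_le_add le_rfl (mul_le_mul' le_rfl h3)

lemma crossTime_eq_iSup (ω : Env d) (n : ℤ) (i : Fin d) :
    crossTime ω n i = ⨆ k, crossTimeTrunc ω k n i := by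
  have h1 : ∀ x : Path d, (tau (n + 1) x : ℝ≥0∞) =
      ⨆ k : ℕ, ((min (tau (n + 1) x) k : ℕ) : ℝ≥0∞) := fun x =>
    le_antisymm (le_iSup_of_le (tau (n + 1) x) (by rw [min_self]))
      (iSup_le fun k => Nat.cast_le.2 (min_le_left _ _))
  simp only [crossTime, crossTimeTrunc, h1]
  refine lintegral_iSup (fun k => measurable_tau_min _ k) fun k k' hk x => ?_
  exact Nat.cast_le.2 (min_le_min le_rfl hk)

/-- Finiteness propagates to the left: by (C3) each site of layer -m-1 is entered with positive
probability from some site of layer -m, whose finite crossing time contains the crossing time from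
there. -/
lemma Regular.crossTime_ne_top (h : Regular ω) (h0 : ∀ i, crossTime ω 0 i ≠ ∞) (m : ℕ)
    (i : Fin d) : crossTime ω (-m) i ≠ ∞ := by
  induction m generalizing i with
  | zero => simpa using h0 i
  | succ m ih =>
    obtain ⟨l, hl⟩ := h.col_Q (-m) i
    have h1 := ih l
    rw [h.crossTime_eq] at h1
    have h2 := (ENNReal.sum_ne_top.1 (ENNReal.add_ne_top.1 h1).2) i (Finset.mem_univ i)
    have h3 := (ENNReal.add_ne_top.1 h2).2
    have h4 := ENNReal.lt_top_of_mul_ne_top_right h3 (ENNReal.ofReal_pos.2 hl).ne'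
    have h5 := (ENNReal.add_lt_top.1 h4).1
    rw [show (-((m + 1 : ℕ) : ℤ)) = -(m : ℤ) - 1 by push_cast; ring]
    exact h5.ne

lemma Regular.kernel_facts (h : Regular ω) (n : ℤ) :
    IsUnit (1 - ((ω n).Q * hm ω (n - 1) n + (ω n).R)) ∧
    resolvent ω n = (1 - ((ω n).Q * hm ω (n - 1) n + (ω n).R))⁻¹ ∧
    ∀ i j, 0 ≤ resolvent ω n i j := by
  have hst := h.hm_mem (sub_one_lt n).le
  have h1 : resolvent ω n = (1 - ((ω n).Q * hm ω (n - 1) n + (ω n).R))⁻¹ := by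
    rw [resolvent, h.zeta_eq, sub_add_cancel, sub_sub]
  refine ⟨isUnit_one_sub (kernel_nonneg ω n hst) (h.kernel_sum_lt_one n hst), h1, ?_⟩
  rw [h1]
  exact inv_one_sub_nonneg (kernel_nonneg ω n hst) (h.kernel_sum_lt_one n hst)

/-- The two forms of the recursion for the expected crossing times. -/
lemma Regular.eq_vecU_add_iff (h : Regular ω) (n : ℤ) (v v' : Fin d → ℝ) :
    v = vecU ω n + matA ω n *ᵥ v' ↔
      v = 1 + ((ω n).R *ᵥ v + (ω n).Q *ᵥ (v' + hm ω (n - 1) n *ᵥ v)) := by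
  obtain ⟨hu, hr, -⟩ := h.kernel_facts n
  have hdet := (Matrix.isUnit_iff_isUnit_det _).1 hu
  set K := (ω n).Q * hm ω (n - 1) n + (ω n).R
  have h1 : vecU ω n + matA ω n *ᵥ v' = (1 - K)⁻¹ *ᵥ (1 + (ω n).Q *ᵥ v') := by
    rw [vecU, matA, hr, ← Matrix.mulVec_mulVec, ← Matrix.mulVec_add]
  have h2 : (v = 1 + ((ω n).R *ᵥ v + (ω n).Q *ᵥ (v' + hm ω (n - 1) n *ᵥ v))) ↔
      (1 - K) *ᵥ v = 1 + (ω n).Q *ᵥ v' := by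
    rw [Matrix.sub_mulVec, Matrix.one_mulVec, Matrix.add_mulVec, ← Matrix.mulVec_mulVec,
      Matrix.mulVec_add, sub_eq_iff_eq_add]
    have : (1 : Fin d → ℝ) + ((ω n).R *ᵥ v + ((ω n).Q *ᵥ v' + (ω n).Q *ᵥ hm ω (n - 1) n *ᵥ v)) =
      1 + (ω n).Q *ᵥ v' + ((ω n).Q *ᵥ hm ω (n - 1) n *ᵥ v + (ω n).R *ᵥ v) := by abel
    rw [this]
  rw [h1, h2]
  constructor
  · intro hv
    rw [hv, Matrix.mulVec_mulVec, Matrix.mul_nonsing_inv _ hdet, Matrix.one_mulVec]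
  · intro hv
    rw [← hv, Matrix.mulVec_mulVec, Matrix.nonsing_inv_mul _ hdet, Matrix.one_mulVec]

lemma Regular.matA_nonneg (h : Regular ω) (n : ℤ) (i j : Fin d) : 0 ≤ matA ω n i j := by
  rw [matA, Matrix.mul_apply]
  exact Finset.sum_nonneg fun l _ => mul_nonneg ((h.kernel_facts n).2.2 i l) ((ω n).Q_nonneg l j)

lemma Regular.vecU_nonneg (h : Regular ω) (n : ℤ) (i : Fin d) : 0 ≤ vecU ω n i := by
  rw [vecU, Matrix.mulVec, dotProduct]
  exact Finset.sum_nonneg fun l _ => mul_nonneg ((h.kernel_facts n).2.2 i l) zero_le_one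

lemma mulVec_mono {A : Matrix (Fin d) (Fin d) ℝ} (hA : ∀ i j, 0 ≤ A i j) {v w : Fin d → ℝ}
    (hvw : ∀ i, v i ≤ w i) (i : Fin d) : (A *ᵥ v) i ≤ (A *ᵥ w) i := by
  simp only [Matrix.mulVec, dotProduct]
  exact Finset.sum_le_sum fun j _ => mul_le_mul_of_nonneg_left (hvw j) (hA i j)

/-- The `k`-th term of the series that starts from the layer `n`. -/
noncomputable def termAt (ω : Env d) : ℤ → ℕ → Fin d → ℝ
  | n, 0 => vecU ω n
  | n, k + 1 => matA ω n *ᵥ termAt ω (n - 1) k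

/-- The series multiplies by new matrices on the right, `termAt` on the left; the latter form fits
recursions in the starting layer. -/
lemma prodA_mulVec_termAt (ω : Env d) (k m : ℕ) :
    prodA ω k *ᵥ termAt ω (-(k : ℤ)) m = termAt ω 0 (k + m) := by
  induction k generalizing m with
  | zero => simp [prodA]
  | succ k ih =>
    rw [prodA, ← Matrix.mulVec_mulVec,
      show (-((k + 1 : ℕ) : ℤ)) = -(k : ℤ) - 1 by push_cast; ring]
    have h1 : matA ω (-(k : ℤ)) *ᵥ termAt ω (-(k : ℤ) - 1) m = termAt ω (-(k : ℤ)) (m + 1) := by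
      rw [termAt]
    rw [h1, ih]
    congr 1
    omega

lemma seriesTerm_eq (ω : Env d) (k : ℕ) : seriesTerm ω k = termAt ω 0 k := by
  have h := prodA_mulVec_termAt ω k 0
  rw [termAt] at h
  exact h

lemma Regular.termAt_nonneg (h : Regular ω) (n : ℤ) (k : ℕ) (i : Fin d) :
    0 ≤ termAt ω n k i := by
  induction k generalizing n i with
  | zero => rw [termAt]; exact h.vecU_nonneg n i
  | succ k ih =>
    simp only [termAt, Matrix.mulVec, dotProduct]
    exact Finset.sum_nonneg fun j _ => mul_nonneg (h.matA_nonneg n i j) (ih (n - 1) j)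

lemma sum_termAt_succ (ω : Env d) (n : ℤ) (N : ℕ) :
    ∑ k ∈ Finset.range (N + 1), termAt ω n k =
      vecU ω n + matA ω n *ᵥ ∑ k ∈ Finset.range N, termAt ω (n - 1) k := by
  rw [Finset.sum_range_succ', termAt, add_comm, Matrix.mulVec_sum]
  simp only [termAt]

lemma toReal_crossTime_eq (h : Regular ω) {n : ℤ} (hn : ∀ i, crossTime ω n i ≠ ∞)
    (hn' : ∀ i, crossTime ω (n - 1) i ≠ ∞) :
    (fun i => (crossTime ω n i).toReal) = vecU ω n + matA ω n *ᵥ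
      fun i => (crossTime ω (n - 1) i).toReal := by
  rw [h.eq_vecU_add_iff]
  funext i
  have hs : ∀ j, ∑ l, ENNReal.ofReal (hm ω (n - 1) n j l) * crossTime ω n l ≠ ∞ := fun j =>
    ENNReal.sum_ne_top.2 fun l _ => ENNReal.mul_ne_top ENNReal.ofReal_ne_top (hn l)
  have ht : ∀ j, crossTime ω (n - 1) j +
      ∑ l, ENNReal.ofReal (hm ω (n - 1) n j l) * crossTime ω n l ≠ ∞ := fun j =>
    ENNReal.add_ne_top.2 ⟨hn' j, hs j⟩
  have h1 : ∀ j, ENNReal.ofReal ((ω n).R i j) * crossTime ω n j ≠ ∞ := fun j =>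
    ENNReal.mul_ne_top ENNReal.ofReal_ne_top (hn j)
  have h2 : ∀ j, ENNReal.ofReal ((ω n).Q i j) * (crossTime ω (n - 1) j +
      ∑ l, ENNReal.ofReal (hm ω (n - 1) n j l) * crossTime ω n l) ≠ ∞ := fun j =>
    ENNReal.mul_ne_top ENNReal.ofReal_ne_top (ht j)
  conv_lhs => rw [h.crossTime_eq]
  rw [ENNReal.toReal_add ENNReal.one_ne_top
      (ENNReal.sum_ne_top.2 fun j _ => ENNReal.add_ne_top.2 ⟨h1 j, h2 j⟩),
    ENNReal.toReal_sum fun j _ => ENNReal.add_ne_top.2 ⟨h1 j, h2 j⟩]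
  simp only [Pi.add_apply, Pi.one_apply, ENNReal.toReal_one, Matrix.mulVec, dotProduct,
    ← Finset.sum_add_distrib]
  congr 1
  refine Finset.sum_congr rfl fun j _ => ?_
  rw [ENNReal.toReal_add (h1 j) (h2 j), ENNReal.toReal_mul, ENNReal.toReal_mul,
    ENNReal.toReal_ofReal ((ω n).R_nonneg i j), ENNReal.toReal_ofReal ((ω n).Q_nonneg i j),
    ENNReal.toReal_add (hn' j) (hs j), ENNReal.toReal_sum
      fun l _ => ENNReal.mul_ne_top ENNReal.ofReal_ne_top (hn l)]
  simp only [ENNReal.toReal_mul, ENNReal.toReal_ofReal (hm_nonneg _ _ _ _ _)]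

/-- Unrolling e_n = u_n + A_n e_{n-1} N times leaves a nonnegative remainder, because A_n and the
crossing times are nonnegative. -/
lemma Regular.sum_termAt_le (h : Regular ω) (h0 : ∀ i, crossTime ω 0 i ≠ ∞) (N m : ℕ)
    (i : Fin d) :
    (∑ k ∈ Finset.range N, termAt ω (-(m : ℤ)) k) i ≤ (crossTime ω (-(m : ℤ)) i).toReal := by
  induction N generalizing m i with
  | zero => simp
  | succ N ih =>
    have e : (-(m : ℤ) - 1) = -((m + 1 : ℕ) : ℤ) := by push_cast; ring
    have h1 := congrFun (toReal_crossTime_eq h (h.crossTime_ne_top h0 m)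
      (by rw [e]; exact h.crossTime_ne_top h0 (m + 1))) i
    rw [h1, sum_termAt_succ, e]
    exact add_le_add le_rfl (mulVec_mono (h.matA_nonneg _) (fun j => ih (m + 1) j) i)

lemma Regular.summable_termAt (h : Regular ω) (h0 : ∀ i, crossTime ω 0 i ≠ ∞) (m : ℕ)
    (i : Fin d) : Summable fun k => termAt ω (-(m : ℤ)) k i :=
  summable_of_sum_range_le (c := (crossTime ω (-(m : ℤ)) i).toReal)
    (fun k => h.termAt_nonneg _ k i) fun N => by
      have := h.sum_termAt_le h0 N m i
      rwa [Finset.sum_apply] at this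

/-- The sum of the series that starts from the layer `n`. -/
noncomputable def seriesAt (ω : Env d) (n : ℤ) : Fin d → ℝ := fun i => ∑' k, termAt ω n k i

lemma Regular.seriesAt_nonneg (h : Regular ω) (n : ℤ) (i : Fin d) : 0 ≤ seriesAt ω n i :=
  tsum_nonneg fun k => h.termAt_nonneg n k i

lemma Regular.seriesAt_eq (h : Regular ω) (h0 : ∀ i, crossTime ω 0 i ≠ ∞) (m : ℕ) :
    seriesAt ω (-(m : ℤ)) =
      vecU ω (-(m : ℤ)) + matA ω (-(m : ℤ)) *ᵥ seriesAt ω (-(m : ℤ) - 1) := by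
  funext i
  have e : (-(m : ℤ) - 1) = -((m + 1 : ℕ) : ℤ) := by push_cast; ring
  simp only [seriesAt, Pi.add_apply]
  rw [(h.summable_termAt h0 m i).tsum_eq_zero_add]
  simp only [termAt, Matrix.mulVec, dotProduct]
  congr 1
  rw [Summable.tsum_finsetSum]
  · simp only [tsum_mul_left]
    rfl
  · intro j _
    rw [e]
    exact (h.summable_termAt h0 (m + 1) j).mul_left _

/-- The series solves the recursion of the mean crossing times, and these are its least nonnegative
solution: the truncated times start at 0 and remain below the series. This excludes a nonzero
remainder in the unrolled recursion. -/
lemma Regular.crossTimeTrunc_le (h : Regular ω) (h0 : ∀ i, crossTime ω 0 i ≠ ∞) (k m : ℕ)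
    (i : Fin d) : crossTimeTrunc ω k (-(m : ℤ)) i ≤ ENNReal.ofReal (seriesAt ω (-(m : ℤ)) i) := by
  induction k generalizing m i with
  | zero => simp [crossTimeTrunc]
  | succ k ih =>
    have e : (-(m : ℤ) - 1) = -((m + 1 : ℕ) : ℤ) := by push_cast; ring
    have ih' : ∀ j, crossTimeTrunc ω k (-(m : ℤ) - 1) j ≤
        ENNReal.ofReal (seriesAt ω (-(m : ℤ) - 1) j) := by
      rw [e]; exact ih (m + 1)
    refine (h.crossTimeTrunc_succ_le k _ i).trans ?_
    have hs := (h.eq_vecU_add_iff _ _ _).1 (h.seriesAt_eq h0 m)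
    have hs' := congrFun hs i
    set n : ℤ := -(m : ℤ)
    have p0 := h.seriesAt_nonneg n
    have p1 : ∀ j, 0 ≤ ∑ l, hm ω (n - 1) n j l * seriesAt ω n l := fun j =>
      Finset.sum_nonneg fun l _ => mul_nonneg (hm_nonneg _ _ _ _ _) (p0 l)
    have p2 : ∀ j, 0 ≤ seriesAt ω (n - 1) j := h.seriesAt_nonneg (n - 1)
    have p3 : ∀ j, 0 ≤ (ω n).R i j * seriesAt ω n j := fun j =>
      mul_nonneg ((ω n).R_nonneg i j) (p0 j)
    have p4 : ∀ j, 0 ≤ (ω n).Q i j * (seriesAt ω (n - 1) j +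
        ∑ l, hm ω (n - 1) n j l * seriesAt ω n l) := fun j =>
      mul_nonneg ((ω n).Q_nonneg i j) (add_nonneg (p2 j) (p1 j))
    have hs2 : seriesAt ω n i = 1 + ∑ j, ((ω n).R i j * seriesAt ω n j +
        (ω n).Q i j * (seriesAt ω (n - 1) j + ∑ l, hm ω (n - 1) n j l * seriesAt ω n l)) := by
      simpa only [Pi.add_apply, Pi.one_apply, Matrix.mulVec, dotProduct,
        ← Finset.sum_add_distrib] using hs'
    rw [hs2, ENNReal.ofReal_add zero_le_one
        (Finset.sum_nonneg fun j _ => add_nonneg (p3 j) (p4 j)), ENNReal.ofReal_one,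
      ENNReal.ofReal_sum_of_nonneg fun j _ => add_nonneg (p3 j) (p4 j)]
    refine add_le_add le_rfl (Finset.sum_le_sum fun j _ => ?_)
    rw [ENNReal.ofReal_add (p3 j) (p4 j), ENNReal.ofReal_mul ((ω n).R_nonneg i j),
      ENNReal.ofReal_mul ((ω n).Q_nonneg i j), ENNReal.ofReal_add (p2 j) (p1 j),
      ENNReal.ofReal_sum_of_nonneg
        fun l _ => mul_nonneg (hm_nonneg ω (n - 1) n j l) (p0 l)]
    simp only [ENNReal.ofReal_mul (hm_nonneg _ _ _ _ _)]
    gcongr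
    · exact ih m j
    · exact ih' j
    · exact ih m _

lemma Regular.summable_seriesTerm (h : Regular ω) (h0 : ∀ i, crossTime ω 0 i ≠ ∞) :
    Summable (seriesTerm ω) := by
  rw [Pi.summable]
  intro i
  simp only [seriesTerm_eq]
  simpa using h.summable_termAt h0 0 i

/-- The series represents the expected crossing time. -/
lemma Regular.tsum_seriesTerm (h : Regular ω) (h0 : ∀ i, crossTime ω 0 i ≠ ∞) (i : Fin d) :
    (∑' k, seriesTerm ω k) i = (crossTime ω 0 i).toReal := by
  rw [tsum_apply (h.summable_seriesTerm h0)]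
  simp only [seriesTerm_eq]
  refine le_antisymm ?_ ?_
  · have hle : ∀ N, ∑ k ∈ Finset.range N, termAt ω 0 k i ≤ (crossTime ω 0 i).toReal := fun N => by
      have := h.sum_termAt_le h0 N 0 i
      rw [Finset.sum_apply] at this
      simpa using this
    exact Real.tsum_le_of_sum_range_le (fun k => h.termAt_nonneg 0 k i) hle
  · have h1 : crossTime ω 0 i ≤ ENNReal.ofReal (seriesAt ω 0 i) := by
      rw [crossTime_eq_iSup]
      refine iSup_le fun k => ?_
      simpa using h.crossTimeTrunc_le h0 k 0 i
    exact ENNReal.toReal_le_of_le_ofReal (h.seriesAt_nonneg 0 i) h1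

end StripWalk

/-! ### Contraction properties of stochastic matrices -/

namespace StripWalk

variable {d : ℕ} {ω : Env d}

/-- The largest `ℓ¹`-distance between two rows. -/
noncomputable def spread (M : Matrix (Fin d) (Fin d) ℝ) : ℝ :=
  ⨆ p : Fin d × Fin d, ∑ j, |M p.1 j - M p.2 j|

lemma le_spread (M : Matrix (Fin d) (Fin d) ℝ) (i i' : Fin d) :
    ∑ j, |M i j - M i' j| ≤ spread M :=
  le_ciSup (f := fun p : Fin d × Fin d => ∑ j, |M p.1 j - M p.2 j|)
    (Set.finite_range _).bddAbove (i, i')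

lemma spread_nonneg (M : Matrix (Fin d) (Fin d) ℝ) : 0 ≤ spread M :=
  Real.iSup_nonneg fun _ => Finset.sum_nonneg fun _ _ => abs_nonneg _

lemma spread_le {M : Matrix (Fin d) (Fin d) ℝ} {c : ℝ} (hc : 0 ≤ c)
    (h : ∀ i i', ∑ j, |M i j - M i' j| ≤ c) : spread M ≤ c :=
  Real.iSup_le (fun p => h p.1 p.2) hc

/-- Doeblin's contraction: differences of rows of M sum to zero, so ε may be subtracted from every
entry of B, which leaves nonnegative rows of mass 1 - dε. -/
lemma spread_mul_le {M B : Matrix (Fin d) (Fin d) ℝ}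
    (hM : ∀ i, ∑ j, M i j = 1) (hB : ∀ i, ∑ j, B i j = 1) {ε : ℝ} (hε : ∀ i j, ε ≤ B i j)
    (hdε : d * ε ≤ 1) : spread (M * B) ≤ (1 - d * ε) * spread M := by
  refine spread_le (mul_nonneg (sub_nonneg.2 hdε) (spread_nonneg M)) fun i i' => ?_
  have h1 : ∀ j, (M * B) i j - (M * B) i' j = ∑ l, (M i l - M i' l) * (B l j - ε) := by
    intro j
    have h0 : ∑ l, (M i l - M i' l) * ε = 0 := by
      rw [← Finset.sum_mul, Finset.sum_sub_distrib, hM, hM, sub_self, zero_mul]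
    simp only [Matrix.mul_apply, mul_sub, Finset.sum_sub_distrib, sub_mul] at h0 ⊢
    linarith
  calc ∑ j, |(M * B) i j - (M * B) i' j|
      ≤ ∑ j, ∑ l, |M i l - M i' l| * (B l j - ε) := by
        refine Finset.sum_le_sum fun j _ => ?_
        rw [h1]
        refine (Finset.abs_sum_le_sum_abs _ _).trans (le_of_eq (Finset.sum_congr rfl fun l _ => ?_))
        rw [abs_mul, abs_of_nonneg (sub_nonneg.2 (hε l j))]
    _ = (1 - d * ε) * ∑ l, |M i l - M i' l| := by
        rw [Finset.sum_comm, Finset.mul_sum]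
        refine Finset.sum_congr rfl fun l _ => ?_
        rw [← Finset.mul_sum, Finset.sum_sub_distrib, hB]
        simp [mul_comm]
    _ ≤ (1 - d * ε) * spread M :=
        mul_le_mul_of_nonneg_left (le_spread M i i') (sub_nonneg.2 hdε)

/-- The difference is an average, with weights p i · q i', of differences of rows of M. -/
lemma abs_vecMul_sub_le {p q : Fin d → ℝ} (hp : p ∈ stdSimplex ℝ (Fin d))
    (hq : q ∈ stdSimplex ℝ (Fin d)) (M : Matrix (Fin d) (Fin d) ℝ) (j : Fin d) :
    |(p ᵥ* M) j - (q ᵥ* M) j| ≤ spread M := by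
  have h1 : (p ᵥ* M) j - (q ᵥ* M) j = ∑ i, ∑ i', p i * q i' * (M i j - M i' j) := by
    have e1 : ∑ i, ∑ i', p i * q i' * M i j = ∑ i, p i * M i j := by
      refine Finset.sum_congr rfl fun i _ => ?_
      simp only [mul_right_comm _ (q _), ← Finset.mul_sum, hq.2, mul_one]
    have e2 : ∑ i, ∑ i', p i * q i' * M i' j = ∑ i', q i' * M i' j := by
      rw [Finset.sum_comm]
      refine Finset.sum_congr rfl fun i' _ => ?_
      simp only [mul_assoc, ← Finset.sum_mul, hp.2, one_mul]
    simp only [mul_sub, Finset.sum_sub_distrib, e1, e2]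
    rfl
  have h2 : ∑ i, ∑ i', p i * q i' * spread M = spread M := by
    simp only [mul_assoc, ← Finset.mul_sum, ← Finset.sum_mul, hp.2, hq.2, one_mul]
  rw [h1]
  refine le_trans ?_ h2.le
  refine (Finset.abs_sum_le_sum_abs _ _).trans (Finset.sum_le_sum fun i _ => ?_)
  refine (Finset.abs_sum_le_sum_abs _ _).trans (Finset.sum_le_sum fun i' _ => ?_)
  rw [abs_mul, abs_of_nonneg (mul_nonneg (hp.1 i) (hq.1 i'))]
  refine mul_le_mul_of_nonneg_left (le_trans ?_ (le_spread M i i')) (mul_nonneg (hp.1 i) (hq.1 i'))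
  exact Finset.single_le_sum (f := fun j => |M i j - M i' j|) (fun _ _ => abs_nonneg _)
    (Finset.mem_univ j)

lemma vecMul_mem_stdSimplex {p : Fin d → ℝ} (hp : p ∈ stdSimplex ℝ (Fin d))
    {M : Matrix (Fin d) (Fin d) ℝ} (hM : M ∈ Matrix.rowStochastic ℝ (Fin d)) :
    p ᵥ* M ∈ stdSimplex ℝ (Fin d) := by
  rw [Matrix.mem_rowStochastic_iff_sum] at hM
  simp only [stdSimplex, Set.mem_ofPred_eq, Matrix.vecMul, dotProduct]
  refine ⟨fun j => Finset.sum_nonneg fun i _ => mul_nonneg (hp.1 i) (hM.1 i j), ?_⟩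
  rw [Finset.sum_comm]
  simp only [← Finset.mul_sum, hM.2, mul_one, hp.2]

/-! ### Consequences of ergodicity -/

/-- f ∘ T - f is nonnegative with integral zero, so f is invariant almost everywhere and ergodicity
applies. -/
lemma ae_eq_const_of_le_comp {α : Type*} [MeasurableSpace α] {m : Measure α} {T : α → α}
    (hT : Ergodic T m) {f : α → ℝ} (hfm : Measurable f) (hf : Integrable f m)
    (hle : ∀ᵐ x ∂m, f x ≤ f (T x)) : ∃ c, ∀ᵐ x ∂m, f x = c := by
  have hi := hT.toMeasurePreserving.integrable_comp_of_integrable hf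
  have h0 : ∫ x, (f (T x) - f x) ∂m = 0 := by
    have h1 := integral_sub hi hf
    simp only [Function.comp_apply] at h1
    have h2 := integral_map (μ := m) (φ := T) hT.measurable.aemeasurable (f := f)
      hfm.aestronglyMeasurable
    rw [hT.map_eq] at h2
    rw [h1, ← h2, sub_self]
  have h3 := (integral_eq_zero_iff_of_nonneg_ae (hle.mono fun x hx => sub_nonneg.2 hx)
    (hi.sub hf)).1 h0
  exact hT.ae_eq_const_of_ae_eq_comp₀ hfm.nullMeasurable
    (h3.mono fun x hx => sub_eq_zero.1 hx)

lemma ae_shift_iterate {P : Measure (Env d)} (hP : Ergodic shift P) {p : Env d → Prop}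
    (h : ∀ᵐ ω ∂P, p ω) : ∀ᵐ ω ∂P, ∀ n : ℕ, p (shift^[n] ω) :=
  ae_all_iff.2 fun n => (hP.iterate n).quasiMeasurePreserving.ae h

lemma hm_shift_iterate (ω : Env d) (n : ℕ) (m N : ℤ) :
    hm (shift^[n] ω) m N = hm ω (m + n) (N + n) := by
  induction n generalizing ω with
  | zero => simp
  | succ n ih =>
    rw [Function.iterate_succ_apply, ih, hm_shift]
    congr 1 <;> push_cast <;> ring

lemma hm_pos_of_transProb_pos {z z' w : Strip d} (hz : z.1 < w.1) (hp : 0 < transProb ω z z')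
    (h : 0 < hm ω z'.1 w.1 z'.2 w.2) : 0 < hm ω z.1 w.1 z.2 w.2 := by
  refine (hm_nonneg _ _ _ _ _).lt_of_ne fun h0 => h.ne' ?_
  have h1 : chain ω z (HitAt w) = 0 :=
    ((ENNReal.toReal_eq_zero_iff _).1 h0.symm).resolve_right (measure_ne_top _ _)
  have h2 : ∀ᵐ x ∂chain ω z, drop 1 x ∈ (HitAt w)ᶜ := by
    filter_upwards [measure_eq_zero_iff_ae_notMem.1 h1, ae_chain_zero ω z] with x hx h0 hx'
    exact hx ((drop_one_mem_hitAt_iff (by rw [h0]; exact hz.ne)).1 hx')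
  have h3 := ae_chain_of_transProb_pos hp (measurableSet_hitAt w).compl h2
  have h4 : chain ω z' (HitAt w) = 0 := measure_eq_zero_iff_ae_notMem.2 h3
  change (chain ω z' (HitAt w)).toReal = 0
  rw [h4, ENNReal.toReal_zero]

/-- By (C3) every site is entered from the previous layer; going back layer by layer gives a
positive-probability route from layer 0. -/
lemma Regular.exists_hm_pos (h : Regular ω) (L : ℕ) (j : Fin d) : ∃ i, 0 < hm ω 0 L i j := by
  induction L generalizing j with
  | zero => exact ⟨j, by simp [hm_self]⟩
  | succ L ih =>
    obtain ⟨l, hl⟩ := h.col_P L j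
    obtain ⟨i, hi⟩ := ih l
    have h1 : 0 < hm ω L (L + 1) l j :=
      hm_pos_of_transProb_pos (z := (L, l)) (z' := (L + 1, j)) (w := (L + 1, j)) (lt_add_one _)
        (by rw [transProb_add_one]; exact hl) (by simp [hm_self])
    refine ⟨i, ?_⟩
    push_cast
    rw [hm_comp ω (by omega : (0 : ℤ) ≤ L) (by omega), Matrix.mul_apply]
    exact Finset.sum_pos' (fun l _ => mul_nonneg (hm_nonneg _ _ _ _ _) (hm_nonneg _ _ _ _ _))
      ⟨l, Finset.mem_univ l, mul_pos hi h1⟩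

/-- A route from z to w can be prefixed to one from w to layer L without hitting L earlier, provided
L lies to the right of all sites the route leaves; this determines L₀. -/
lemma exists_hm_pos_of_reach {z w : Strip d}
    (h : Relation.ReflTransGen (fun z w : Strip d => 0 < transProb ω z w) z w) :
    ∃ L₀ : ℕ, ∀ L : ℕ, L₀ ≤ L → ∀ j, 0 < hm ω w.1 L w.2 j → 0 < hm ω z.1 L z.2 j := by
  induction h using Relation.ReflTransGen.head_induction_on with
  | refl => exact ⟨0, fun _ _ _ h => h⟩
  | @head a c hac _ ih =>
    obtain ⟨L₀, hL⟩ := ih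
    refine ⟨max L₀ (a.1 + 1).toNat, fun L hLL j hj => ?_⟩
    have h1 : L₀ ≤ L := (le_max_left _ _).trans hLL
    have h2 : (a.1 + 1).toNat ≤ L := (le_max_right _ _).trans hLL
    exact hm_pos_of_transProb_pos (w := (L, j)) (by simp only; omega) hac (hL L h1 j hj)

lemma Regular.exists_block_pos (h : Regular ω) (hc : LayerZeroCommunicates ω) :
    ∃ L : ℕ, ∀ i j, 0 < hm ω 0 L i j := by
  choose L₀ hL₀ using fun p : Fin d × Fin d => exists_hm_pos_of_reach (hc p.1 p.2)
  refine ⟨Finset.univ.sup L₀, fun i j => ?_⟩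
  obtain ⟨i', hi'⟩ := h.exists_hm_pos (Finset.univ.sup L₀) j
  exact hL₀ (i, i') _ (Finset.le_sup (Finset.mem_univ _)) j hi'

/-- The length of the positive block depends on ω, but it takes countably many values, so one of
them has positive probability. -/
lemma exists_frequently_block {P : Measure (Env d)} (hC : ConditionC P)
    (hreg : ∀ᵐ ω ∂P, Regular ω) : ∃ L : ℕ, ∃ᶠ ω in ae P, ∀ i j, 0 < hm ω 0 L i j := by
  by_contra h
  rw [not_exists] at h
  have h1 : ∀ᵐ ω ∂P, ∀ L : ℕ, ¬ ∀ i j, 0 < hm ω 0 L i j :=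
    ae_all_iff.2 fun L => Filter.not_frequently.1 (h L)
  refine hC.communication.ne' (measure_eq_zero_iff_ae_notMem.2 ?_)
  filter_upwards [h1, hreg] with ω hω hr hc
  obtain ⟨L, hL⟩ := hr.exists_block_pos hc
  exact hω L hL

/-- The infimum of the spreads of the products `ζ_{-k} ⋯ ζ_{-1}`. -/
noncomputable def limSpread (ω : Env d) : ℝ := ⨅ k : ℕ, spread (hm ω (-(k : ℤ)) 0)

lemma limSpread_le (ω : Env d) (k : ℕ) : limSpread ω ≤ spread (hm ω (-(k : ℤ)) 0) :=
  ciInf_le ⟨0, by rintro _ ⟨k, rfl⟩; exact spread_nonneg _⟩ k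

lemma limSpread_nonneg (ω : Env d) : 0 ≤ limSpread ω := Real.iInf_nonneg fun _ => spread_nonneg _

lemma measurable_spread_hm (m N : ℤ) : Measurable fun ω : Env d => spread (hm ω m N) := by
  refine Measurable.iSup fun p => Finset.measurable_sum _ fun j _ => ?_
  exact continuous_abs.measurable.comp ((measurable_hm m N p.1 j).sub (measurable_hm m N p.2 j))

lemma measurable_limSpread : Measurable (limSpread (d := d)) :=
  Measurable.iInf fun _ => measurable_spread_hm _ _

lemma Regular.limSpread_shift_iterate_le (h : Regular ω) (L : ℕ) {ε : ℝ}
    (hε : ∀ i j, ε ≤ hm ω 0 L i j) (hdε : d * ε ≤ 1) :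
    limSpread (shift^[L] ω) ≤ (1 - d * ε) * limSpread ω := by
  rw [limSpread.eq_def ω, Real.mul_iInf_of_nonneg (sub_nonneg.2 hdε)]
  refine le_ciInf fun k => ?_
  have hk : (0 : ℤ) ≤ k := Int.natCast_nonneg k
  have hL : (0 : ℤ) ≤ L := Int.natCast_nonneg L
  -- Seen from layer L, the product with k + L factors is the one from -k to 0 followed by the block
  -- from 0 to L.
  have h1 := limSpread_le (shift^[L] ω) (k + L)
  rw [hm_shift_iterate, show (-((k + L : ℕ) : ℤ) + L) = -(k : ℤ) by push_cast; ring, zero_add,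
    hm_comp ω (by omega : -(k : ℤ) ≤ 0) hL] at h1
  exact h1.trans (spread_mul_le (h.hm_rowSum (by omega)) (h.hm_rowSum hL) hε hdε)

/-- The limit spread cannot increase under the shift, so it is almost surely constant. Where a
positive block occurs, it contracts by a factor less than 1, which forces the constant to be 0. -/
lemma ae_limSpread_eq_zero (hd : 1 ≤ d) {P : Measure (Env d)} [IsProbabilityMeasure P]
    (hC : ConditionC P) (hreg : ∀ᵐ ω ∂P, Regular ω) : ∀ᵐ ω ∂P, limSpread ω = 0 := by
  have hle : ∀ᵐ ω ∂P, limSpread (shift ω) ≤ limSpread ω := by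
    filter_upwards [hreg] with ω hω
    simpa using hω.limSpread_shift_iterate_le 1 (ε := 0) (fun i j => hm_nonneg _ _ _ _ _)
      (by simp)
  have hint : Integrable (limSpread (d := d)) P := by
    refine Integrable.of_bound measurable_limSpread.aestronglyMeasurable 2 ?_
    filter_upwards [hreg] with ω hω
    rw [Real.norm_eq_abs, abs_of_nonneg (limSpread_nonneg ω)]
    refine (limSpread_le ω 0).trans (spread_le two_pos.le fun i i' => ?_)
    have h1 := hω.hm_rowSum (m := -((0 : ℕ) : ℤ)) (N := 0) (by simp)
    calc _ ≤ ∑ j, (hm ω (-((0 : ℕ) : ℤ)) 0 i j + hm ω (-((0 : ℕ) : ℤ)) 0 i' j) := by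
          refine Finset.sum_le_sum fun j _ => (abs_sub _ _).trans ?_
          rw [abs_of_nonneg (hm_nonneg _ _ _ _ _), abs_of_nonneg (hm_nonneg _ _ _ _ _)]
      _ = 2 := by rw [Finset.sum_add_distrib, h1, h1]; norm_num
  obtain ⟨c, hc⟩ := ae_eq_const_of_le_comp hC.ergodic measurable_limSpread.neg hint.neg
    (hle.mono fun ω h => neg_le_neg h)
  obtain ⟨L, hL⟩ := exists_frequently_block hC hreg
  obtain ⟨ω, hpos, hω, hcω⟩ :=
    (hL.and_eventually (hreg.and (ae_shift_iterate hC.ergodic hc))).exists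
  have hne : Nonempty (Fin d) := ⟨⟨0, hd⟩⟩
  obtain ⟨p, hp⟩ := Finite.exists_min fun p : Fin d × Fin d => hm ω 0 L p.1 p.2
  set ε := hm ω 0 L p.1 p.2
  have hεpos : 0 < ε := hpos _ _
  have hε : ∀ i j, ε ≤ hm ω 0 L i j := fun i j => hp (i, j)
  have hdε : d * ε ≤ 1 := by
    rw [← hω.hm_rowSum (m := 0) (N := L) (by omega) p.1]
    have := Finset.card_nsmul_le_sum Finset.univ (fun j => hm ω 0 L p.1 j) ε
      fun j _ => hε p.1 j
    simpa using this
  have h1 := hω.limSpread_shift_iterate_le L hε hdε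
  have h2 : -limSpread ω = c := hcω 0
  have h3 : -limSpread (shift^[L] ω) = c := hcω L
  have hdpos : (0 : ℝ) < d * ε := mul_pos (by exact_mod_cast hd) hεpos
  have h4 : limSpread ω ≤ 0 := by
    rw [show limSpread (shift^[L] ω) = limSpread ω by linarith] at h1
    nlinarith
  have h5 : c = 0 := by linarith [limSpread_nonneg ω]
  filter_upwards [hc] with ω' h'
  have : -limSpread ω' = c := h'
  linarith

/-- A bounded family with `f = ζ_0 (f ∘ θ)` is constant. -/
lemma ae_eq_const_of_harmonic (hd : 1 ≤ d) {P : Measure (Env d)} [IsProbabilityMeasure P]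
    (hC : ConditionC P) (hreg : ∀ᵐ ω ∂P, Regular ω) {f : Env d → Fin d → ℝ}
    (hfm : ∀ i, Measurable fun ω => f ω i) (hf0 : ∀ ω i, 0 ≤ f ω i) (hf1 : ∀ ω i, f ω i ≤ 1)
    (hf : ∀ᵐ ω ∂P, f ω = hm ω 0 1 *ᵥ f (shift ω)) : ∃ c, ∀ᵐ ω ∂P, ∀ i, f ω i = c := by
  have hne : Nonempty (Fin d) := ⟨⟨0, hd⟩⟩
  have hle : ∀ ω i, f ω i ≤ ⨆ i, f ω i := fun ω i => le_ciSup (Set.finite_range _).bddAbove i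
  have hge : ∀ ω i, ⨅ i, f ω i ≤ f ω i := fun ω i => ciInf_le (Set.finite_range _).bddBelow i
  have hmax : ∃ c, ∀ᵐ ω ∂P, ⨆ i, f ω i = c := by
    have hmeas : Measurable fun ω => ⨆ i, f ω i := Measurable.iSup hfm
    refine ae_eq_const_of_le_comp hC.ergodic hmeas
      (Integrable.of_bound hmeas.aestronglyMeasurable 1 (Eventually.of_forall fun ω => ?_)) ?_
    · rw [Real.norm_eq_abs, abs_of_nonneg (Real.iSup_nonneg (hf0 ω))]
      exact ciSup_le (hf1 ω)
    · filter_upwards [hf, hreg] with ω h1 hω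
      refine ciSup_le fun i => ?_
      rw [h1]
      simp only [Matrix.mulVec, dotProduct]
      calc _ ≤ ∑ j, hm ω 0 1 i j * ⨆ i, f (shift ω) i :=
            Finset.sum_le_sum fun j _ =>
              mul_le_mul_of_nonneg_left (hle _ j) (hm_nonneg _ _ _ _ _)
        _ = _ := by rw [← Finset.sum_mul, hω.hm_rowSum zero_le_one, one_mul]
  have hmin : ∃ c, ∀ᵐ ω ∂P, -⨅ i, f ω i = c := by
    have hmeas : Measurable fun ω => -⨅ i, f ω i := (Measurable.iInf hfm).neg
    refine ae_eq_const_of_le_comp hC.ergodic hmeas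
      (Integrable.of_bound hmeas.aestronglyMeasurable 1 (Eventually.of_forall fun ω => ?_)) ?_
    · rw [norm_neg, Real.norm_eq_abs, abs_of_nonneg (Real.iInf_nonneg (hf0 ω))]
      exact (hge ω ⟨0, hd⟩).trans (hf1 ω _)
    · filter_upwards [hf, hreg] with ω h1 hω
      refine neg_le_neg (le_ciInf fun i => ?_)
      rw [h1]
      simp only [Matrix.mulVec, dotProduct]
      calc _ = ∑ j, hm ω 0 1 i j * ⨅ i, f (shift ω) i := by
            rw [← Finset.sum_mul, hω.hm_rowSum zero_le_one, one_mul]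
        _ ≤ _ := Finset.sum_le_sum fun j _ =>
              mul_le_mul_of_nonneg_left (hge _ j) (hm_nonneg _ _ _ _ _)
  obtain ⟨a, ha⟩ := hmax
  obtain ⟨b, hb⟩ := hmin
  obtain ⟨L, hL⟩ := exists_frequently_block hC hreg
  obtain ⟨ω, hpos, hω, haω, hbω, hfω⟩ := (hL.and_eventually (hreg.and
    ((ae_shift_iterate hC.ergodic ha).and ((ae_shift_iterate hC.ergodic hb).and
      (ae_shift_iterate hC.ergodic hf))))).exists
  have hiter : ∀ n : ℕ, f ω = hm ω 0 n *ᵥ f (shift^[n] ω) := by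
    intro n
    induction n with
    | zero => simp [hm_self]
    | succ n ih =>
      rw [ih, hfω n, hm_shift_iterate, Matrix.mulVec_mulVec, ← Function.iterate_succ_apply' shift,
        zero_add, Nat.cast_add, Nat.cast_one, add_comm (1 : ℤ),
        ← hm_comp ω (by omega) (by omega)]
  obtain ⟨i, hi⟩ := Finite.exists_max (f ω)
  obtain ⟨j, hj⟩ := Finite.exists_min (f (shift^[L] ω))
  have hi' : f ω i = a := le_antisymm ((hle ω i).trans (haω 0).le)
    ((haω 0).symm.le.trans (ciSup_le hi))
  have hj' : f (shift^[L] ω) j ≤ -b := by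
    have h1 : -⨅ i, f (shift^[L] ω) i = b := hbω L
    have h2 : f (shift^[L] ω) j ≤ ⨅ i, f (shift^[L] ω) i := le_ciInf hj
    linarith
  -- The positive block gives positive weight to a site where f is minimal; if the minimum were
  -- below the maximum a, the average at the maximising site would be less than a.
  have hab : a ≤ -b := by
    by_contra! hlt
    have h1 : f ω i < ∑ l, hm ω 0 L i l * a := by
      conv_lhs => rw [hiter L]
      simp only [Matrix.mulVec, dotProduct]
      refine Finset.sum_lt_sum (fun l _ => ?_) ⟨j, Finset.mem_univ j, ?_⟩
      · exact mul_le_mul_of_nonneg_left ((hle _ l).trans (haω L).le) (hm_nonneg _ _ _ _ _)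
      · exact mul_lt_mul_of_pos_left (hj'.trans_lt hlt) (hpos i j)
    rw [← Finset.sum_mul, hω.hm_rowSum (by omega), one_mul] at h1
    exact h1.ne hi'
  refine ⟨a, ?_⟩
  filter_upwards [ha, hb] with ω' h1 h2 l
  refine le_antisymm ((hle ω' l).trans h1.le) ?_
  have := hge ω' l
  linarith

/-! ### The vectors `y_n` -/

lemma Regular.dist_zetaProd_le (h : Regular ω) (k₀ k k' : ℕ) (hk : k₀ ≤ k) (hk' : k₀ ≤ k')
    {p p' : Fin d → ℝ} (hp : p ∈ stdSimplex ℝ (Fin d)) (hp' : p' ∈ stdSimplex ℝ (Fin d)) :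
    dist (p ᵥ* zetaProd ω (-1) k) (p' ᵥ* zetaProd ω (-1) k') ≤
      spread (hm ω (-((k₀ + 1 : ℕ) : ℤ)) 0) := by
  have key : ∀ k : ℕ, k₀ ≤ k → zetaProd ω (-1) k =
      hm ω (-1 - k) (-((k₀ + 1 : ℕ) : ℤ)) * hm ω (-((k₀ + 1 : ℕ) : ℤ)) 0 := fun k hk => by
    rw [h.zetaProd_eq, neg_add_cancel]
    exact hm_comp ω (by push_cast; omega) (by push_cast; omega)
  rw [dist_pi_le_iff (spread_nonneg _), key k hk, key k' hk', ← Matrix.vecMul_vecMul,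
    ← Matrix.vecMul_vecMul]
  intro j
  rw [Real.dist_eq]
  exact abs_vecMul_sub_le (vecMul_mem_stdSimplex hp (h.hm_mem (by push_cast; omega)))
    (vecMul_mem_stdSimplex hp' (h.hm_mem (by push_cast; omega))) _ j

/-- The products defining y have at least one factor, hence the index k₀ + 1. An extra stochastic
factor on the left only averages rows and does not increase the spread. -/
lemma Regular.exists_spread_lt (h : Regular ω) (h0 : limSpread ω = 0) {ε : ℝ} (hε : 0 < ε) :
    ∃ k₀ : ℕ, spread (hm ω (-((k₀ + 1 : ℕ) : ℤ)) 0) < ε := by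
  obtain ⟨k, hk⟩ := exists_lt_of_ciInf_lt (show limSpread ω < ε by rwa [h0])
  refine ⟨k, lt_of_le_of_lt ?_ hk⟩
  have h1 : hm ω (-((k + 1 : ℕ) : ℤ)) 0 =
      hm ω (-((k + 1 : ℕ) : ℤ)) (-(k : ℤ)) * hm ω (-(k : ℤ)) 0 :=
    hm_comp ω (by push_cast; omega) (by omega)
  refine spread_le (spread_nonneg _) fun i i' => ?_
  set A := hm ω (-((k + 1 : ℕ) : ℤ)) (-(k : ℤ))
  set M := hm ω (-(k : ℤ)) 0
  have hA : ∀ i, ∑ j, A i j = 1 := h.hm_rowSum (by push_cast; omega)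
  have hA0 : ∀ i j, 0 ≤ A i j := hm_nonneg ω _ _
  have e : ∀ j, (A * M) i j - (A * M) i' j = ∑ l, ∑ l', A i l * A i' l' * (M l j - M l' j) := by
    intro j
    have e1 : ∑ l, ∑ l', A i l * A i' l' * M l j = ∑ l, A i l * M l j := by
      refine Finset.sum_congr rfl fun l _ => ?_
      simp only [mul_right_comm _ (A i' _), ← Finset.mul_sum, hA, mul_one]
    have e2 : ∑ l, ∑ l', A i l * A i' l' * M l' j = ∑ l', A i' l' * M l' j := by
      rw [Finset.sum_comm]
      refine Finset.sum_congr rfl fun l' _ => ?_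
      simp only [mul_assoc, ← Finset.sum_mul, hA, one_mul]
    simp only [mul_sub, Finset.sum_sub_distrib, e1, e2, Matrix.mul_apply]
  have hAA : ∑ l, ∑ l', A i l * A i' l' * spread M = spread M := by
    simp only [mul_assoc, ← Finset.mul_sum, ← Finset.sum_mul, hA, one_mul]
  rw [h1, ← hAA]
  calc ∑ j, |(A * M) i j - (A * M) i' j|
      ≤ ∑ j, ∑ l, ∑ l', A i l * A i' l' * |M l j - M l' j| := by
        refine Finset.sum_le_sum fun j _ => ?_
        rw [e]
        refine (Finset.abs_sum_le_sum_abs _ _).trans (Finset.sum_le_sum fun l _ => ?_)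
        refine (Finset.abs_sum_le_sum_abs _ _).trans (Finset.sum_le_sum fun l' _ => ?_)
        rw [abs_mul, abs_of_nonneg (mul_nonneg (hA0 i l) (hA0 i' l'))]
    _ = ∑ l, ∑ l', A i l * A i' l' * ∑ j, |M l j - M l' j| := by
        rw [Finset.sum_comm]
        refine Finset.sum_congr rfl fun l _ => ?_
        rw [Finset.sum_comm]
        simp only [Finset.mul_sum]
    _ ≤ _ := Finset.sum_le_sum fun l _ => Finset.sum_le_sum fun l' _ =>
        mul_le_mul_of_nonneg_left (le_spread M l l') (mul_nonneg (hA0 i l) (hA0 i' l'))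

lemma Regular.isY_vecY (hd : 1 ≤ d) (h : Regular ω) (h0 : limSpread ω = 0) :
    IsY ω (-1) (vecY ω (-1)) := by
  refine Classical.epsilon_spec (p := IsY ω (-1)) ?_
  set q : Fin d → ℝ := Pi.single ⟨0, hd⟩ 1
  have hq : q ∈ stdSimplex ℝ (Fin d) := single_mem_stdSimplex ℝ _
  have hcau : CauchySeq fun k => q ᵥ* zetaProd ω (-1) k := by
    refine Metric.cauchySeq_iff.2 fun ε hε => ?_
    obtain ⟨k₀, hk₀⟩ := h.exists_spread_lt h0 hε
    exact ⟨k₀, fun k hk k' hk' => (h.dist_zetaProd_le k₀ k k' hk hk' hq hq).trans_lt hk₀⟩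
  obtain ⟨v, hv⟩ := cauchySeq_tendsto_of_complete hcau
  refine ⟨v, fun p hp => ?_⟩
  refine (tendsto_iff_of_dist ?_).1 hv
  refine Metric.tendsto_atTop.2 fun ε hε => ?_
  obtain ⟨k₀, hk₀⟩ := h.exists_spread_lt h0 hε
  refine ⟨k₀, fun k hk => ?_⟩
  rw [Real.dist_eq, sub_zero, abs_of_nonneg dist_nonneg]
  exact (h.dist_zetaProd_le k₀ k k hk hk hq (hp k)).trans_lt hk₀

/-- The products for the shifted environment end one layer further right, so each is a product for ω
times ζ_0, and the limit passes through. -/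
lemma Regular.vecY_shift (hd : 1 ≤ d) (h : Regular ω) (h0 : limSpread ω = 0)
    (h0' : limSpread (shift ω) = 0) : vecY (shift ω) (-1) = vecY ω (-1) ᵥ* hm ω 0 1 := by
  set q : Fin d → ℝ := Pi.single ⟨0, hd⟩ 1
  have hq : q ∈ stdSimplex ℝ (Fin d) := single_mem_stdSimplex ℝ _
  have h1 := (regular_shift h).isY_vecY hd h0' (fun _ => q) fun _ => hq
  have h2 := h.isY_vecY hd h0 (fun _ => q) fun _ => hq
  refine tendsto_nhds_unique ((tendsto_add_atTop_iff_nat 1).2 h1) ?_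
  have h3 : ∀ k : ℕ, q ᵥ* zetaProd (shift ω) (-1) (k + 1) =
      (q ᵥ* zetaProd ω (-1) k) ᵥ* hm ω 0 1 := fun k => by
    rw [(regular_shift h).zetaProd_eq, h.zetaProd_eq, hm_shift, Matrix.vecMul_vecMul, neg_add_cancel,
      zero_add, show (-1 - ((k + 1 : ℕ) : ℤ) + 1) = -1 - (k : ℤ) by push_cast; ring,
      ← hm_comp ω (by omega) zero_le_one]
  simp only [h3]
  have hcont : Continuous fun v : Fin d → ℝ => v ᵥ* hm ω 0 1 :=
    continuous_id.matrix_vecMul continuous_const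
  exact (hcont.tendsto _).comp h2

lemma ae_vec_shift (hd : 1 ≤ d) {P : Measure (Env d)} [IsProbabilityMeasure P]
    (hC : ConditionC P) (hreg : ∀ᵐ ω ∂P, Regular ω) {μ : InitialLaw d}
    (hμ : ∀ᵐ ω ∂P, μ.vec ω = vecY ω (-1)) :
    ∀ᵐ ω ∂P, μ.vec (shift ω) = μ.vec ω ᵥ* hm ω 0 1 := by
  have h0 := ae_limSpread_eq_zero hd hC hreg
  have hq := hC.ergodic.quasiMeasurePreserving
  filter_upwards [hreg, h0, hq.ae h0, hμ, hq.ae hμ] with ω h1 h2 h3 h4 h5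
  rw [h5, h4, h1.vecY_shift hd h2 h3]

/-- Strict positivity of μ is forward invariant, since every column of ζ_0 has a positive entry, and
it is produced by a positive block; ergodicity makes it almost sure. It is needed to get finite
crossing times from every site of layer 0. -/
lemma ae_vec_pos {P : Measure (Env d)} [IsProbabilityMeasure P]
    (hC : ConditionC P) (hreg : ∀ᵐ ω ∂P, Regular ω) {μ : InitialLaw d}
    (hμ : ∀ᵐ ω ∂P, μ.vec (shift ω) = μ.vec ω ᵥ* hm ω 0 1) :
    ∀ᵐ ω ∂P, ∀ i, 0 < μ.vec ω i := by
  set G : Set (Env d) := {ω | ∀ i, 0 < μ.vec ω i} with hG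
  have hGm : MeasurableSet G := by
    have : G = ⋂ i, {ω | 0 < μ.vec ω i} := by ext ω; simp [hG]
    rw [this]
    exact MeasurableSet.iInter fun i => measurableSet_lt measurable_const
      ((measurable_pi_apply i).comp μ.measurable_vec)
  have hsub : G ≤ᵐ[P] shift ⁻¹' G := by
    filter_upwards [hμ, hreg] with ω h1 hω hpos j
    rw [h1]
    obtain ⟨i, hi⟩ := hω.exists_hm_pos 1 j
    simp only [Matrix.vecMul, dotProduct]
    exact Finset.sum_pos' (fun l _ => mul_nonneg (hpos l).le (hm_nonneg _ _ _ _ _))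
      ⟨i, Finset.mem_univ i, mul_pos (hpos i) (by exact_mod_cast hi)⟩
  rcases hC.ergodic.ae_empty_or_univ_of_ae_le_preimage hGm.nullMeasurableSet hsub with h | h
  · exfalso
    have h1 : ∀ᵐ ω ∂P, ω ∉ G := measure_eq_zero_iff_ae_notMem.1 (ae_eq_empty.1 h)
    obtain ⟨L, hL⟩ := exists_frequently_block hC hreg
    obtain ⟨ω, hpos, hnot, hω⟩ := (hL.and_eventually
      ((ae_shift_iterate hC.ergodic h1).and (ae_shift_iterate hC.ergodic hμ))).exists
    have hiter : ∀ n : ℕ, μ.vec (shift^[n] ω) = μ.vec ω ᵥ* hm ω 0 n := by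
      intro n
      induction n with
      | zero => simp [hm_self]
      | succ n ih =>
        rw [Function.iterate_succ_apply', hω n, ih, hm_shift_iterate, Matrix.vecMul_vecMul,
          zero_add, Nat.cast_add, Nat.cast_one, add_comm (1 : ℤ),
          ← hm_comp ω (by omega) (by omega)]
    refine hnot L fun j => ?_
    rw [hiter L]
    obtain ⟨i, hi⟩ := exists_pos_of_sum_pos (f := μ.vec ω)
      (by rw [(μ.mem_simplex ω).2]; exact one_pos)
    simp only [Matrix.vecMul, dotProduct]
    exact Finset.sum_pos' (fun l _ => mul_nonneg ((μ.mem_simplex ω).1 l) (hm_nonneg _ _ _ _ _))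
      ⟨i, Finset.mem_univ i, mul_pos hi (hpos i j)⟩
  · exact eventuallyEq_univ.1 h

end StripWalk

/-! ### The environment and the walk, seen from the hitting place of the next layer -/

namespace StripWalk

variable {d : ℕ} {ω : Env d}

/-- The map that restarts the walk at the hitting time of the layer `1` and shifts this layer to
the origin. -/
noncomputable def advance (p : Env d × Path d) : Env d × Path d := (shift p.1, tr (post 1 p.2))

lemma measurable_advance : Measurable (advance (d := d)) :=
  (measurable_shift.comp measurable_fst).prodMk
    (measurable_tr.comp ((measurable_post 1).comp measurable_snd))

lemma Regular.chain_post_tr (h : Regular ω) (i : Fin d) {D : Set (Path d)}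
    (hD : MeasurableSet D) :
    chain ω (0, i) {x | tr (post 1 x) ∈ D} =
      ∑ l, chain ω (0, i) (HitAt (1, l)) * chain (shift ω) (0, l) D := by
  have h1 := congrArg (fun m => m (tr ⁻¹' D))
    (map_post ω (0, i) 1 (h.ae_hits (z := (0, i)) zero_le_one))
  simp only [Measure.coe_finsetSum, Finset.sum_apply, Measure.smul_apply, smul_eq_mul] at h1
  rw [Measure.map_apply (measurable_post 1) (measurable_tr hD)] at h1
  refine h1.trans (Finset.sum_congr rfl fun l _ => ?_)
  rw [chain_shift, Measure.map_apply measurable_tr hD, zero_add]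

lemma quenchedLaw_apply (μ : InitialLaw d) (ω : Env d) (D : Set (Path d)) :
    quenchedLaw μ ω D = ∑ i, ENNReal.ofReal (μ.vec ω i) * chain ω (0, i) D := by
  rw [quenchedLaw_eq_sum]
  simp

/-- Here the choice of μ enters: the hitting distribution on layer 1 is the initial law prescribed
by the shifted environment. -/
lemma Regular.quenchedLaw_post_tr (h : Regular ω) {μ : InitialLaw d}
    (hμ : μ.vec (shift ω) = μ.vec ω ᵥ* hm ω 0 1) {D : Set (Path d)} (hD : MeasurableSet D) :
    quenchedLaw μ ω {x | tr (post 1 x) ∈ D} = quenchedLaw μ (shift ω) D := by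
  rw [quenchedLaw_apply, quenchedLaw_apply, hμ]
  simp only [h.chain_post_tr _ hD, ← ofReal_hm, Finset.mul_sum, Matrix.vecMul, dotProduct]
  rw [Finset.sum_comm]
  refine Finset.sum_congr rfl fun l _ => ?_
  rw [ENNReal.ofReal_sum_of_nonneg
    fun i _ => mul_nonneg ((μ.mem_simplex ω).1 i) (hm_nonneg _ _ _ _ _), Finset.sum_mul]
  refine Finset.sum_congr rfl fun i _ => ?_
  rw [ENNReal.ofReal_mul ((μ.mem_simplex ω).1 i), mul_assoc]

lemma annealedLaw_apply (P : Measure (Env d)) [IsProbabilityMeasure P] (μ : InitialLaw d)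
    {E : Set (Env d × Path d)} (hE : MeasurableSet E) :
    annealedLaw P μ E = ∫⁻ ω, quenchedLaw μ ω (Prod.mk ω ⁻¹' E) ∂P :=
  Measure.compProd_apply hE

instance (P : Measure (Env d)) [IsProbabilityMeasure P] (μ : InitialLaw d) :
    IsProbabilityMeasure (annealedLaw P μ) := by unfold annealedLaw; infer_instance

lemma measurePreserving_advance {P : Measure (Env d)} [IsProbabilityMeasure P]
    (hP : MeasurePreserving shift P P) (hreg : ∀ᵐ ω ∂P, Regular ω) {μ : InitialLaw d}
    (hμ : ∀ᵐ ω ∂P, μ.vec (shift ω) = μ.vec ω ᵥ* hm ω 0 1) :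
    MeasurePreserving advance (annealedLaw P μ) (annealedLaw P μ) := by
  refine ⟨measurable_advance, ?_⟩
  ext E hE
  rw [Measure.map_apply measurable_advance hE, annealedLaw_apply P μ (measurable_advance hE),
    annealedLaw_apply P μ hE]
  have hmeas : Measurable fun ω => quenchedLaw μ ω (Prod.mk ω ⁻¹' E) :=
    Kernel.measurable_kernel_prodMk_left (κ := quenchedKernel μ) hE
  rw [← hP.lintegral_comp hmeas]
  refine lintegral_congr_ae ?_
  filter_upwards [hreg, hμ] with ω h1 h2
  have h3 : Prod.mk ω ⁻¹' (advance ⁻¹' E) =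
      {x | tr (post 1 x) ∈ Prod.mk (shift ω) ⁻¹' E} := rfl
  rw [h3, h1.quenchedLaw_post_tr h2 (measurable_prodMk_left hE)]

/-! ### Iterates -/

/-- The translation of a path by `n` layers to the left. -/
def trN (n : ℕ) (x : Path d) : Path d := fun t => ((x t).1 - n, (x t).2)

lemma measurable_trN (n : ℕ) : Measurable (trN (d := d) n) :=
  measurable_pi_iff.2 fun t => (measurable_of_countable fun w : Strip d => (w.1 - n, w.2)).comp
    (measurable_pi_apply t)

lemma tr_trN (n : ℕ) (x : Path d) : tr (trN n x) = trN (n + 1) x := by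
  funext t
  simp only [tr, trN, Nat.cast_add, Nat.cast_one, sub_sub]

lemma tau_trN (n : ℕ) (x : Path d) : tau 1 (trN n x) = tau ((n + 1 : ℕ) : ℤ) x := by
  have h : ∀ t, (trN n x t).1 = 1 ↔ (x t).1 = ((n + 1 : ℕ) : ℤ) := fun t => by
    simp only [trN]
    push_cast
    omega
  simp only [tau, h]

lemma chain_shift_iterate (ω : Env d) (n : ℕ) (i : Fin d) :
    chain (shift^[n] ω) (0, i) = (chain ω (n, i)).map (trN n) := by
  have key : ∀ (n : ℕ) (m : ℤ), chain (shift^[n] ω) (m, i) =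
      (chain ω (m + n, i)).map (trN n) := by
    intro n
    induction n with
    | zero =>
      intro m
      have : trN (d := d) 0 = id := by
        funext x t
        simp [trN]
      simp [this]
    | succ n ih =>
      intro m
      rw [Function.iterate_succ_apply', chain_shift, ih,
        Measure.map_map measurable_tr (measurable_trN n)]
      have : tr ∘ trN (d := d) n = trN (n + 1) := funext fun x => tr_trN n x
      rw [this]
      congr 3
      push_cast
      ring
  have := key n 0
  rwa [zero_add] at this

/-- The typical paths of the walk from the layer `0`. -/
structure GoodPath (x : Path d) : Prop where
  nearest : NearestNeighbor x
  zero : (x 0).1 = 0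
  hits : ∀ n : ℕ, Hits n x

lemma Regular.ae_goodPath (h : Regular ω) (i : Fin d) : ∀ᵐ x ∂chain ω (0, i), GoodPath x := by
  filter_upwards [ae_chain_nearestNeighbor ω (0, i), ae_chain_zero ω (0, i),
    ae_all_iff.2 fun n : ℕ => h.ae_hits (z := (0, i)) (N := n) (by simp)] with x h1 h2 h3
  exact ⟨h1, by rw [h2], h3⟩

lemma ae_quenchedLaw {μ : InitialLaw d} {p : Path d → Prop}
    (h : ∀ i, ∀ᵐ x ∂chain ω (0, i), p x) : ∀ᵐ x ∂quenchedLaw μ ω, p x := by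
  change quenchedLaw μ ω {x | p x}ᶜ = 0
  rw [quenchedLaw_apply]
  refine Finset.sum_eq_zero fun i _ => ?_
  rw [show chain ω (0, i) {x | p x}ᶜ = 0 from h i, mul_zero]

lemma GoodPath.tau_mono {x : Path d} (h : GoodPath x) {m n : ℕ} (hmn : m ≤ n) :
    tau m x ≤ tau n x :=
  (h.nearest.hits_of_hits (by rw [h.zero]; simp) (by exact_mod_cast hmn) (h.hits n)).2

lemma GoodPath.tau_zero {x : Path d} (h : GoodPath x) : tau 0 x = 0 :=
  tau_eq h.zero (by simp)

lemma NearestNeighbor.le_add {x : Path d} (h : NearestNeighbor x) (t : ℕ) :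
    (x t).1 ≤ (x 0).1 + t := by
  induction t with
  | zero => simp
  | succ t ih =>
    have := abs_le.1 (h t)
    push_cast
    omega

lemma GoodPath.le_tau {x : Path d} (h : GoodPath x) (n : ℕ) : n ≤ tau n x := by
  have h1 := h.nearest.le_add (tau n x)
  rw [(h.hits n).tau_spec, h.zero] at h1
  omega

/-- Layers are hit in increasing order, so repeated restarts at the next layer amount to a single
restart at layer n. -/
lemma GoodPath.advance_iterate {x : Path d} (h : GoodPath x) (ω : Env d) (n : ℕ) :
    advance^[n] (ω, x) = (shift^[n] ω, trN n (post n x)) := by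
  induction n with
  | zero =>
    simp only [Function.iterate_zero, id_eq, Prod.mk.injEq, true_and]
    funext t
    simp only [trN, post, drop, Nat.cast_zero, sub_zero, h.tau_zero, zero_add]
  | succ n ih =>
    rw [Function.iterate_succ_apply', Function.iterate_succ_apply', ih, advance]
    have h1 : post 1 (trN n (post n x)) = trN n (post ((n + 1 : ℕ) : ℤ) (post n x)) := by
      funext s
      simp only [post, drop, tau_trN]
      rfl
    simp only [h1, tr_trN, post_post (h.hits (n + 1)) (h.tau_mono n.le_succ)]

lemma GoodPath.birkhoffSum_tau {x : Path d} (h : GoodPath x) (ω : Env d) (n : ℕ) :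
    birkhoffSum advance (fun p : Env d × Path d => (tau 1 p.2 : ℝ)) n (ω, x) = tau n x := by
  induction n with
  | zero => simp [h.tau_zero]
  | succ n ih =>
    rw [birkhoffSum_succ, ih, h.advance_iterate, tau_trN,
      (tau_eq_add (h.hits (n + 1)) (h.tau_mono n.le_succ)).2]
    push_cast
    rfl

/-! ### Ergodicity -/

lemma adapted_cyl_inter (a : Path d) {M : ℕ} (N : ℤ) (l : Fin d) (t : ℕ) :
    Adapted t (cyl a M ∩ {x | M < tau N x} ∩ FirstAt (N, l) t) := by
  intro x y hxy hx
  have hy := adapted_firstAt (N, l) t hxy hx.2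
  have h1 : tau N x = t := tau_eq_of_firstAt hx.2
  have h2 : tau N y = t := tau_eq_of_firstAt hy
  have h3 : M < tau N x := hx.1.2
  refine ⟨⟨adapted_cyl a M (fun k hk => hxy k (by omega)) hx.1.1, ?_⟩, hy⟩
  change M < tau N y
  omega

/-- An invariant event is independent of the path up to time M: layer N = M + 1 is hit after time M,
the event can be read off the path after that hit, and its conditional probability there is c
wherever the layer is hit. -/
lemma Regular.restrict_invariant (h : Regular ω) {A : Set (Env d × Path d)}
    (hA : MeasurableSet A) (hinv : advance ⁻¹' A = A) {c : ℝ≥0∞}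
    (hc : ∀ (n : ℕ) i, chain (shift^[n] ω) (0, i) (Prod.mk (shift^[n] ω) ⁻¹' A) = c)
    (i : Fin d) :
    (chain ω (0, i)).restrict (Prod.mk ω ⁻¹' A) = c • chain ω (0, i) := by
  refine ext_of_cyl fun a M => ?_
  set N : ℕ := M + 1
  set D : Set (Path d) := trN N ⁻¹' (Prod.mk (shift^[N] ω) ⁻¹' A)
  have hD : MeasurableSet D := measurable_trN N (measurable_prodMk_left hA)
  have hDc : ∀ l, chain ω (N, l) D = c := fun l => by
    rw [← hc N l, chain_shift_iterate, Measure.map_apply (measurable_trN N)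
      (measurable_prodMk_left hA)]
  -- The condition that the hit comes after time M makes the cylinder known at the hitting time, as
  -- the strong Markov property requires.
  set C : Set (Path d) := cyl a M ∩ {x | M < tau (N : ℤ) x}
  have hCm : MeasurableSet C := (measurableSet_cyl a M).inter
    (measurableSet_lt measurable_const (measurable_tau _))
  have hiterA : advance^[N] ⁻¹' A = A := by
    have : ∀ n : ℕ, advance^[n] ⁻¹' A = A := by
      intro n
      induction n with
      | zero => rfl
      | succ n ih => rw [Function.iterate_succ', Set.preimage_comp, hinv, ih]
    exact this N
  have hdisj : Pairwise (Function.onFun Disjoint fun l : Fin d => C ∩ HitAt (N, l)) :=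
    fun l l' hne => (disjoint_hitAt N hne).mono Set.inter_subset_right Set.inter_subset_right
  have h1 : chain ω (0, i) (cyl a M ∩ Prod.mk ω ⁻¹' A) =
      chain ω (0, i) (⋃ l, (C ∩ HitAt (N, l) ∩ post N ⁻¹' D)) := by
    refine measure_congr ?_
    filter_upwards [h.ae_goodPath i] with x hx
    have hmem : x ∈ Prod.mk ω ⁻¹' A ↔ x ∈ post N ⁻¹' D := by
      have : (ω, x) ∈ advance^[N] ⁻¹' A ↔ (ω, x) ∈ A := by rw [hiterA]
      rw [Set.mem_preimage, hx.advance_iterate] at this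
      exact this.symm
    refine propext ⟨fun hxA => Set.mem_iUnion.2 ⟨(x (tau N x)).2, ⟨⟨hxA.1, ?_⟩, ?_⟩,
      hmem.1 hxA.2⟩, fun hxU => ?_⟩
    · exact hx.le_tau N
    · exact ⟨hx.hits N, Prod.ext (hx.hits N).tau_spec rfl⟩
    · obtain ⟨l, hl⟩ := Set.mem_iUnion.1 hxU
      exact ⟨hl.1.1.1, hmem.2 hl.2⟩
  have h2 : chain ω (0, i) (cyl a M) = chain ω (0, i) (⋃ l, (C ∩ HitAt (N, l))) := by
    refine measure_congr ?_
    filter_upwards [h.ae_goodPath i] with x hx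
    refine propext ⟨fun hxA => Set.mem_iUnion.2 ⟨(x (tau N x)).2, ⟨hxA, hx.le_tau N⟩,
      hx.hits N, Prod.ext (hx.hits N).tau_spec rfl⟩, fun hxU => ?_⟩
    obtain ⟨l, hl⟩ := Set.mem_iUnion.1 hxU
    exact hl.1.1
  rw [Measure.restrict_apply (measurableSet_cyl a M), Measure.smul_apply, smul_eq_mul, h1, h2,
    measure_iUnion hdisj fun l => hCm.inter (measurableSet_hitAt _), measure_iUnion, tsum_fintype,
    tsum_fintype, Finset.mul_sum]
  · refine Finset.sum_congr rfl fun l _ => ?_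
    have := chain_inter_post ω (0, i) (N, l) (C := C) (adapted_cyl_inter a N l) hD
    rw [this, hDc, mul_comm]
  · intro l l' hne
    exact (hdisj hne).mono Set.inter_subset_left Set.inter_subset_left
  · exact fun l => (hCm.inter (measurableSet_hitAt _)).inter (measurable_post N hD)

lemma ergodic_advance (hd : 1 ≤ d) {P : Measure (Env d)} [IsProbabilityMeasure P]
    (hC : ConditionC P) (hreg : ∀ᵐ ω ∂P, Regular ω) {μ : InitialLaw d}
    (hμ : ∀ᵐ ω ∂P, μ.vec (shift ω) = μ.vec ω ᵥ* hm ω 0 1) :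
    Ergodic advance (annealedLaw P μ) := by
  refine ⟨measurePreserving_advance hC.ergodic.toMeasurePreserving hreg hμ, ⟨fun A hA hinv => ?_⟩⟩
  have hsec : ∀ ω : Env d, MeasurableSet (Prod.mk ω ⁻¹' A) := fun ω => measurable_prodMk_left hA
  set f : Env d → Fin d → ℝ := fun ω i => (chain ω (0, i) (Prod.mk ω ⁻¹' A)).toReal with hf
  have hfm : ∀ i, Measurable fun ω => f ω i := fun i =>
    (Kernel.measurable_kernel_prodMk_left (κ := chainKernel (0, i)) hA).ennreal_toReal
  have hharm : ∀ᵐ ω ∂P, f ω = hm ω 0 1 *ᵥ f (shift ω) := by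
    filter_upwards [hreg] with ω hω
    funext i
    have h1 : (Prod.mk ω ⁻¹' A) = {x | tr (post 1 x) ∈ Prod.mk (shift ω) ⁻¹' A} := by
      conv_lhs => rw [← hinv]
      rfl
    simp only [hf, Matrix.mulVec, dotProduct]
    rw [h1, hω.chain_post_tr i (hsec _), ENNReal.toReal_sum
      fun l _ => ENNReal.mul_ne_top (measure_ne_top _ _) (measure_ne_top _ _)]
    simp only [ENNReal.toReal_mul]
    rfl
  obtain ⟨c, hc⟩ := ae_eq_const_of_harmonic hd hC hreg hfm (fun _ _ => ENNReal.toReal_nonneg)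
    (fun _ _ => ENNReal.toReal_le_of_le_ofReal zero_le_one (by simpa using prob_le_one)) hharm
  have hchain : ∀ᵐ ω ∂P, ∀ (n : ℕ) i,
      chain (shift^[n] ω) (0, i) (Prod.mk (shift^[n] ω) ⁻¹' A) = ENNReal.ofReal c := by
    filter_upwards [ae_shift_iterate hC.ergodic hc] with ω hω n i
    rw [← hω n i, hf, ENNReal.ofReal_toReal (measure_ne_top _ _)]
  -- Evaluating the independence relation on the event itself gives c = c · c.
  have hidem : ENNReal.ofReal c = 0 ∨ ENNReal.ofReal c = 1 := by
    obtain ⟨ω, hω, hcω⟩ := (hreg.and hchain).exists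
    have h1 := congrArg (fun m => m (Prod.mk ω ⁻¹' A)) (hω.restrict_invariant hA hinv hcω ⟨0, hd⟩)
    simp only [Measure.smul_apply, smul_eq_mul] at h1
    rw [Measure.restrict_apply_self, show chain ω (0, ⟨0, hd⟩) (Prod.mk ω ⁻¹' A) =
      ENNReal.ofReal c from hcω 0 _] at h1
    by_cases h0 : ENNReal.ofReal c = 0
    · exact Or.inl h0
    · refine Or.inr ?_
      have h2 : ENNReal.ofReal c * 1 = ENNReal.ofReal c * ENNReal.ofReal c := by rwa [mul_one]
      exact ((ENNReal.mul_right_inj h0 ENNReal.ofReal_ne_top).1 h2).symm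
  have hval : annealedLaw P μ A = ENNReal.ofReal c := by
    rw [annealedLaw_apply P μ hA]
    have : ∀ᵐ ω ∂P, quenchedLaw μ ω (Prod.mk ω ⁻¹' A) = ENNReal.ofReal c := by
      filter_upwards [hchain] with ω hω
      rw [quenchedLaw_apply]
      simp only [show ∀ i, chain ω (0, i) (Prod.mk ω ⁻¹' A) = ENNReal.ofReal c from hω 0]
      rw [← Finset.sum_mul, ← ENNReal.ofReal_sum_of_nonneg fun i _ => (μ.mem_simplex ω).1 i,
        (μ.mem_simplex ω).2, ENNReal.ofReal_one, one_mul]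
    rw [lintegral_congr_ae this]
    simp
  rw [eventuallyConst_set']
  rcases hidem with h | h
  · exact Or.inl (ae_eq_empty.2 (hval.trans h))
  · exact Or.inr (eventuallyEq_univ.2 ((mem_ae_iff_prob_eq_one hA).2 (hval.trans h)))

end StripWalk

/-! ### From hitting times to the speed -/

namespace StripWalk

variable {d : ℕ} {ω : Env d}

lemma NearestNeighbor.sub_le {x : Path d} (h : NearestNeighbor x) (s t : ℕ) :
    (x s).1 - t ≤ (x (s + t)).1 := by
  induction t with
  | zero => simp
  | succ t ih =>
    have := abs_le.1 (h (s + t))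
    rw [← add_assoc]
    push_cast
    omega

/-- The largest `k ≤ n` such that the layer `k` has been hit by time `n`. -/
noncomputable def topLayer (x : Path d) (n : ℕ) : ℕ :=
  Nat.findGreatest (fun k => tau (k : ℤ) x ≤ n) n

lemma GoodPath.tau_topLayer_le {x : Path d} (h : GoodPath x) (n : ℕ) :
    tau (topLayer x n : ℤ) x ≤ n :=
  Nat.findGreatest_spec (P := fun k => tau (k : ℤ) x ≤ n) (m := 0) (Nat.zero_le n)
    (by simp [h.tau_zero])

lemma GoodPath.lt_tau_topLayer_succ {x : Path d} (h : GoodPath x) (n : ℕ) :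
    n < tau ((topLayer x n + 1 : ℕ) : ℤ) x := by
  rcases le_or_gt (topLayer x n + 1) n with h1 | h1
  · exact not_le.1 (Nat.findGreatest_is_greatest (P := fun k => tau (k : ℤ) x ≤ n)
      (Nat.lt_succ_self _) h1)
  -- The search bound n in `topLayer` loses nothing, because layer k cannot be hit before time k.
  · exact h1.trans_le (h.le_tau _)

lemma GoodPath.tendsto_topLayer {x : Path d} (h : GoodPath x) :
    Tendsto (topLayer x) atTop atTop := by
  refine tendsto_atTop.2 fun K => ?_
  filter_upwards [eventually_ge_atTop (tau (K : ℤ) x)] with n hn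
  exact Nat.le_findGreatest ((h.le_tau K).trans hn) hn

lemma GoodPath.le_topLayer {x : Path d} (h : GoodPath x) (n : ℕ) : (x n).1 ≤ topLayer x n := by
  by_contra! hlt
  obtain ⟨s, hs, hN⟩ := h.nearest.exists_eq (M := ((topLayer x n + 1 : ℕ) : ℤ)) (t := n)
    (by rw [h.zero]; positivity) (by push_cast; omega)
  exact absurd (h.lt_tau_topLayer_succ n) (not_lt.2 ((tau_le hN).trans hs))

/-- Since the top layer was hit, the walk has moved left by at most one layer per step. -/
lemma GoodPath.topLayer_sub_le {x : Path d} (h : GoodPath x) (n : ℕ) :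
    (topLayer x n : ℤ) - (n - tau (topLayer x n : ℤ) x : ℤ) ≤ (x n).1 := by
  have h1 := h.nearest.sub_le (tau (topLayer x n : ℤ) x) (n - tau (topLayer x n : ℤ) x)
  rw [Nat.add_sub_cancel' (h.tau_topLayer_le n), (h.hits _).tau_spec,
    Nat.cast_sub (h.tau_topLayer_le n)] at h1
  exact h1

/-- If the hitting times grow linearly, then the walk has a speed. -/
lemma GoodPath.tendsto_div {x : Path d} (h : GoodPath x) {c : ℝ} (hc : 0 < c)
    (hlim : Tendsto (fun n : ℕ => (tau (n : ℤ) x : ℝ) / n) atTop (𝓝 c)) :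
    Tendsto (fun n : ℕ => ((x n).1 : ℝ) / n) atTop (𝓝 (1 / c)) := by
  have hm := h.tendsto_topLayer
  have hu : Tendsto (fun n => (tau (topLayer x n : ℤ) x : ℝ) / topLayer x n) atTop (𝓝 c) :=
    hlim.comp hm
  have hv0 : Tendsto (fun k : ℕ => (tau ((k + 1 : ℕ) : ℤ) x : ℝ) / k) atTop (𝓝 c) := by
    have h1 := ((tendsto_add_atTop_iff_nat 1).2 hlim).mul
      (tendsto_const_nhds.add (tendsto_one_div_atTop_nhds_zero_nat (𝕜 := ℝ)) :
        Tendsto (fun k : ℕ => (1 : ℝ) + 1 / k) atTop (𝓝 (1 + 0)))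
    rw [add_zero, mul_one] at h1
    refine h1.congr' ?_
    filter_upwards [eventually_gt_atTop 0] with k hk
    have hk' : (k : ℝ) ≠ 0 := by positivity
    push_cast
    field_simp
  have hv : Tendsto (fun n => (tau ((topLayer x n + 1 : ℕ) : ℤ) x : ℝ) / topLayer x n) atTop
      (𝓝 c) := hv0.comp hm
  -- Time n lies between the hitting times of the top layer and of the next one, which have the same
  -- linear growth.
  have hn : Tendsto (fun n : ℕ => (n : ℝ) / topLayer x n) atTop (𝓝 c) := by
    refine tendsto_of_tendsto_of_tendsto_of_le_of_le hu hv (fun n => ?_) (fun n => ?_)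
    · exact div_le_div_of_nonneg_right (Nat.cast_le.2 (h.tau_topLayer_le n))
        (Nat.cast_nonneg _)
    · exact div_le_div_of_nonneg_right (Nat.cast_le.2 (h.lt_tau_topLayer_succ n).le)
        (Nat.cast_nonneg _)
  have hmn : Tendsto (fun n : ℕ => (topLayer x n : ℝ) / n) atTop (𝓝 (1 / c)) := by
    have := hn.inv₀ hc.ne'
    simpa only [inv_div, one_div] using this
  -- The time elapsed since the top layer was hit is o(n), so the possible backtracking is
  -- negligible.
  have htau : Tendsto (fun n : ℕ => (tau (topLayer x n : ℤ) x : ℝ) / n) atTop (𝓝 1) := by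
    have h1 := hu.mul hmn
    rw [mul_one_div_cancel hc.ne'] at h1
    refine h1.congr' ?_
    filter_upwards [hm.eventually (eventually_gt_atTop 0)] with n hn0
    have : (topLayer x n : ℝ) ≠ 0 := by positivity
    field_simp
  have hlow : Tendsto (fun n : ℕ => (topLayer x n : ℝ) / n -
      (1 - (tau (topLayer x n : ℤ) x : ℝ) / n)) atTop (𝓝 (1 / c)) := by
    have := hmn.sub (tendsto_const_nhds (x := (1 : ℝ)).sub htau)
    simpa using this
  refine tendsto_of_tendsto_of_tendsto_of_le_of_le' hlow hmn ?_ ?_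
  · filter_upwards [eventually_gt_atTop 0] with n hn0
    have h1 : ((topLayer x n : ℝ) - (n - tau (topLayer x n : ℤ) x)) ≤ ((x n).1 : ℝ) := by
      exact_mod_cast h.topLayer_sub_le n
    have hn' : (n : ℝ) ≠ 0 := by positivity
    calc _ = ((topLayer x n : ℝ) - (n - tau (topLayer x n : ℤ) x)) / n := by field_simp
      _ ≤ _ := div_le_div_of_nonneg_right h1 (by positivity)
  · refine Eventually.of_forall fun n => div_le_div_of_nonneg_right ?_ (by positivity)
    exact_mod_cast h.le_topLayer n

/-! ### The annealed expectation of the crossing time -/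

lemma hitTime_eq_tau {N : ℤ} {x : Path d} (h : Hits N x) : hitTime N x = (tau N x : ℕ∞) :=
  le_antisymm (iInf₂_le (f := fun t (_ : (x t).1 = N) => (t : ℕ∞)) (tau N x) h.tau_spec)
    (le_iInf₂ fun _ ht => Nat.cast_le.2 (tau_le ht))

lemma measurableSet_goodPath : MeasurableSet {x : Path d | GoodPath x} := by
  have h : {x : Path d | GoodPath x} = (⋂ t : ℕ, {x | |(x (t + 1)).1 - (x t).1| ≤ 1}) ∩
      {x | (x 0).1 = 0} ∩ ⋂ n : ℕ, {x | Hits n x} := by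
    ext x
    simp only [Set.mem_inter_iff, Set.mem_iInter, Set.mem_ofPred_eq]
    exact ⟨fun h => ⟨⟨h.nearest, h.zero⟩, h.hits⟩, fun h => ⟨h.1.1, h.1.2, h.2⟩⟩
  rw [h]
  refine ((MeasurableSet.iInter fun t => ?_).inter ?_).inter
    (MeasurableSet.iInter fun n => measurableSet_hits n)
  · refine Adapted.measurableSet (t := t + 1) fun x y hxy hx => ?_
    simpa only [Set.mem_ofPred_eq, hxy (t + 1) le_rfl, hxy t t.le_succ] using hx
  · refine Adapted.measurableSet (t := 0) fun x y hxy hx => ?_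
    simpa only [Set.mem_ofPred_eq, hxy 0 le_rfl] using hx

lemma ae_annealedLaw_goodPath {P : Measure (Env d)} [IsProbabilityMeasure P] {μ : InitialLaw d}
    (hreg : ∀ᵐ ω ∂P, Regular ω) : ∀ᵐ p ∂annealedLaw P μ, GoodPath p.2 := by
  refine Measure.ae_compProd_of_ae_ae (measurable_snd measurableSet_goodPath) ?_
  filter_upwards [hreg] with ω hω
  exact ae_quenchedLaw fun i => hω.ae_goodPath i

/-- The quenched expectation of the crossing time from the layer `0`. -/
noncomputable def meanCross (μ : InitialLaw d) (ω : Env d) : ℝ≥0∞ :=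
  ∫⁻ x, (tau 1 x : ℝ≥0∞) ∂quenchedKernel μ ω

lemma measurable_meanCross (μ : InitialLaw d) : Measurable (meanCross μ) :=
  (measurable_tau_enn 1).lintegral_kernel

lemma meanCross_eq_sum (μ : InitialLaw d) (ω : Env d) :
    meanCross μ ω = ∑ i, ENNReal.ofReal (μ.vec ω i) * crossTime ω 0 i := by
  change ∫⁻ x, (tau 1 x : ℝ≥0∞) ∂quenchedLaw μ ω = _
  rw [quenchedLaw_eq_sum]
  simp [lintegral_finsetSum_measure, lintegral_smul_measure, crossTime]

lemma lintegral_tau_annealedLaw (P : Measure (Env d)) [IsProbabilityMeasure P]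
    (μ : InitialLaw d) :
    ∫⁻ p, (tau 1 p.2 : ℝ≥0∞) ∂annealedLaw P μ = ∫⁻ ω, meanCross μ ω ∂P :=
  Measure.lintegral_compProd ((measurable_tau_enn 1).comp measurable_snd)

lemma Regular.seriesValue_eq (h : Regular ω) {μ : InitialLaw d} (hμ : μ.vec ω = vecY ω (-1))
    (h0 : ∀ i, crossTime ω 0 i ≠ ∞) : seriesValue ω = (meanCross μ ω).toReal := by
  rw [seriesValue, ← hμ, meanCross_eq_sum, ENNReal.toReal_sum
    fun i _ => ENNReal.mul_ne_top ENNReal.ofReal_ne_top (h0 i)]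
  refine Finset.sum_congr rfl fun i _ => ?_
  rw [h.tsum_seriesTerm h0, ENNReal.toReal_mul, ENNReal.toReal_ofReal ((μ.mem_simplex ω).1 i)]

end StripWalk

/-! ### The law of large numbers -/

open StripWalk
theorem corollary1 (d : ℕ) (hd : 1 ≤ d)
    (P : Measure (Env d)) [IsProbabilityMeasure P] (hC : ConditionC P)
    (μ : InitialLaw d) (hμ : ∀ᵐ ω ∂P, μ.vec ω = vecY ω (-1))
    (htrans : ∀ᵐ p ∂(annealedLaw P μ), Tendsto (fun t => (p.2 t).1) atTop atTop)
    (hspeed : 0 < speed P μ) :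
    (∀ᵐ ω ∂P, Summable (seriesTerm ω)) ∧
    Integrable (fun ω : Env d => seriesValue ω) P ∧
    0 < ∫ ω : Env d, seriesValue ω ∂P ∧
    ∀ᵐ p ∂(annealedLaw P μ),
      Tendsto (fun n : ℕ => ((p.2 n).1 : ℝ) / (n : ℝ)) atTop
        (𝓝 (1 / ∫ ω : Env d, seriesValue ω ∂P)) := by
  have hreg := ae_regular hC μ htrans
  have hvec := ae_vec_shift hd hC hreg hμ
  have hgood := ae_annealedLaw_goodPath (μ := μ) hreg
  have hfin : ∫⁻ p, (tau 1 p.2 : ℝ≥0∞) ∂annealedLaw P μ ≠ ∞ := by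
    have h1 : ∫⁻ p, (hitTime 1 p.2 : ℝ≥0∞) ∂annealedLaw P μ =
        ∫⁻ p, (tau 1 p.2 : ℝ≥0∞) ∂annealedLaw P μ := by
      refine lintegral_congr_ae ?_
      filter_upwards [hgood] with p hp
      rw [hitTime_eq_tau (by simpa using hp.hits 1)]
      rfl
    rw [← h1]
    exact (ENNReal.inv_pos.1 hspeed)
  have hfin' : ∫⁻ ω, meanCross μ ω ∂P ≠ ∞ := by rwa [← lintegral_tau_annealedLaw]
  have hmean : ∀ᵐ ω ∂P, meanCross μ ω < ∞ := ae_lt_top (measurable_meanCross μ) hfin'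
  -- A finite average with strictly positive weights has all its terms finite.
  have hcross : ∀ᵐ ω ∂P, ∀ i, crossTime ω 0 i ≠ ∞ := by
    filter_upwards [hmean, ae_vec_pos hC hreg hvec] with ω h1 h2 i
    rw [meanCross_eq_sum] at h1
    exact (ENNReal.lt_top_of_mul_ne_top_right
      (ENNReal.sum_ne_top.1 h1.ne i (Finset.mem_univ i)) (ENNReal.ofReal_pos.2 (h2 i)).ne').ne
  have hval : ∀ᵐ ω ∂P, (meanCross μ ω).toReal = seriesValue ω := by
    filter_upwards [hreg, hμ, hcross] with ω h1 h2 h3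
    exact (h1.seriesValue_eq h2 h3).symm
  have hint : ∫ ω, seriesValue ω ∂P =
      (∫⁻ p, (tau 1 p.2 : ℝ≥0∞) ∂annealedLaw P μ).toReal := by
    rw [← integral_congr_ae hval, integral_toReal (measurable_meanCross μ).aemeasurable hmean,
      lintegral_tau_annealedLaw]
  have hpos : 0 < ∫ ω, seriesValue ω ∂P := by
    rw [hint]
    refine ENNReal.toReal_pos ?_ hfin
    -- At least one step is needed to reach layer 1, so 𝔼T_1 ≥ 1.
    have h1 : ∫⁻ _, 1 ∂annealedLaw P μ ≤ ∫⁻ p, (tau 1 p.2 : ℝ≥0∞) ∂annealedLaw P μ := by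
      refine lintegral_mono_ae ?_
      filter_upwards [hgood] with p hp
      exact_mod_cast hp.le_tau 1
    rw [lintegral_const, measure_univ, mul_one] at h1
    exact (one_pos.trans_le h1).ne'
  refine ⟨?_, ?_, hpos, ?_⟩
  · filter_upwards [hreg, hcross] with ω h1 h2
    exact h1.summable_seriesTerm h2
  · exact (integrable_toReal_of_lintegral_ne_top (measurable_meanCross μ).aemeasurable
      hfin').congr hval
  · have hmeas : Measurable fun p : Env d × Path d => (tau 1 p.2 : ℝ≥0∞) :=
      (measurable_tau_enn 1).comp measurable_snd
    have hI := integrable_toReal_of_lintegral_ne_top hmeas.aemeasurable hfin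
    have hbirk := BirkhoffErgodic.ae_tendsto_birkhoffSum_div (ergodic_advance hd hC hreg hvec)
      hmeas.ennreal_toReal hI
    rw [integral_toReal hmeas.aemeasurable (ae_lt_top hmeas hfin), ← hint] at hbirk
    simp only [ENNReal.toReal_natCast] at hbirk
    filter_upwards [hbirk, hgood] with p h1 h2
    refine h2.tendsto_div hpos ?_
    simpa only [h2.birkhoffSum_tau p.1] using h1
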